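/- Let $Q(m,n)=am^2+bmn+cn^2$ be a positive definite binary quadratic form with arbitrary real coefficients ($a>0$, $4ac-b^2>0$), and let $\zeta_Q$ be its Epstein zeta-function, that is, the analytic continuation to $\mathbb{C}\setminus\{1\}$ of the series $\sum_{(m,n)\in\mathbb{Z}^2\setminus\{(0,0)\}}Q(m,n)^{-s}$ ($\operatorname{Re} s>1$). For $\sigma\in\mathbb{R}$ and $T>0$ let $N_Q^*(\sigma,T)$ be the number of zeros, counted with multiplicity, of $\zeta_Q(s)$ with $\operatorname{Re} s=\sigma$ and $|\operatorname{Im} s|\le T$, and put $N_Q(\sigma,T)=\sum_{\sigma'\ge\sigma}N_Q^*(\sigma',T)$. Then, for every $T>0$, $$N_Q^*(\tfrac14,T)=N_Q^*(\tfrac34,T)\le N_Q(\tfrac34,T)<\infty,$$ and $N_Q(\tfrac34,T)=o(T\log T)$ as $T\to\infty$ (for each fixed $Q$). -/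

import Mathlib

namespace EpsteinZeta

open Real Complex Filter Topology Asymptotics Set MeasureTheory

/-- The binary quadratic form `a m² + b m n + c n²` at an integer point. -/
noncomputable def form (a b c : ℝ) (p : ℤ × ℤ) : ℝ :=
  a * (p.1 : ℝ) ^ 2 + b * p.1 * p.2 + c * (p.2 : ℝ) ^ 2

theorem exists_form_lower {a b c : ℝ} (ha : 0 < a) (hD : 0 < 4 * a * c - b ^ 2) :
    ∃ δ : ℝ, 0 < δ ∧ ∀ p : ℤ × ℤ, δ * ((p.1 : ℝ) ^ 2 + (p.2 : ℝ) ^ 2) ≤ form a b c p := by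
  have hc : 0 < c := by
    by_contra h
    nlinarith [sq_nonneg b, mul_nonneg ha.le (not_lt.mp h |> neg_nonneg.mpr)]
  refine ⟨(4 * a * c - b ^ 2) / (4 * (a + c)), by positivity, fun p ↦ ?_⟩
  rw [div_mul_eq_mul_div, div_le_iff₀ (by positivity), form]
  nlinarith [sq_nonneg (2 * a * p.1 + b * p.2), sq_nonneg (2 * c * p.2 + b * p.1)]

theorem one_le_sq_add_sq {p : ℤ × ℤ} (hp : p ≠ 0) : (1 : ℝ) ≤ (p.1 : ℝ) ^ 2 + (p.2 : ℝ) ^ 2 := by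
  have : 0 < p.1 ^ 2 + p.2 ^ 2 := by
    by_contra h
    apply hp
    have h1 : p.1 = 0 := by nlinarith [sq_nonneg p.1, sq_nonneg p.2]
    have h2 : p.2 = 0 := by nlinarith [sq_nonneg p.1, sq_nonneg p.2]
    exact Prod.ext h1 h2
  exact_mod_cast this

theorem form_pos {a b c : ℝ} (ha : 0 < a) (hD : 0 < 4 * a * c - b ^ 2) {p : ℤ × ℤ}
    (hp : p ≠ 0) : 0 < form a b c p := by
  obtain ⟨δ, hδ, h⟩ := exists_form_lower ha hD
  have := h p
  nlinarith [one_le_sq_add_sq hp]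

theorem summable_gauss {r : ℝ} (hr : 0 < r) : Summable fun n : ℤ ↦ rexp (-r * (n : ℝ) ^ 2) := by
  have h := (summable_jacobiTheta₂_term_iff 0 (I * (r / π : ℝ))).mpr (by
    simp; positivity)
  refine h.norm.congr fun n ↦ ?_
  rw [norm_jacobiTheta₂_term]
  congr 1
  simp
  field_simp

theorem summable_theta {a b c : ℝ} (ha : 0 < a) (hD : 0 < 4 * a * c - b ^ 2) {t : ℝ}
    (ht : 0 < t) : Summable fun p : ℤ × ℤ ↦ rexp (-π * form a b c p * t) := by
  obtain ⟨δ, hδ, h⟩ := exists_form_lower ha hD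
  have h1 := summable_gauss (r := π * δ * t) (by positivity)
  refine (h1.mul_of_nonneg h1 (fun _ ↦ (exp_pos _).le) (fun _ ↦ (exp_pos _).le)).of_nonneg_of_le
    (fun _ ↦ (exp_pos _).le) fun p ↦ ?_
  rw [← Real.exp_add]
  refine Real.exp_le_exp.mpr ?_
  have := mul_le_mul_of_nonneg_left (h p) (by positivity : 0 ≤ π * t)
  linarith

theorem summable_zeta {a b c : ℝ} (ha : 0 < a) (hD : 0 < 4 * a * c - b ^ 2) {σ : ℝ}
    (hσ : 1 < σ) : Summable fun p : {p : ℤ × ℤ // p ≠ 0} ↦ 1 / form a b c p ^ σ := by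
  obtain ⟨δ, hδ, h⟩ := exists_form_lower ha hD
  have h1 : Summable fun p : ℤ × ℤ ↦ ‖![p.1, p.2]‖ ^ (-(2 * σ)) :=
    (finTwoArrowEquiv ℤ).symm.summable_iff.mpr
      (EisensteinSeries.summable_one_div_norm_rpow (k := 2 * σ) (by linarith))
  refine ((h1.subtype _).mul_left (δ ^ (-σ))).of_nonneg_of_le
    (fun p ↦ by have := form_pos ha hD p.2; positivity) fun p ↦ ?_
  have hn : 0 < ‖![p.1.1, p.1.2]‖ := by
    rw [norm_pos_iff]
    intro h0
    exact p.2 (Prod.ext (by simpa using congrFun h0 0) (by simpa using congrFun h0 1))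
  have hle : ‖![p.1.1, p.1.2]‖ ^ 2 ≤ (p.1.1 : ℝ) ^ 2 + (p.1.2 : ℝ) ^ 2 := by
    have : ‖![p.1.1, p.1.2]‖ ≤ √((p.1.1 : ℝ) ^ 2 + (p.1.2 : ℝ) ^ 2) := by
      refine (pi_norm_le_iff_of_nonneg (Real.sqrt_nonneg _)).mpr fun i ↦ ?_
      refine Real.le_sqrt_of_sq_le ?_
      fin_cases i <;> simp [Int.norm_eq_abs, sq_nonneg]
    calc _ ≤ _ := pow_le_pow_left₀ (norm_nonneg _) this 2
      _ = _ := Real.sq_sqrt (by positivity)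
  have hb : δ * ‖![p.1.1, p.1.2]‖ ^ 2 ≤ form a b c p :=
    (mul_le_mul_of_nonneg_left hle hδ.le).trans (h p)
  have e : δ ^ (-σ) * ‖![p.1.1, p.1.2]‖ ^ (-(2 * σ)) = 1 / (δ * ‖![p.1.1, p.1.2]‖ ^ 2) ^ σ := by
    rw [Real.mul_rpow hδ.le (by positivity), ← Real.rpow_natCast, ← Real.rpow_mul hn.le,
      Real.rpow_neg hδ.le, Real.rpow_neg hn.le]
    push_cast
    field_simp
  simp only [Function.comp_def]
  rw [e]
  exact one_div_le_one_div_of_le (by positivity)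
    (Real.rpow_le_rpow (by positivity) hb (by linarith))

/-- The theta series of a form. -/
noncomputable def theta (a b c t : ℝ) : ℝ := ∑' p : ℤ × ℤ, rexp (-π * form a b c p * t)

theorem hasSum_theta_sub_one {a b c : ℝ} (ha : 0 < a) (hD : 0 < 4 * a * c - b ^ 2) {t : ℝ}
    (ht : 0 < t) : HasSum (fun p : {p : ℤ × ℤ // p ≠ 0} ↦ rexp (-π * form a b c p * t))
      (theta a b c t - 1) := by
  have h := (summable_theta ha hD ht).hasSum
  have h2 := (Finset.hasSum_compl_iff {(0 : ℤ × ℤ)} (f := fun p : ℤ × ℤ ↦ rexp (-π * form a b c p * t))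
    (a := theta a b c t - 1)).mpr (by simpa [form, theta] using h)
  exact (Equiv.subtypeEquivRight (q := fun p ↦ p ∉ ({0} : Finset (ℤ × ℤ))) (p := fun p : ℤ × ℤ ↦ p ≠ 0)
    (by simp)).hasSum_iff.mpr h2

theorem continuousOn_theta {a b c : ℝ} (ha : 0 < a) (hD : 0 < 4 * a * c - b ^ 2) :
    ContinuousOn (theta a b c) (Ioi 0) := by
  intro t ht
  have ht : 0 < t := ht
  have : ContinuousOn (theta a b c) (Ioi (t / 2)) := by
    refine continuousOn_tsum (u := fun p ↦ rexp (-π * form a b c p * (t / 2)))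
      (fun p ↦ by fun_prop) (summable_theta ha hD (by positivity)) fun p x hx ↦ ?_
    have hq : 0 ≤ form a b c p := by
      rcases eq_or_ne p 0 with rfl | hp
      · simp [form]
      · exact (form_pos ha hD hp).le
    rw [Real.norm_of_nonneg (exp_pos _).le]
    refine Real.exp_le_exp.mpr ?_
    have := mul_le_mul_of_nonneg_left (le_of_lt hx) (by positivity : 0 ≤ π * form a b c p)
    linarith
  exact (this.continuousAt (Ioi_mem_nhds (by linarith))).continuousWithinAt

theorem theta_sub_one_isBigO {a b c : ℝ} (ha : 0 < a) (hD : 0 < 4 * a * c - b ^ 2) (r : ℝ) :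
    (fun t ↦ theta a b c t - 1) =O[atTop] (· ^ r) := by
  obtain ⟨δ, hδ, h⟩ := exists_form_lower ha hD
  have key : (fun t ↦ theta a b c t - 1) =O[atTop] fun t ↦ rexp (-(π * δ) * t) := by
    refine IsBigO.of_bound (rexp (π * δ) * (theta a b c 1 - 1)) ?_
    filter_upwards [eventually_ge_atTop 1] with t ht
    have h1 := hasSum_theta_sub_one ha hD (zero_lt_one)
    have h2 := hasSum_theta_sub_one ha hD (zero_lt_one.trans_le ht)
    rw [Real.norm_of_nonneg (h2.nonneg fun _ ↦ (exp_pos _).le), Real.norm_of_nonneg (exp_pos _).le]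
    have h3 := h1.mul_left (rexp (π * δ) * rexp (-(π * δ) * t))
    refine (hasSum_le (fun p ↦ ?_) h2 h3).trans (le_of_eq (by ring))
    rw [← Real.exp_add, ← Real.exp_add]
    refine Real.exp_le_exp.mpr ?_
    have hp : δ ≤ form a b c p := by
      have := h p
      nlinarith [one_le_sq_add_sq p.2]
    nlinarith [mul_nonneg (mul_nonneg pi_pos.le (sub_nonneg.mpr hp)) (sub_nonneg.mpr ht)]
  exact key.trans (isLittleO_exp_neg_mul_rpow_atTop (by positivity) r).isBigO

/-- Poisson summation in both variables, for a form of discriminant `-4`. -/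
theorem theta_inv {a b c : ℝ} (ha : 0 < a) (hD : 4 * a * c - b ^ 2 = 4) {t : ℝ} (ht : 0 < t) :
    theta a b c (1 / t) = t * theta a b c t := by
  have hD' : 0 < 4 * a * c - b ^ 2 := by rw [hD]; norm_num
  have haC : (a : ℂ) ≠ 0 := ofReal_ne_zero.mpr ha.ne'
  have htC : (t : ℂ) ≠ 0 := ofReal_ne_zero.mpr ht.ne'
  have hDC : 4 * (a : ℂ) * c - b ^ 2 = 4 := by exact_mod_cast hD
  have s1 {x : ℝ} (hx : 0 < x) : Summable fun p : ℤ × ℤ ↦ cexp (-π * form a b c p * x) := by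
    have := Complex.hasSum_ofReal.mpr (summable_theta ha hD' hx).hasSum
    push_cast at this
    exact this.summable
  have th {x : ℝ} : (theta a b c x : ℂ) = ∑' p : ℤ × ℤ, cexp (-π * form a b c p * x) := by
    rw [theta, Complex.ofReal_tsum]
    push_cast
    rfl
  let F : ℤ → ℤ → ℂ := fun n k ↦ cexp (-π * t / a * k ^ 2) *
    cexp (-π * (1 / (a * t) : ℝ) * n ^ 2 + 2 * π * (I * b * k / (2 * a)) * n)
  have sF : Summable (Function.uncurry F) := by
    have h1 := summable_gauss (r := π * (1 / (a * t))) (by positivity)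
    have h2 := summable_gauss (r := π * t / a) (by positivity)
    refine Summable.of_norm ((h1.mul_of_nonneg h2 (fun _ ↦ (exp_pos _).le)
      (fun _ ↦ (exp_pos _).le)).congr fun p ↦ ?_)
    simp only [Function.uncurry, F, norm_mul, Complex.norm_exp]
    rw [mul_comm]
    congr 2
    · rw [show (-π * t / a * p.2 ^ 2 : ℂ) = ((-(π * t / a) * p.2 ^ 2 : ℝ) : ℂ) by
        push_cast; ring, ofReal_re]
    · rw [show (-π * (1 / (a * t) : ℝ) * p.1 ^ 2 + 2 * π * (I * b * p.2 / (2 * a)) * p.1 : ℂ)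
        = ((-(π * (1 / (a * t))) * p.1 ^ 2 : ℝ) : ℂ) + ((π * b * p.2 / a * p.1 : ℝ) : ℂ) * I by
        push_cast; field_simp]
      simp [-ofReal_mul, -ofReal_div, -ofReal_neg]
  have A : ∑' p : ℤ × ℤ, cexp (-π * form a b c p * (1 / t : ℝ)) =
      1 / ((a / t : ℝ) : ℂ) ^ (1 / 2 : ℂ) * ∑' n, ∑' k, F n k := by
    have hs := s1 (one_div_pos.mpr ht)
    rw [← (Equiv.prodComm ℤ ℤ).tsum_eq, Summable.tsum_prod (f := fun p ↦ cexp (-π * form a b c (Equiv.prodComm ℤ ℤ p) * (1 / t : ℝ)))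
      ((Equiv.prodComm ℤ ℤ).summable_iff.mpr hs),
      ← tsum_mul_left]
    refine tsum_congr fun n ↦ ?_
    have h := Complex.tsum_exp_neg_quadratic (a := (a / t : ℝ)) (by rw [ofReal_re]; positivity)
      (-b * n / (2 * t))
    calc _ = ∑' m : ℤ, cexp (-π * c * n ^ 2 / t) *
          cexp (-π * (a / t : ℝ) * m ^ 2 + 2 * π * (-b * n / (2 * t)) * m) := by
          refine tsum_congr fun m ↦ ?_
          rw [← Complex.exp_add]
          congr 1
          simp only [form, Equiv.prodComm_apply, Prod.swap]
          push_cast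
          field_simp
          ring
      _ = _ := by
          rw [tsum_mul_left, h, mul_left_comm, ← tsum_mul_left]
          congr 1
          refine tsum_congr fun k ↦ ?_
          simp only [F]
          rw [← Complex.exp_add, ← Complex.exp_add]
          congr 1
          push_cast
          have e : (c : ℂ) = (4 + b ^ 2) / (4 * a) := by field_simp; linear_combination hDC
          rw [e]
          field_simp
          ring_nf
          simp only [I_sq]
          ring
  have B : ∑' p : ℤ × ℤ, cexp (-π * form a b c p * t) =
      ((1 / (a * t) : ℝ) : ℂ) ^ (1 / 2 : ℂ) * ∑' k, ∑' n, F n k := by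
    let e : ℤ × ℤ ≃ ℤ × ℤ := (Equiv.prodComm ℤ ℤ).trans ((Equiv.refl ℤ).prodCongr (Equiv.neg ℤ))
    rw [← e.tsum_eq, Summable.tsum_prod (f := fun p ↦ cexp (-π * form a b c (e p) * t))
      (e.summable_iff.mpr (s1 ht)), ← tsum_mul_left]
    refine tsum_congr fun k ↦ ?_
    have h := Complex.tsum_exp_neg_quadratic (a := (1 / (a * t) : ℝ))
      (by rw [ofReal_re]; positivity) (I * b * k / (2 * a))
    have hne : (((1 / (a * t) : ℝ) : ℂ) ^ (1 / 2 : ℂ)) ≠ 0 := by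
      rw [Ne, Complex.cpow_eq_zero_iff, not_and_or]
      left
      exact ofReal_ne_zero.mpr (by positivity)
    simp only [F]
    rw [tsum_mul_left, h, mul_left_comm, ← mul_assoc (_ ^ _), mul_one_div_cancel hne, one_mul,
      ← tsum_mul_left]
    refine tsum_congr fun l ↦ ?_
    rw [← Complex.exp_add]
    congr 1
    simp only [form, e, Equiv.trans_apply, Equiv.prodComm_apply, Prod.swap, Equiv.prodCongr_apply,
      Prod.map, Equiv.refl_apply, Equiv.neg_apply]
    push_cast
    have e : (c : ℂ) = (4 + b ^ 2) / (4 * a) := by field_simp; linear_combination hDC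
    rw [e]
    field_simp
    ring_nf
    simp only [I_sq, I_pow_four]
    ring
  have sw : ∑' n, ∑' k, F n k = ∑' k, ∑' n, F n k := sF.tsum_comm.symm
  have P : 1 / ((a / t : ℝ) : ℂ) ^ (1 / 2 : ℂ) = t * ((1 / (a * t) : ℝ) : ℂ) ^ (1 / 2 : ℂ) := by
    rw [show (1 / 2 : ℂ) = ((1 / 2 : ℝ) : ℂ) by push_cast; rfl, ← ofReal_cpow (by positivity),
      ← ofReal_cpow (by positivity), ← ofReal_one, ← ofReal_div, ← ofReal_mul, ← Real.sqrt_eq_rpow,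
      ← Real.sqrt_eq_rpow, Real.sqrt_div ha.le, Real.sqrt_div zero_le_one, Real.sqrt_mul ha.le,
      Real.sqrt_one]
    congr 1
    have := Real.mul_self_sqrt ht.le
    field_simp
    nlinarith
  apply ofReal_injective
  rw [ofReal_mul, th, th, A, B, sw, P, mul_assoc]

/-- The Mellin pair of the theta series of a form of discriminant `-4`. -/
noncomputable def fePair {a b c : ℝ} (ha : 0 < a) (hD : 4 * a * c - b ^ 2 = 4) :
    WeakFEPair ℂ where
  f t := theta a b c t
  g t := theta a b c t
  k := 1
  ε := 1
  f₀ := 1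
  g₀ := 1
  hf_int := (continuous_ofReal.comp_continuousOn
    (continuousOn_theta ha (by rw [hD]; norm_num))).locallyIntegrableOn measurableSet_Ioi
  hg_int := (continuous_ofReal.comp_continuousOn
    (continuousOn_theta ha (by rw [hD]; norm_num))).locallyIntegrableOn measurableSet_Ioi
  hk := one_pos
  hε := one_ne_zero
  h_feq t ht := by
    rw [theta_inv ha hD ht]
    simp
  hf_top r := by
    have := theta_sub_one_isBigO (c := c) ha (by rw [hD]; norm_num) r
    refine IsBigO.trans (isBigO_of_le _ fun t ↦ le_of_eq ?_) this
    rw [← Complex.ofReal_one, ← Complex.ofReal_sub, Complex.norm_real]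
  hg_top r := by
    have := theta_sub_one_isBigO (c := c) ha (by rw [hD]; norm_num) r
    refine IsBigO.trans (isBigO_of_le _ fun t ↦ le_of_eq ?_) this
    rw [← Complex.ofReal_one, ← Complex.ofReal_sub, Complex.norm_real]

/-- `Z` is the Epstein zeta-function of the form `a m² + b m n + c n²`: it is holomorphic on
`ℂ ∖ {1}` and is the (absolutely convergent) series `∑ (a m² + b m n + c n²)^(-s)` over
`(m, n) ∈ ℤ² ∖ {(0, 0)}` for `Re s > 1`. -/
def IsContinuation (a b c : ℝ) (Z : ℂ → ℂ) : Prop :=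
  DifferentiableOn ℂ Z {1}ᶜ ∧ ∀ s : ℂ, 1 < s.re →
    HasSum (fun p : {p : ℤ × ℤ // p ≠ 0} ↦ (form a b c p : ℂ) ^ (-s)) (Z s)

theorem exists_continuation_aux {a b c : ℝ} (ha : 0 < a) (hD : 4 * a * c - b ^ 2 = 4) :
    ∃ Z, IsContinuation a b c Z := by
  have hD' : 0 < 4 * a * c - b ^ 2 := by rw [hD]; norm_num
  have hpi : (π : ℂ) ≠ 0 := ofReal_ne_zero.mpr pi_ne_zero
  let P := fePair ha hD
  refine ⟨fun s ↦ (π : ℂ) ^ s * (P.Λ₀ s * (Gamma s)⁻¹ - (Gamma (s + 1))⁻¹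
    - 1 / (1 - s) * (Gamma s)⁻¹), ?_, fun s hs ↦ ?_⟩
  · intro s hs
    have h1 : (1 : ℂ) - s ≠ 0 := sub_ne_zero.mpr (Ne.symm hs)
    have h2 := differentiable_one_div_Gamma s
    have h3 : DifferentiableAt ℂ (fun s : ℂ ↦ (Gamma (s + 1))⁻¹) s :=
      (differentiable_one_div_Gamma (s + 1)).comp s (f := fun s : ℂ ↦ s + 1) (by fun_prop)
    have h4 := P.differentiable_Λ₀ s
    have h5 : DifferentiableAt ℂ (fun s : ℂ ↦ 1 / (1 - s)) s := by fun_prop (disch := exact h1)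
    have h6 : DifferentiableAt ℂ (fun s : ℂ ↦ (π : ℂ) ^ s) s :=
      differentiableAt_id.const_cpow (Or.inl hpi)
    exact (h6.mul (((h4.mul h2).sub h3).sub (h5.mul h2))).differentiableWithinAt
  · have hs0 : s ≠ 0 := by rintro rfl; simp at hs; linarith
    have hG : Gamma s ≠ 0 := Gamma_ne_zero_of_re_pos (by linarith)
    have hpw : (π : ℂ) ^ s ≠ 0 := by simp [Complex.cpow_eq_zero_iff, hpi]
    have h := hasSum_mellin_pi_mul (ι := {p : ℤ × ℤ // p ≠ 0}) (a := fun _ ↦ 1)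
      (q := fun p ↦ form a b c p) (F := fun t ↦ ((theta a b c t - 1 : ℝ) : ℂ)) (s := s)
      (fun p ↦ Or.inr (form_pos ha hD' p.2)) (by linarith)
      (fun t ht ↦ by simpa using Complex.hasSum_ofReal.mpr (hasSum_theta_sub_one ha hD' ht))
      (by simpa using summable_zeta ha hD' hs)
    have hm : mellin (fun t ↦ ((theta a b c t - 1 : ℝ) : ℂ)) s = P.Λ s := by
      rw [← (P.hasMellin (s := s) hs).2]
      congr 1
      ext t
      simp [P, fePair]
    rw [hm] at h
    have h' := h.mul_left ((π : ℂ) ^ s * (Gamma s)⁻¹)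
    convert! h' using 1
    · ext p
      rw [Complex.cpow_neg, Complex.cpow_neg]
      field_simp
    · beta_reduce
      rw [Complex.Gamma_add_one s hs0, P.Λ₀_eq]
      simp only [P, fePair, smul_eq_mul, mul_one, ofReal_one]
      field_simp
      ring

/-- Existence of the analytic continuation, for every positive definite form. -/
theorem exists_continuation {a b c : ℝ} (ha : 0 < a) (hD : 0 < 4 * a * c - b ^ 2) :
    ∃ Z, IsContinuation a b c Z := by
  obtain ⟨r, hr, hr2⟩ : ∃ r : ℝ, 0 < r ∧ r ^ 2 * (4 * a * c - b ^ 2) = 4 :=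
    ⟨2 / √(4 * a * c - b ^ 2), by positivity, by rw [div_pow, Real.sq_sqrt hD.le]; field_simp; norm_num⟩
  obtain ⟨Z, hZ, hs⟩ := exists_continuation_aux (a := r * a) (b := r * b) (c := r * c)
    (by positivity) (by linear_combination hr2)
  have hrC : (r : ℂ) ≠ 0 := ofReal_ne_zero.mpr hr.ne'
  refine ⟨fun s ↦ (r : ℂ) ^ s * Z s, ?_, fun s h ↦ ?_⟩
  · have : Differentiable ℂ fun s : ℂ ↦ (r : ℂ) ^ s :=
      fun s ↦ differentiableAt_id.const_cpow (Or.inl hrC)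
    exact this.differentiableOn.mul hZ
  · convert! (hs s h).mul_left ((r : ℂ) ^ s) using 1
    ext p
    have : form (r * a) (r * b) (r * c) p = r * form a b c p := by simp only [form]; ring
    rw [this, ofReal_mul, mul_cpow_ofReal_nonneg hr.le (form_pos ha hD p.2).le, ← mul_assoc,
      Complex.cpow_neg (r : ℂ), mul_inv_cancel₀, one_mul]
    simp [Complex.cpow_eq_zero_iff, hrC]

/-- The analytic continuation is unique off the point `1`. -/
theorem IsContinuation.eqOn {a b c : ℝ} {Z W : ℂ → ℂ} (hZ : IsContinuation a b c Z)
    (hW : IsContinuation a b c W) : EqOn Z W {1}ᶜ := by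
  have hc : IsPreconnected ({1}ᶜ : Set ℂ) :=
    (isConnected_compl_singleton_of_one_lt_rank (by simp [Complex.rank_real_complex]) 1).isPreconnected
  have hev : Z =ᶠ[𝓝 2] W := by
    filter_upwards [(isOpen_lt continuous_const continuous_re).mem_nhds
      (show (2 : ℂ) ∈ {s : ℂ | (1 : ℝ) < s.re} by simp)] with s hs
    exact (hZ.2 s hs).unique (hW.2 s hs)
  exact (hZ.1.analyticOnNhd isOpen_compl_singleton).eqOn_of_preconnected_of_eventuallyEq
    (hW.1.analyticOnNhd isOpen_compl_singleton) hc (by simp) hev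

open Classical in
/-- The Epstein zeta-function `ζ_Q` of the form `Q(m, n) = a m² + b m n + c n²`: the analytic
continuation to `ℂ ∖ {1}` of `∑ Q(m, n)^(-s)`, summed over `(m, n) ∈ ℤ² ∖ {(0, 0)}`.
It exists for every positive definite `Q`, and is unique (see above). -/
noncomputable def epsteinZeta (a b c : ℝ) : ℂ → ℂ :=
  if h : ∃ Z, IsContinuation a b c Z then h.choose else 0

theorem isContinuation_epsteinZeta {a b c : ℝ} (ha : 0 < a) (hD : 0 < 4 * a * c - b ^ 2) :
    IsContinuation a b c (epsteinZeta a b c) := by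
  have h := exists_continuation ha hD
  rw [epsteinZeta, dif_pos h]
  exact h.choose_spec

/-- `N*_Q(σ, T)`: the number of zeros of `ζ_Q`, counted with multiplicity, on the segment
`Re s = σ`, `|Im s| ≤ T`. (The order of vanishing is `0` at points which are not zeros, and also at
the pole `1`, where `ζ_Q` is not analytic.) -/
noncomputable def lineCount (a b c σ T : ℝ) : ENNReal :=
  ∑' s : {s : ℂ // s.re = σ ∧ |s.im| ≤ T},
    ((analyticOrderAt (epsteinZeta a b c) s : ℕ∞) : ENNReal)

/-- `N_Q(σ, T)`: the sum of `N*_Q(σ', T)` over all real `σ' ≥ σ`. -/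
noncomputable def zeroCount (a b c σ T : ℝ) : ENNReal :=
  ∑' σ' : {σ' : ℝ // σ ≤ σ'}, lineCount a b c σ' T

end EpsteinZeta

namespace EpsteinZeta

open Real Complex Filter Topology Asymptotics Set MeasureTheory

/-! ### Plancherel inequalities for the Fourier and Mellin transforms. -/

open FourierTransform in
theorem integral_fourier_mul_eq {f g : ℝ → ℂ} (hf : Integrable f) (hg : Integrable g) :
    ∫ ξ, 𝓕 f ξ * g ξ = ∫ x, f x * 𝓕 g x := by
  simpa using! VectorFourier.integral_fourierIntegral_smul_eq_flip (L := innerₗ ℝ)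
    Real.continuous_fourierChar (by fun_prop) hf hg

open FourierTransform in
theorem norm_fourier_le_integral (f : ℝ → ℂ) (ξ : ℝ) : ‖𝓕 f ξ‖ ≤ ∫ x, ‖f x‖ := by
  simpa using! VectorFourier.norm_fourierIntegral_le_integral_norm Real.fourierChar volume
    (innerₗ ℝ) f ξ

open FourierTransform in
theorem continuous_fourier_of_integrable {f : ℝ → ℂ} (hf : Integrable f) : Continuous (𝓕 f) :=
  VectorFourier.fourierIntegral_continuous Real.continuous_fourierChar (by fun_prop) hf

/-- The heat kernel whose Fourier transform is `exp (-π b ξ²)`. -/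
noncomputable def heat (b u : ℝ) : ℝ := (√b)⁻¹ * rexp (-(π / b) * u ^ 2)

theorem lintegral_heat {b : ℝ} (hb : 0 < b) (x : ℝ) :
    ∫⁻ y, ENNReal.ofReal (heat b (y - x)) = 1 := by
  have h1 : ∀ u, 0 ≤ heat b u := fun u ↦ by unfold heat; positivity
  have h2 : Integrable (heat b) :=
    (integrable_exp_neg_mul_sq (b := π / b) (by positivity)).const_mul _
  rw [lintegral_sub_right_eq_self (fun y ↦ ENNReal.ofReal (heat b y)),
    ← ofReal_integral_eq_lintegral_ofReal h2 (ae_of_all _ h1)]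
  unfold heat
  rw [integral_const_mul, integral_gaussian, div_div_cancel₀ pi_ne_zero,
    inv_mul_cancel₀ (by positivity), ENNReal.ofReal_one]

open FourierTransform in
theorem fourier_gaussian_modulated {b : ℝ} (hb : 0 < b) (x y : ℝ) :
    𝓕 (fun ξ : ℝ ↦ cexp (2 * π * (I * x) * ξ) * rexp (-π * b * ξ ^ 2)) y = heat b (y - x) := by
  have h := congrFun (fourier_gaussian_pi' (b := b) (by simpa using hb) (I * x)) y
  have e : (fun ξ : ℝ ↦ cexp (2 * π * (I * x) * ξ) * rexp (-π * b * ξ ^ 2)) =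
      fun ξ : ℝ ↦ cexp (-π * b * ξ ^ 2 + 2 * π * (I * x) * ξ) := by
    ext ξ
    push_cast
    rw [← Complex.exp_add, add_comm]
  rw [e, h, heat, Real.sqrt_eq_rpow]
  push_cast
  rw [Complex.ofReal_cpow hb.le]
  push_cast
  rw [one_div, ← mul_assoc I I, I_mul_I]
  congr 2
  ring

-- Moving the transform off one factor by self-adjointness turns the Gaussian into the heat kernel,
-- so integrability of `f` suffices and no square integrability is needed.
open FourierTransform ComplexConjugate in
theorem integral_fourier_sq_mul_gaussian {f : ℝ → ℂ} (hf : Integrable f) {b : ℝ} (hb : 0 < b) :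
    ∫ ξ, 𝓕 f ξ * (conj (𝓕 f ξ) * rexp (-π * b * ξ ^ 2)) =
      ∫ x, f x * conj (∫ y, f y * heat b (y - x)) := by
  have hg : Integrable fun ξ : ℝ ↦ (rexp (-π * b * ξ ^ 2) : ℂ) := by
    have := (integrable_exp_neg_mul_sq (b := π * b) (by positivity)).ofReal (𝕜 := ℂ)
    simpa using this
  have hc := continuous_fourier_of_integrable hf
  rw [integral_fourier_mul_eq hf]
  · congr 1
    ext x
    congr 1
    have h2 := integral_fourier_mul_eq hf
      (g := fun ξ : ℝ ↦ cexp (2 * π * (I * x) * ξ) * rexp (-π * b * ξ ^ 2)) (by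
        refine hg.bdd_mul (c := 1) (by fun_prop) (ae_of_all _ fun ξ ↦ ?_)
        rw [show (2 * π * (I * x) * ξ : ℂ) = ((2 * π * x * ξ : ℝ) : ℂ) * I by push_cast; ring,
          Complex.norm_exp_ofReal_mul_I])
    simp_rw [fourier_gaussian_modulated hb] at h2
    rw [← h2, ← integral_conj, Real.fourier_eq']
    congr 1
    ext ξ
    simp only [smul_eq_mul, map_mul, RCLike.inner_apply, conj_trivial, conj_ofReal]
    rw [← Complex.exp_conj]
    simp only [map_mul, conj_ofReal, conj_I, map_ofNat]
    push_cast
    rw [show (-2 * π * (x * ξ) * I : ℂ) = 2 * π * (-I * x) * ξ by ring]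
    ring
  · refine hg.bdd_mul (c := ∫ x, ‖f x‖) (by fun_prop) (ae_of_all _ fun ξ ↦ ?_)
    rw [RCLike.norm_conj]
    exact norm_fourier_le_integral f ξ

open FourierTransform ComplexConjugate in
/-- A truncated form of the Plancherel inequality. -/
theorem lintegral_fourier_sq_le {f : ℝ → ℂ} (hf : Integrable f) {L : ℝ} (hL : 0 < L) :
    ∫⁻ ξ in Icc (-L) L, ‖𝓕 f ξ‖ₑ ^ 2 ≤ ENNReal.ofReal (2 * rexp π) * ∫⁻ x, ‖f x‖ₑ ^ 2 := by
  -- With this width the Gaussian is at least `exp (-π)` on `[-L, L]`; this is the source of `rexp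
  -- π` in the constant.
  let b := 1 / L ^ 2
  have hb : 0 < b := by positivity
  have hc := continuous_fourier_of_integrable hf
  have main : ∫⁻ ξ, ‖𝓕 f ξ‖ₑ ^ 2 * ENNReal.ofReal (rexp (-π * b * ξ ^ 2)) ≤
      2 * ∫⁻ x, ‖f x‖ₑ ^ 2 := by
    have e : ∀ ξ, 𝓕 f ξ * (conj (𝓕 f ξ) * rexp (-π * b * ξ ^ 2)) =
        ((‖𝓕 f ξ‖ ^ 2 * rexp (-π * b * ξ ^ 2) : ℝ) : ℂ) := fun ξ ↦ by
      rw [← mul_assoc, Complex.mul_conj, Complex.normSq_eq_norm_sq]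
      push_cast
      rfl
    have hint : Integrable fun ξ ↦ ‖𝓕 f ξ‖ ^ 2 * rexp (-π * b * ξ ^ 2) := by
      have hg : Integrable fun ξ : ℝ ↦ rexp (-π * b * ξ ^ 2) := by
        simpa using integrable_exp_neg_mul_sq (b := π * b) (by positivity)
      refine hg.bdd_mul (c := (∫ x, ‖f x‖) ^ 2) (by fun_prop) (ae_of_all _ fun ξ ↦ ?_)
      rw [norm_pow, norm_norm]
      exact pow_le_pow_left₀ (norm_nonneg _) (norm_fourier_le_integral f ξ) 2
    have h1 : ∫⁻ ξ, ‖𝓕 f ξ‖ₑ ^ 2 * ENNReal.ofReal (rexp (-π * b * ξ ^ 2)) =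
        ‖∫ x, f x * conj (∫ y, f y * heat b (y - x))‖ₑ := by
      rw [← integral_fourier_sq_mul_gaussian hf hb]
      simp_rw [e]
      rw [integral_complex_ofReal, ← ofReal_norm, Complex.norm_real, Real.norm_of_nonneg
        (integral_nonneg fun _ ↦ by positivity), ofReal_integral_eq_lintegral_ofReal hint
        (ae_of_all _ fun _ ↦ by positivity)]
      congr 1
      ext ξ
      rw [ENNReal.ofReal_mul (by positivity), ENNReal.ofReal_pow (norm_nonneg _),
        ofReal_norm]
    have hm : AEMeasurable (fun y ↦ ‖f y‖ₑ) := hf.aestronglyMeasurable.enorm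
    have hk : Measurable fun p : ℝ × ℝ ↦ ENNReal.ofReal (heat b (p.2 - p.1)) := by
      unfold heat; fun_prop
    have hsymm : ∀ x y, heat b (y - x) = heat b (x - y) := fun x y ↦ by
      unfold heat; rw [show (y - x) ^ 2 = (x - y) ^ 2 by ring]
    rw [h1]
    calc _ ≤ ∫⁻ x, ‖f x‖ₑ * ∫⁻ y, ‖f y‖ₑ * ENNReal.ofReal (heat b (y - x)) := by
          refine (enorm_integral_le_lintegral_enorm _).trans (lintegral_mono fun x ↦ ?_)
          rw [enorm_mul, ← ofReal_norm (conj _), RCLike.norm_conj, ofReal_norm]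
          gcongr
          refine (enorm_integral_le_lintegral_enorm _).trans (lintegral_mono fun y ↦ ?_)
          rw [enorm_mul, ← ofReal_norm (_ : ℂ), ← ofReal_norm (heat b _ : ℂ),
            Complex.norm_real, Real.norm_of_nonneg (by unfold heat; positivity)]
      -- The crude bound `uv ≤ u² + v²` costs a factor `2`. The heat kernel has mass one in either
      -- variable, so each half integrates to `∫ ‖f‖²`.
      _ ≤ ∫⁻ x, ∫⁻ y, (‖f x‖ₑ ^ 2 * ENNReal.ofReal (heat b (y - x)) +
            ‖f y‖ₑ ^ 2 * ENNReal.ofReal (heat b (y - x))) := by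
          refine lintegral_mono fun x ↦ ?_
          rw [← lintegral_const_mul' _ _ enorm_ne_top]
          refine lintegral_mono fun y ↦ ?_
          simp only [← mul_assoc, ← add_mul]
          gcongr
          rcases le_total ‖f x‖ₑ ‖f y‖ₑ with h | h
          · exact ((mul_le_mul_left h _).trans (sq _).ge).trans le_add_self
          · exact ((mul_le_mul_right h _).trans (sq _).ge).trans le_self_add
      _ = (∫⁻ x, ‖f x‖ₑ ^ 2) + ∫⁻ x, ‖f x‖ₑ ^ 2 := by
          have m1 : AEMeasurable (fun p : ℝ × ℝ ↦ ‖f p.1‖ₑ ^ 2 * ENNReal.ofReal (heat b (p.2 - p.1)))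
              (volume.prod volume) := (hm.comp_fst.pow_const 2).mul hk.aemeasurable
          have m2 : AEMeasurable (fun p : ℝ × ℝ ↦ ‖f p.2‖ₑ ^ 2 * ENNReal.ofReal (heat b (p.2 - p.1)))
              (volume.prod volume) := (hm.comp_snd.pow_const 2).mul hk.aemeasurable
          have s1 : ∀ x, ∫⁻ y, ‖f x‖ₑ ^ 2 * ENNReal.ofReal (heat b (y - x)) = ‖f x‖ₑ ^ 2 := fun x ↦ by
            rw [lintegral_const_mul _ (by unfold heat; fun_prop), lintegral_heat hb, mul_one]
          have s2 : ∫⁻ x, ∫⁻ y, ‖f y‖ₑ ^ 2 * ENNReal.ofReal (heat b (y - x)) =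
              ∫⁻ x, ‖f x‖ₑ ^ 2 := by
            rw [lintegral_lintegral_swap m2]
            refine lintegral_congr fun y ↦ ?_
            simp_rw [hsymm _ y]
            exact s1 y
          rw [← s2]
          nth_rewrite 1 [s2]
          rw [← lintegral_congr s1, ← lintegral_add_left' m1.lintegral_prod_right']
          refine lintegral_congr fun x ↦ ?_
          rw [lintegral_add_left (by unfold heat; fun_prop)]
      _ = _ := (two_mul _).symm
  calc _ ≤ ∫⁻ ξ in Icc (-L) L, ENNReal.ofReal (rexp π) *
        (‖𝓕 f ξ‖ₑ ^ 2 * ENNReal.ofReal (rexp (-π * b * ξ ^ 2))) := by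
        refine setLIntegral_mono' measurableSet_Icc fun ξ hξ ↦ ?_
        rw [mul_left_comm, ← ENNReal.ofReal_mul (exp_pos _).le, ← Real.exp_add]
        refine le_mul_of_one_le_right' ?_
        rw [← ENNReal.ofReal_one]
        refine ENNReal.ofReal_le_ofReal (Real.one_le_exp ?_)
        have : b * ξ ^ 2 ≤ 1 := by
          rw [one_div_mul_eq_div, div_le_one (by positivity)]
          exact sq_le_sq' hξ.1 hξ.2
        nlinarith [pi_pos]
    _ ≤ ∫⁻ ξ, ENNReal.ofReal (rexp π) *
        (‖𝓕 f ξ‖ₑ ^ 2 * ENNReal.ofReal (rexp (-π * b * ξ ^ 2))) := setLIntegral_le_lintegral _ _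
    _ ≤ _ := by
        rw [lintegral_const_mul _ (by fun_prop), mul_comm 2 (rexp π),
          ENNReal.ofReal_mul (exp_pos _).le, mul_assoc]
        gcongr
        simpa using main

theorem image_exp_neg_univ : (fun u : ℝ ↦ rexp (-u)) '' univ = Ioi 0 := by
  rw [show (fun u : ℝ ↦ rexp (-u)) = rexp ∘ Neg.neg from rfl, Set.image_comp,
    Set.image_univ_of_surjective neg_surjective, Set.image_univ, Real.range_exp]

theorem hasDerivWithinAt_exp_neg (u : ℝ) :
    HasDerivWithinAt (fun u : ℝ ↦ rexp (-u)) (-rexp (-u)) univ u := by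
  have := (hasDerivAt_neg u).exp
  rw [mul_neg_one] at this
  exact this.hasDerivWithinAt

theorem injOn_exp_neg : InjOn (fun u : ℝ ↦ rexp (-u)) univ := fun x _ y _ h ↦ by
  simpa using h

theorem lintegral_Ioi_eq_lintegral_exp_neg (g : ℝ → ENNReal) :
    ∫⁻ x in Ioi (0 : ℝ), g x = ∫⁻ u, ENNReal.ofReal (rexp (-u)) * g (rexp (-u)) := by
  rw [← image_exp_neg_univ, lintegral_image_eq_lintegral_abs_deriv_mul MeasurableSet.univ
    (fun u _ ↦ hasDerivWithinAt_exp_neg u) injOn_exp_neg, Measure.restrict_univ]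
  simp

theorem integrable_of_mellinConvergent {h : ℝ → ℂ} {σ : ℝ} (hc : MellinConvergent h σ) :
    Integrable fun u : ℝ ↦ rexp (-σ * u) • h (rexp (-u)) := by
  rw [MellinConvergent, ← image_exp_neg_univ, integrableOn_image_iff_integrableOn_abs_deriv_smul
      MeasurableSet.univ (fun u _ ↦ hasDerivWithinAt_exp_neg u) injOn_exp_neg,
      integrableOn_univ] at hc
  refine hc.congr (ae_of_all _ fun u ↦ ?_)
  simp only [abs_neg, abs_exp, smul_eq_mul, Complex.real_smul]
  rw [← mul_assoc]
  congr 1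
  rw [show ((σ : ℂ) - 1) = ((σ - 1 : ℝ) : ℂ) by push_cast; rfl, ← Complex.ofReal_cpow (exp_pos _).le,
    ← Complex.ofReal_mul]
  congr 1
  rw [← Real.exp_mul, ← Real.exp_add]
  ring_nf

/-- A truncated Plancherel inequality for the Mellin transform on a vertical line. -/
theorem lintegral_mellin_sq_le {h : ℝ → ℂ} {σ : ℝ} (hc : MellinConvergent h σ) {L : ℝ}
    (hL : 0 < L) : ∫⁻ t in Icc (-L) L, ‖mellin h (σ + t * I)‖ₑ ^ 2 ≤
      ENNReal.ofReal (4 * π * rexp π) *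
        ∫⁻ x in Ioi (0 : ℝ), ‖h x‖ₑ ^ 2 * ENNReal.ofReal (x ^ (2 * σ - 1)) := by
  have hF := integrable_of_mellinConvergent hc
  have h1 := lintegral_fourier_sq_le hF (L := L / (2 * π)) (by positivity)
  have h2 : ∫⁻ x in Ioi (0 : ℝ), ‖h x‖ₑ ^ 2 * ENNReal.ofReal (x ^ (2 * σ - 1)) =
      ∫⁻ u : ℝ, ‖rexp (-σ * u) • h (rexp (-u))‖ₑ ^ 2 := by
    rw [lintegral_Ioi_eq_lintegral_exp_neg]
    refine lintegral_congr fun u ↦ ?_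
    rw [enorm_smul, mul_pow, mul_left_comm, mul_comm (‖h _‖ₑ ^ 2), Real.enorm_of_nonneg
      (exp_pos _).le, ← ENNReal.ofReal_pow (exp_pos _).le, ← ENNReal.ofReal_mul (exp_pos _).le]
    rw [← Real.exp_mul, ← Real.exp_add, ← Real.exp_nat_mul]
    congr 3
    push_cast
    ring
  -- After `x = exp (-u)` the Mellin transform is a Fourier transform at frequency `t / (2π)`; the
  -- Jacobian `2π` enters the constant.
  have h3 : Icc (-L) L = (fun ξ : ℝ ↦ 2 * π * ξ) '' Icc (-(L / (2 * π))) (L / (2 * π)) := by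
    rw [Set.image_mul_left_Icc' (by positivity)]
    congr 1 <;> field_simp
  rw [h2, h3, lintegral_image_eq_lintegral_abs_deriv_mul (f' := fun _ ↦ 2 * π) measurableSet_Icc
    (fun ξ _ ↦ by simpa using ((hasDerivAt_id ξ).const_mul (2 * π)).hasDerivWithinAt)
    (fun x _ y _ hxy ↦ mul_left_cancel₀ (by positivity) hxy)]
  rw [lintegral_const_mul' _ _ ENNReal.ofReal_ne_top, abs_of_pos (by positivity),
    show 4 * π * rexp π = 2 * π * (2 * rexp π) by ring, ENNReal.ofReal_mul (p := 2 * π) (by positivity),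
    mul_assoc (ENNReal.ofReal (2 * π))]
  refine mul_le_mul' le_rfl ?_
  refine le_trans (le_of_eq (lintegral_congr fun ξ ↦ ?_)) h1
  rw [mellin_eq_fourier]
  simp [mul_div_cancel_left₀ ξ (show 2 * π ≠ 0 by positivity)]

/-! ### Lattice points in strips, and pairs of vectors of nearly equal length. -/

/-- The integer points of the square `[-R, R]²`. -/
noncomputable def box (R : ℕ) : Finset (ℤ × ℤ) := Finset.Icc (-(R : ℤ)) R ×ˢ Finset.Icc (-(R : ℤ)) R

theorem mem_box {R : ℕ} {p : ℤ × ℤ} : p ∈ box R ↔ |p.1| ≤ R ∧ |p.2| ≤ R := by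
  simp [box, abs_le]

theorem card_box (R : ℕ) : (box R).card = (2 * R + 1) ^ 2 := by
  rw [box, Finset.card_product, Int.card_Icc, sq]
  congr 1 <;> omega

/-- The points of a box in the strip `j ≤ x v₁ + y v₂ < j + 1`. -/
noncomputable def strip (R : ℕ) (x y : ℝ) (j : ℤ) : Finset (ℤ × ℤ) :=
  (box R).filter fun v ↦ ⌊x * v.1 + y * v.2⌋ = j

theorem abs_sub_lt_one_of_mem_strip {R : ℕ} {x y : ℝ} {j : ℤ} {v w : ℤ × ℤ}
    (hv : v ∈ strip R x y j) (hw : w ∈ strip R x y j) :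
    |x * (v - w).1 + y * (v - w).2| < 1 := by
  simp only [strip, Finset.mem_filter] at hv hw
  have := Int.abs_sub_lt_one_of_floor_eq_floor (hv.2.trans hw.2.symm)
  rw [show x * ((v - w).1 : ℤ) + y * ((v - w).2 : ℤ) =
    x * v.1 + y * v.2 - (x * w.1 + y * w.2) by simp; ring]
  exact this

theorem card_strip_swap (R : ℕ) (x y : ℝ) (j : ℤ) :
    (strip R x y j).card = (strip R y x j).card := by
  refine Finset.card_bij (fun p _ ↦ p.swap) ?_ (fun _ _ _ _ h ↦ Prod.swap_injective h) ?_
  · intro p hp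
    simp only [strip, Finset.mem_filter, mem_box, Prod.fst_swap, Prod.snd_swap] at hp ⊢
    exact ⟨hp.1.symm, by rw [add_comm]; exact hp.2⟩
  · intro p hp
    refine ⟨p.swap, ?_, Prod.swap_swap p⟩
    simp only [strip, Finset.mem_filter, mem_box, Prod.fst_swap, Prod.snd_swap] at hp ⊢
    exact ⟨hp.1.symm, by rw [add_comm]; exact hp.2⟩

/-- Two points of a strip with equal second coordinate differ by `(k, 0)` with `|x k| < 1`, hence
`|k| < m`. So a point is determined by its second coordinate and its first coordinate modulo `m`. -/
theorem card_strip_le_of_abs_le {R m : ℕ} {x y : ℝ} (hm : 1 ≤ m * |x|) (j : ℤ) :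
    (strip R x y j).card ≤ (2 * R + 1) * m := by
  have hm0 : 0 < m := by
    rcases Nat.eq_zero_or_pos m with rfl | h
    · simp at hm; linarith
    · exact h
  have hx : 0 < |x| := by
    by_contra h
    have : |x| = 0 := le_antisymm (not_lt.mp h) (abs_nonneg x)
    rw [this] at hm; simp at hm; linarith
  have : (Finset.Icc (-(R : ℤ)) R ×ˢ Finset.Ico (0 : ℤ) m).card = (2 * R + 1) * m := by
    rw [Finset.card_product, Int.card_Icc, Int.card_Ico]
    congr 1 <;> omega
  rw [← this]
  refine Finset.card_le_card_of_injOn (fun v ↦ (v.2, v.1 % m)) (fun v hv ↦ ?_)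
    fun v hv w hw h ↦ ?_
  · have hb := (Finset.mem_filter.mp hv).1
    rw [mem_box] at hb
    simp only [Finset.coe_product, Set.mem_prod, Finset.mem_coe, Finset.mem_Icc, Finset.mem_Ico]
    exact ⟨abs_le.mp hb.2, Int.emod_nonneg _ (by omega), Int.emod_lt_of_pos _ (by omega)⟩
  · have hs := abs_sub_lt_one_of_mem_strip hv hw
    simp only [Prod.mk.injEq] at h
    have h2 : (v - w).2 = 0 := by simp [h.1]
    have hdvd : (m : ℤ) ∣ (v - w).1 := Int.ModEq.dvd (Eq.symm h.2)
    rw [h2, Int.cast_zero, mul_zero, add_zero, abs_mul] at hs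
    have hlt : |(v - w).1| < m := by
      have : |(((v - w).1 : ℤ) : ℝ)| < m := by
        by_contra hcon
        have := mul_le_mul_of_nonneg_left (not_lt.mp hcon) hx.le
        linarith
      exact_mod_cast this
    have h1 := Int.eq_zero_of_abs_lt_dvd hdvd hlt
    simp only [Prod.fst_sub, Prod.snd_sub, sub_eq_zero] at h1 h2
    exact Prod.ext h1 h2

theorem card_strip_le {R m : ℕ} {x y : ℝ} (hm : 1 ≤ m * |x| ∨ 1 ≤ m * |y|) (j : ℤ) :
    (strip R x y j).card ≤ (2 * R + 1) * m := by
  rcases hm with h | h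
  · exact card_strip_le_of_abs_le h j
  · rw [card_strip_swap]
    exact card_strip_le_of_abs_le h j

/-- Pigeonhole: the second coordinates fall into `2q + 1` blocks of length `h`, so two points of a
crowded strip share a block. For their difference `d` one has `|d.2| < h`, and `|x| |d.1| < 1 + |y|
|d.2|` then confines `d.1` to `h + m`, because `|y| ≤ |x|`. -/
theorem exists_short_vector_aux {h q m : ℕ} (h0 : 0 < h) {x y : ℝ} (hm : 1 ≤ m * |x|)
    (hxy : |y| ≤ |x|) {j : ℤ} (hcard : 2 * q + 1 < (strip (h * q) x y j).card) :
    ∃ d ∈ box (h + m), d ≠ 0 ∧ |x * d.1 + y * d.2| < 1 := by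
  have hx : 0 < |x| := by
    by_contra h
    have : |x| = 0 := le_antisymm (not_lt.mp h) (abs_nonneg x)
    rw [this] at hm; simp at hm; linarith
  have hc : (Finset.Icc (-(q : ℤ)) q).card = 2 * q + 1 := by
    rw [Int.card_Icc]; omega
  rw [← hc] at hcard
  obtain ⟨v, hv, w, hw, hne, he⟩ := Finset.exists_ne_map_eq_of_card_lt_of_maps_to hcard
    (f := fun v ↦ v.2 / h) (fun v hv ↦ by
      have hb := (Finset.mem_filter.mp hv).1
      rw [mem_box] at hb
      have hb2 := abs_le.mp hb.2
      push_cast at hb2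
      rw [Finset.mem_coe, Finset.mem_Icc]
      exact ⟨(Int.le_ediv_iff_mul_le (by omega)).mpr (by nlinarith),
        Int.ediv_le_of_le_mul (by omega) (by nlinarith)⟩)
  have hs := abs_sub_lt_one_of_mem_strip hv hw
  have h2 : |(v - w).2| < h := by
    have e1 := Int.emod_add_mul_ediv v.2 h
    have e2 := Int.emod_add_mul_ediv w.2 h
    have e3 := Int.emod_nonneg v.2 (b := h) (by omega)
    have e4 := Int.emod_nonneg w.2 (b := h) (by omega)
    have e5 := Int.emod_lt_of_pos v.2 (b := h) (by omega)
    have e6 := Int.emod_lt_of_pos w.2 (b := h) (by omega)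
    have he' : v.2 / (h : ℤ) = w.2 / h := he
    rw [he'] at e1
    rw [Prod.snd_sub, abs_lt]
    constructor <;> linarith
  have h1 : |(v - w).1| ≤ h + m := by
    have : |(((v - w).1 : ℤ) : ℝ)| ≤ h + m := by
      have t1 : |x| * |(((v - w).1 : ℤ) : ℝ)| ≤ 1 + |y| * |(((v - w).2 : ℤ) : ℝ)| := by
        rw [← abs_mul, ← abs_mul]
        have := abs_sub_abs_le_abs_sub (x * (((v - w).1 : ℤ) : ℝ)) (-(y * (((v - w).2 : ℤ) : ℝ)))
        rw [abs_neg, sub_neg_eq_add] at this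
        linarith
      have t2 : |(((v - w).2 : ℤ) : ℝ)| ≤ h := by exact_mod_cast h2.le
      have t3 : |y| * |(((v - w).2 : ℤ) : ℝ)| ≤ |x| * h :=
        mul_le_mul hxy t2 (abs_nonneg _) hx.le
      by_contra hcon
      have := mul_lt_mul_of_pos_left (not_le.mp hcon) hx
      nlinarith
    exact_mod_cast this
  refine ⟨v - w, mem_box.mpr ⟨by push_cast; exact h1, by push_cast; linarith [h2]⟩,
    sub_ne_zero.mpr hne, hs⟩

theorem exists_short_vector {h q m : ℕ} (h0 : 0 < h) {x y : ℝ}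
    (hm : 1 ≤ m * |x| ∨ 1 ≤ m * |y|) {j : ℤ}
    (hcard : 2 * q + 1 < (strip (h * q) x y j).card) :
    ∃ d ∈ box (h + m), d ≠ 0 ∧ |x * d.1 + y * d.2| < 1 := by
  have mono {s t : ℝ} (hst : s ≤ t) (h : 1 ≤ m * s) : 1 ≤ m * t :=
    h.trans (mul_le_mul_of_nonneg_left hst (Nat.cast_nonneg m))
  rcases le_total |y| |x| with hxy | hxy
  · exact exists_short_vector_aux h0 (hm.elim id (mono hxy)) hxy hcard
  · rw [card_strip_swap] at hcard
    obtain ⟨d, hd, hne, hlt⟩ := exists_short_vector_aux h0 (hm.elim (mono hxy) id) hxy hcard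
    refine ⟨d.swap, mem_box.mpr (mem_box.mp hd).symm, fun h ↦ hne ?_, by
      rw [add_comm]; exact hlt⟩
    simpa using congrArg Prod.swap h

theorem one_div_one_add_sq_le (x : ℝ) : 1 / (1 + x ^ 2) ≤ 3 / (1 + (⌊x⌋ : ℝ) ^ 2) := by
  rw [div_le_div_iff₀ (by positivity) (by positivity)]
  have h1 := Int.floor_le x
  have h2 := Int.lt_floor_add_one x
  nlinarith [sq_nonneg (x + (⌊x⌋ : ℝ)), sq_nonneg (x - 1), sq_nonneg (x+1)]

theorem summable_int_one_div_one_add_sq : Summable fun j : ℤ ↦ 3 / (1 + (j : ℝ) ^ 2) := by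
  have h : Summable fun j : ℤ ↦ 1 / (j : ℝ) ^ 2 := Real.summable_one_div_int_pow.mpr (by norm_num)
  refine (h.mul_left 3).of_norm_bounded_eventually ?_
  rw [Filter.eventually_cofinite]
  refine (Set.finite_singleton (0 : ℤ)).subset fun j hj ↦ ?_
  by_contra h0
  apply hj
  have : (0 : ℝ) < (j : ℝ) ^ 2 := by have : (j : ℝ) ≠ 0 := by exact_mod_cast h0
                                     positivity
  rw [Real.norm_of_nonneg (by positivity), mul_one_div]
  exact div_le_div_of_nonneg_left (by norm_num) this (by linarith)

/-- Grouping the points by strip makes the sum over strips converge absolutely, so a uniform bound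
for one strip controls everything. -/
theorem sum_box_strip_le {R M : ℕ} {x y : ℝ} (hM : ∀ j, (strip R x y j).card ≤ M) :
    ∑ v ∈ box R, 1 / (1 + (x * v.1 + y * v.2) ^ 2) ≤
      (M : ℝ) * ∑' j : ℤ, 3 / (1 + (j : ℝ) ^ 2) := by
  calc _ ≤ ∑ v ∈ box R, 3 / (1 + (⌊x * v.1 + y * v.2⌋ : ℝ) ^ 2) :=
        Finset.sum_le_sum fun v _ ↦ one_div_one_add_sq_le _
    _ = ∑ j ∈ (box R).image (fun v ↦ ⌊x * v.1 + y * v.2⌋),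
          (strip R x y j).card * (3 / (1 + (j : ℝ) ^ 2)) := by
        rw [Finset.sum_comp (fun j : ℤ ↦ 3 / (1 + (j : ℝ) ^ 2))
          (fun v : ℤ × ℤ ↦ ⌊x * v.1 + y * v.2⌋)]
        simp [strip, nsmul_eq_mul]
    _ ≤ ∑ j ∈ (box R).image (fun v ↦ ⌊x * v.1 + y * v.2⌋), M * (3 / (1 + (j : ℝ) ^ 2)) := by
        gcongr
        exact hM _
    _ ≤ _ := by
        rw [← Finset.mul_sum]
        gcongr
        exact summable_int_one_div_one_add_sq.sum_le_tsum _ fun _ _ ↦ by positivity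

/-- The linear form `v ↦ (Q(u + v) - Q(u - v)) / 4`. -/
noncomputable def polar (a b c : ℝ) (u v : ℤ × ℤ) : ℝ :=
  (a * u.1 + b / 2 * u.2) * v.1 + (b / 2 * u.1 + c * u.2) * v.2

theorem polar_comm (a b c : ℝ) (u v : ℤ × ℤ) : polar a b c u v = polar a b c v u := by
  unfold polar; ring

/-- The form at `u` is the pairing of these two coefficients with `u`. If both were below `δ / 2`,
then `|k| ≤ k²` for integers would make the form smaller than `δ |u|²`. The point is that `m` does
not depend on `u`. -/
theorem exists_polar_coeff {a b c : ℝ} (ha : 0 < a) (hD : 0 < 4 * a * c - b ^ 2) :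
    ∃ m : ℕ, ∀ u : ℤ × ℤ, u ≠ 0 →
      1 ≤ m * |a * u.1 + b / 2 * u.2| ∨ 1 ≤ m * |b / 2 * u.1 + c * u.2| := by
  obtain ⟨δ, hδ, h⟩ := exists_form_lower ha hD
  obtain ⟨m, hm⟩ := exists_nat_ge (2 / δ)
  refine ⟨m, fun u hu ↦ ?_⟩
  by_contra! hcon
  obtain ⟨h1, h2⟩ := hcon
  have hm0 : 0 < (m : ℝ) := (by positivity : 0 < 2 / δ).trans_le hm
  rw [← lt_div_iff₀' hm0] at h1 h2
  have hmδ : 1 / (m : ℝ) ≤ δ / 2 := by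
    rw [div_le_iff₀ hm0]; rw [div_le_iff₀ hδ] at hm; linarith
  have e : form a b c u = (a * u.1 + b / 2 * u.2) * u.1 + (b / 2 * u.1 + c * u.2) * u.2 := by
    unfold form; ring
  have hh := h u
  have hone := one_le_sq_add_sq hu
  have t1 : (a * u.1 + b / 2 * u.2) * u.1 ≤ δ / 2 * |(u.1 : ℝ)| :=
    (le_abs_self _).trans (by rw [abs_mul]; gcongr; linarith)
  have t2 : (b / 2 * u.1 + c * u.2) * u.2 ≤ δ / 2 * |(u.2 : ℝ)| :=
    (le_abs_self _).trans (by rw [abs_mul]; gcongr; linarith)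
  have i1 : ∀ k : ℤ, |(k : ℝ)| ≤ (k : ℝ) ^ 2 := fun k ↦ by
    rw [← sq_abs]
    rcases eq_or_ne k 0 with rfl | hk
    · simp
    · have : (1 : ℝ) ≤ |(k : ℝ)| := by exact_mod_cast Int.one_le_abs hk
      nlinarith
  nlinarith [i1 u.1, i1 u.2]

/-- The points of a box for which a short vector lies in a thin strip. -/
noncomputable def exceptional (a b c : ℝ) (R H : ℕ) : Finset (ℤ × ℤ) :=
  open Classical in
  insert 0 (((box H).erase 0).biUnion fun d ↦ (box R).filter fun u ↦ |polar a b c u d| < 1)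

theorem card_filter_polar_le {a b c : ℝ} {R m : ℕ} {d : ℤ × ℤ}
    (hd : 1 ≤ m * |a * d.1 + b / 2 * d.2| ∨ 1 ≤ m * |b / 2 * d.1 + c * d.2|) :
    ((box R).filter fun u ↦ |polar a b c u d| < 1).card ≤ 2 * ((2 * R + 1) * m) := by
  let x := a * d.1 + b / 2 * d.2
  let y := b / 2 * d.1 + c * d.2
  have : ((box R).filter fun u ↦ |polar a b c u d| < 1) ⊆ strip R x y (-1) ∪ strip R x y 0 := by
    intro u hu
    obtain ⟨h1, h2⟩ := Finset.mem_filter.mp hu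
    rw [polar_comm] at h2
    obtain ⟨h2, h3⟩ := abs_lt.mp h2
    rw [Finset.mem_union, strip, strip, Finset.mem_filter, Finset.mem_filter, Int.floor_eq_iff,
      Int.floor_eq_iff]
    change -1 < x * u.1 + y * u.2 at h2
    change x * u.1 + y * u.2 < 1 at h3
    rcases lt_or_ge (x * u.1 + y * u.2) 0 with h | h
    · left; refine ⟨h1, ?_, ?_⟩ <;> push_cast <;> linarith
    · right; refine ⟨h1, ?_, ?_⟩ <;> push_cast <;> linarith
  calc _ ≤ _ := Finset.card_le_card this
    _ ≤ _ := Finset.card_union_le _ _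
    _ ≤ _ := by rw [two_mul]; exact add_le_add (card_strip_le hd _) (card_strip_le hd _)

theorem card_exceptional_le {a b c : ℝ} {m : ℕ} (hm : ∀ u : ℤ × ℤ, u ≠ 0 →
      1 ≤ m * |a * u.1 + b / 2 * u.2| ∨ 1 ≤ m * |b / 2 * u.1 + c * u.2|) (R H : ℕ) :
    (exceptional a b c R H).card ≤ (2 * H + 1) ^ 2 * (2 * ((2 * R + 1) * m)) + 1 := by
  classical
  unfold exceptional
  refine (Finset.card_insert_le _ _).trans (Nat.add_le_add_right ?_ 1)
  refine (Finset.card_biUnion_le_card_mul _ _ (2 * ((2 * R + 1) * m)) fun d hd ↦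
    card_filter_polar_le (hm d (Finset.ne_of_mem_erase hd))).trans ?_
  gcongr
  exact (Finset.card_erase_le).trans (card_box H).le

/-- Let `R = 8 ^ i` and cut into blocks of length `h = 2 ^ i`. For ordinary `u` a strip has `O(R /
h)` points, for a total of `R² · R / h`. The exceptional `u` number `O(h² R)`, each with strips of
`O(R)` points. Both totals are `256 ^ i = R ^ (8/3)` exactly when `h³ = R`, which is why powers of
`8` are used. -/
theorem sum_box_polar_le {a b c : ℝ} (ha : 0 < a) (hD : 0 < 4 * a * c - b ^ 2) :
    ∃ C : ℝ, 0 ≤ C ∧ ∀ i : ℕ,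
      ∑ q ∈ box (8 ^ i) ×ˢ box (8 ^ i), 1 / (1 + polar a b c q.1 q.2 ^ 2) ≤ C * 256 ^ i := by
  classical
  obtain ⟨m, hm⟩ := exists_polar_coeff ha hD
  set G := ∑' j : ℤ, 3 / (1 + (j : ℝ) ^ 2) with hG
  have hG0 : 0 ≤ G := tsum_nonneg fun _ ↦ by positivity
  have hm0 : (0 : ℝ) ≤ m := Nat.cast_nonneg m
  refine ⟨G * (27 + 3 * (m : ℝ) * ((2 * m + 3) ^ 2 * (6 * m) + 1) + 9), by positivity, fun i ↦ ?_⟩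
  set E := exceptional a b c (8 ^ i) (2 ^ i + m)
  have e8 : (8 : ℕ) ^ i = 2 ^ i * 4 ^ i := by rw [← Nat.mul_pow]
  have one2 : (1 : ℝ) ≤ 2 ^ i := one_le_pow₀ (by norm_num)
  have e4 : (4 : ℝ) ^ i = (2 ^ i) ^ 2 := by rw [← pow_mul, mul_comm, pow_mul]; norm_num
  have e8' : (8 : ℝ) ^ i = (2 ^ i) ^ 3 := by rw [← pow_mul, mul_comm, pow_mul]; norm_num
  have e256 : (256 : ℝ) ^ i = (2 ^ i) ^ 8 := by rw [← pow_mul, mul_comm, pow_mul]; norm_num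
  have hE := card_exceptional_le hm (8 ^ i) (2 ^ i + m)
  -- A strip bound valid for every `u`: the ordinary one, the extra cost of an exceptional `u`, and
  -- the whole box for `u = 0`, where the linear form vanishes.
  let M : ℤ × ℤ → ℕ := fun u ↦ (2 * 4 ^ i + 1) + (if u ∈ E then (2 * 8 ^ i + 1) * m else 0) +
    (if u = 0 then (2 * 8 ^ i + 1) ^ 2 else 0)
  have hu : ∀ u ∈ box (8 ^ i), ∑ v ∈ box (8 ^ i), 1 / (1 + polar a b c u v ^ 2) ≤ M u * G := by
    intro u hu
    refine sum_box_strip_le (R := 8 ^ i) (M := M u) fun j ↦ ?_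
    by_cases h0 : u = 0
    · have : M u = (2 * 4 ^ i + 1) + (if u ∈ E then (2 * 8 ^ i + 1) * m else 0) +
        (2 * 8 ^ i + 1) ^ 2 := by simp only [M, if_pos h0]
      rw [this, ← card_box]
      exact (Finset.card_filter_le _ _).trans (Nat.le_add_left _ _)
    by_cases hE : u ∈ E
    · simp only [M, if_pos hE]
      refine (card_strip_le (hm u h0) j).trans ?_
      omega
    · simp only [M]
      by_contra! hcon
      apply hE
      rw [e8] at hcon
      obtain ⟨d, hd, hd0, hlt⟩ := exists_short_vector (q := 4 ^ i) (by positivity) (hm u h0)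
        (lt_of_le_of_lt (by omega) hcon)
      simp only [E, exceptional, Finset.mem_insert, Finset.mem_biUnion]
      exact Or.inr ⟨d, Finset.mem_erase.mpr ⟨hd0, hd⟩, Finset.mem_filter.mpr ⟨hu, hlt⟩⟩
  have hE' : (E.card : ℝ) ≤ (2 * (2 ^ i + m) + 1) ^ 2 * (2 * ((2 * 8 ^ i + 1) * m)) + 1 := by
    exact_mod_cast hE
  have hMsum : ((∑ u ∈ box (8 ^ i), M u : ℕ) : ℝ) ≤
      (2 * 8 ^ i + 1) ^ 2 * (2 * 4 ^ i + 1) + E.card * ((2 * 8 ^ i + 1) * m) +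
        (2 * 8 ^ i + 1) ^ 2 := by
    have : ∑ u ∈ box (8 ^ i), M u ≤ (2 * 8 ^ i + 1) ^ 2 * (2 * 4 ^ i + 1) +
        E.card * ((2 * 8 ^ i + 1) * m) + (2 * 8 ^ i + 1) ^ 2 := by
      simp only [M]
      rw [Finset.sum_add_distrib, Finset.sum_add_distrib]
      gcongr
      · rw [Finset.sum_const, card_box, smul_eq_mul]
      · rw [← Finset.sum_filter, Finset.sum_const, smul_eq_mul]
        gcongr
        exact fun u hu ↦ (Finset.mem_filter.mp hu).2
      · rw [← Finset.sum_filter, Finset.sum_const, smul_eq_mul]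
        refine Nat.mul_le_of_le_div _ _ _ ?_
        rw [Nat.div_self (by positivity)]
        refine (Finset.card_le_card (t := {0}) fun u hu ↦ ?_).trans (by simp)
        simpa using (Finset.mem_filter.mp hu).2
    exact_mod_cast this
  rw [Finset.sum_product]
  calc _ ≤ ∑ u ∈ box (8 ^ i), (M u : ℝ) * G := Finset.sum_le_sum hu
    _ = ((∑ u ∈ box (8 ^ i), M u : ℕ) : ℝ) * G := by rw [← Finset.sum_mul]; push_cast; rfl
    _ ≤ ((27 + 3 * (m : ℝ) * ((2 * m + 3) ^ 2 * (6 * m) + 1) + 9) * 256 ^ i) * G := by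
        refine mul_le_mul_of_nonneg_right (hMsum.trans ?_) hG0
        rw [e8'] at *
        rw [e4, e256]
        set t : ℝ := 2 ^ i
        have b1 : 2 * t ^ 3 + 1 ≤ 3 * t ^ 3 := by nlinarith [one_le_pow₀ one2 (n := 3)]
        have b2 : 2 * t ^ 2 + 1 ≤ 3 * t ^ 2 := by nlinarith [one_le_pow₀ one2 (n := 2)]
        have b3 : 2 * (t + m) + 1 ≤ (2 * m + 3) * t := by nlinarith
        have b4 : (E.card : ℝ) ≤ ((2 * m + 3) ^ 2 * (6 * m) + 1) * t ^ 5 := by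
          calc _ ≤ _ := hE'
            _ ≤ ((2 * m + 3) * t) ^ 2 * (2 * ((3 * t ^ 3) * m)) + t ^ 5 := by
                gcongr
                exact one_le_pow₀ one2
            _ = _ := by ring
        calc _ ≤ (3 * t ^ 3) ^ 2 * (3 * t ^ 2) +
              (((2 * m + 3) ^ 2 * (6 * m) + 1) * t ^ 5) * ((3 * t ^ 3) * m) + (3 * t ^ 3) ^ 2 * t ^ 2 := by
              gcongr
              exact (pow_le_pow_left₀ (by positivity) b1 2).trans
                (le_mul_of_one_le_right (by positivity) (one_le_pow₀ one2))
          _ = _ := by ring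
    _ = _ := by ring

/-- Level `i` contributes at most a multiple of `(256 · 64 ^ (-k)) ^ i`, and `256 = 64 ^ (4/3)`;
this is the origin of the threshold `4 / 3`. -/
theorem summable_sum_levels {a b c : ℝ} (ha : 0 < a) (hD : 0 < 4 * a * c - b ^ 2) {k : ℝ}
    (hk : 4 / 3 < k) : Summable fun r : ℕ × ((ℤ × ℤ) × (ℤ × ℤ)) ↦
      if r.2 ∈ box (8 ^ r.1) ×ˢ box (8 ^ r.1) then
        ((64 : ℝ) ^ (-k)) ^ r.1 * (1 / (1 + polar a b c r.2.1 r.2.2 ^ 2)) else 0 := by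
  obtain ⟨C, hC0, hC⟩ := sum_box_polar_le ha hD
  have hnn : ∀ r : ℕ × ((ℤ × ℤ) × (ℤ × ℤ)), 0 ≤ if r.2 ∈ box (8 ^ r.1) ×ˢ box (8 ^ r.1) then
        ((64 : ℝ) ^ (-k)) ^ r.1 * (1 / (1 + polar a b c r.2.1 r.2.2 ^ 2)) else 0 := fun r ↦ by
    split_ifs <;> positivity
  have hts : ∀ i : ℕ, ∑' q : (ℤ × ℤ) × (ℤ × ℤ), (if q ∈ box (8 ^ i) ×ˢ box (8 ^ i) then
        ((64 : ℝ) ^ (-k)) ^ i * (1 / (1 + polar a b c q.1 q.2 ^ 2)) else 0) ≤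
        C * (256 * (64 : ℝ) ^ (-k)) ^ i := fun i ↦ by
    rw [tsum_eq_sum (s := box (8 ^ i) ×ˢ box (8 ^ i)) fun q hq ↦ if_neg hq,
      Finset.sum_congr rfl fun q hq ↦ if_pos hq, ← Finset.mul_sum, mul_pow]
    calc _ ≤ ((64 : ℝ) ^ (-k)) ^ i * (C * 256 ^ i) := by gcongr; exact hC i
      _ = _ := by ring
  rw [summable_prod_of_nonneg hnn]
  refine ⟨fun i ↦ summable_of_ne_finset_zero (s := box (8 ^ i) ×ˢ box (8 ^ i))
    fun q hq ↦ if_neg hq, ?_⟩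
  refine ((summable_geometric_of_lt_one (by positivity) ?_).mul_left C).of_nonneg_of_le
    (fun i ↦ tsum_nonneg fun q ↦ hnn (i, q)) hts
  rw [show (256 : ℝ) = 64 ^ (4 / 3 : ℝ) by
    rw [show (64 : ℝ) = 4 ^ (3 : ℝ) by norm_num, ← Real.rpow_mul (by norm_num)]; norm_num,
    ← Real.rpow_add (by norm_num)]
  exact Real.rpow_lt_one_of_one_lt_of_neg (by norm_num) (by linarith)

/-- Pairs of vectors of almost equal length are rare. -/
theorem summable_pairs {a b c : ℝ} (ha : 0 < a) (hD : 0 < 4 * a * c - b ^ 2) {k : ℝ}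
    (hk : 4 / 3 < k) :
    Summable fun p : {p : ℤ × ℤ // p ≠ 0} × {p : ℤ × ℤ // p ≠ 0} ↦
      (form a b c p.1 + form a b c p.2) ^ (-k) / (1 + (form a b c p.1 - form a b c p.2) ^ 2) := by
  obtain ⟨δ, hδ, h⟩ := exists_form_lower ha hD
  let n : (ℤ × ℤ) × (ℤ × ℤ) → ℕ := fun q ↦
    max (max q.1.1.natAbs q.1.2.natAbs) (max q.2.1.natAbs q.2.2.natAbs)
  -- The variables `p - q` and `p + q` factor the difference of the form values as a bilinear form.
  -- Only injectivity is needed, so the parity condition on the image can be dropped.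
  let φ : {p : ℤ × ℤ // p ≠ 0} × {p : ℤ × ℤ // p ≠ 0} → (ℤ × ℤ) × (ℤ × ℤ) :=
    fun p ↦ (p.1.1 - p.2.1, p.1.1 + p.2.1)
  have hφ : Function.Injective φ := by
    rintro ⟨⟨⟨p1, p2⟩, _⟩, ⟨⟨q1, q2⟩, _⟩⟩ ⟨⟨⟨r1, r2⟩, _⟩, ⟨⟨s1, s2⟩, _⟩⟩ e
    simp only [φ, Prod.mk.injEq, Prod.mk_sub_mk, Prod.mk_add_mk] at e
    simp only [Prod.mk.injEq, Subtype.mk.injEq]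
    omega
  -- Each pair is filed under the least `i` for which the box of size `8 ^ i` contains its image.
  let ψ : {p : ℤ × ℤ // p ≠ 0} × {p : ℤ × ℤ // p ≠ 0} → ℕ × ((ℤ × ℤ) × (ℤ × ℤ)) :=
    fun p ↦ (Nat.clog 8 (n (φ p)), φ p)
  have hψ : Function.Injective ψ := fun p q e ↦ hφ (congrArg Prod.snd e)
  refine (((summable_sum_levels ha hD hk).comp_injective hψ).mul_left
    ((δ / 128) ^ (-k))).of_nonneg_of_le (fun p ↦ ?_) fun p ↦ ?_
  · have := form_pos ha hD p.1.2
    have := form_pos ha hD p.2.2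
    positivity
  · set q := φ p with hq
    set i := Nat.clog 8 (n q)
    have hni : n q ≤ 8 ^ i := Nat.le_pow_clog (by norm_num) _
    have hn0 : 0 < n q := by
      by_contra hcon
      have h0 : n q = 0 := by omega
      simp only [n, Nat.max_eq_zero_iff, Int.natAbs_eq_zero] at h0
      have h1 : q.1 = 0 := Prod.ext h0.1.1 h0.1.2
      have h2 : q.2 = 0 := Prod.ext h0.2.1 h0.2.2
      simp only [hq, φ] at h1 h2
      apply p.1.2
      have e1 := congrArg Prod.fst h1
      have e2 := congrArg Prod.snd h1
      have e3 := congrArg Prod.fst h2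
      have e4 := congrArg Prod.snd h2
      simp only [Prod.fst_sub, Prod.snd_sub, Prod.fst_add, Prod.snd_add, Prod.fst_zero,
        Prod.snd_zero] at e1 e2 e3 e4
      exact Prod.ext (by simp; omega) (by simp; omega)
    have hin : 8 ^ i ≤ 8 * n q := by
      rcases Nat.eq_zero_or_pos i with h0 | h0
      · rw [h0]; omega
      · have := Nat.pow_pred_clog_lt_self (b := 8) (x := n q) (by norm_num) (by
          by_contra hcon
          have : n q = 1 := by omega
          simp [i, this] at h0)
        have h8 : 8 ^ i = 8 * 8 ^ (i - 1) := by rw [← pow_succ']; congr 1; omega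
        rw [h8]
        exact Nat.mul_le_mul_left 8 this.le
    have hmem : q ∈ box (8 ^ i) ×ˢ box (8 ^ i) := by
      simp only [n, max_le_iff] at hni
      rw [Finset.mem_product, mem_box, mem_box]
      simp only [Int.abs_eq_natAbs]
      exact ⟨⟨by exact_mod_cast hni.1.1, by exact_mod_cast hni.1.2⟩,
        by exact_mod_cast hni.2.1, by exact_mod_cast hni.2.2⟩
    simp only [Function.comp_apply, ψ]
    rw [if_pos hmem]
    have e1 : form a b c p.1 - form a b c p.2 = polar a b c q.1 q.2 := by
      simp only [form, polar, hq, φ, Prod.fst_sub, Prod.snd_sub, Prod.fst_add, Prod.snd_add]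
      push_cast
      ring
    have e2 : form a b c p.1 + form a b c p.2 = (form a b c q.1 + form a b c q.2) / 2 := by
      simp only [form, hq, φ, Prod.fst_sub, Prod.snd_sub, Prod.fst_add, Prod.snd_add]
      push_cast
      ring
    -- In `128 = 2 · 64`, the `2` is the parallelogram law and the `64` is the square of the loss in
    -- rounding up to a power of `8`.
    have e3 : δ / 128 * (64 : ℝ) ^ i ≤ form a b c p.1 + form a b c p.2 := by
      have h1 := h q.1
      have h2 := h q.2
      have hn : (n q : ℝ) ^ 2 ≤
          ((q.1.1 : ℝ) ^ 2 + (q.1.2 : ℝ) ^ 2) + ((q.2.1 : ℝ) ^ 2 + (q.2.2 : ℝ) ^ 2) := by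
        have : ((n q : ℤ)) ^ 2 ≤ (q.1.1 ^ 2 + q.1.2 ^ 2) + (q.2.1 ^ 2 + q.2.2 ^ 2) := by
          have hc : ∃ z : ℤ, (n q : ℤ) ^ 2 = z ^ 2 ∧
              (z = q.1.1 ∨ z = q.1.2 ∨ z = q.2.1 ∨ z = q.2.2) := by
            simp only [n]
            rcases max_choice (max q.1.1.natAbs q.1.2.natAbs) (max q.2.1.natAbs q.2.2.natAbs) with e | e
            · rw [e]
              rcases max_choice q.1.1.natAbs q.1.2.natAbs with e | e <;> rw [e]
              · exact ⟨q.1.1, by simp, by simp⟩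
              · exact ⟨q.1.2, by simp, by simp⟩
            · rw [e]
              rcases max_choice q.2.1.natAbs q.2.2.natAbs with e | e <;> rw [e]
              · exact ⟨q.2.1, by simp, by simp⟩
              · exact ⟨q.2.2, by simp, by simp⟩
          obtain ⟨z, hz, hz'⟩ := hc
          rw [hz]
          rcases hz' with rfl | rfl | rfl | rfl <;>
          nlinarith [sq_nonneg q.1.1, sq_nonneg q.1.2, sq_nonneg q.2.1, sq_nonneg q.2.2]
        exact_mod_cast this
      have h64 : (64 : ℝ) ^ i ≤ 64 * (n q : ℝ) ^ 2 := by
        have : ((8 : ℝ) ^ i) ≤ 8 * n q := by exact_mod_cast hin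
        calc (64 : ℝ) ^ i = (8 ^ i) ^ 2 := by rw [← pow_mul, mul_comm, pow_mul]; norm_num
          _ ≤ (8 * n q) ^ 2 := by gcongr
          _ = _ := by ring
      rw [e2]
      nlinarith [mul_le_mul_of_nonneg_left h64 hδ.le, mul_le_mul_of_nonneg_left hn hδ.le]
    rw [e1, ← mul_assoc, mul_one_div]
    gcongr
    calc _ ≤ (δ / 128 * (64 : ℝ) ^ i) ^ (-k) :=
          Real.rpow_le_rpow_of_nonpos (by positivity) e3 (by linarith)
      _ = _ := by
          rw [Real.mul_rpow (by positivity) (by positivity), ← Real.rpow_natCast,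
            ← Real.rpow_natCast, ← Real.rpow_mul (by norm_num), ← Real.rpow_mul (by norm_num),
            mul_comm (-k)]

/-! ### Euler integrals with complex frequency and a smooth cut-off. -/

theorem isOpen_re_pos : IsOpen {w : ℂ | 0 < w.re} := isOpen_lt continuous_const continuous_re

theorem eqOn_re_pos_of_eq_on_pos {f g : ℂ → ℂ} (hf : DifferentiableOn ℂ f {w | 0 < w.re})
    (hg : DifferentiableOn ℂ g {w | 0 < w.re}) (h : ∀ t : ℝ, 0 < t → f t = g t) :
    EqOn f g {w | 0 < w.re} := by
  refine (hf.analyticOnNhd isOpen_re_pos).eqOn_of_preconnected_of_frequently_eq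
    (hg.analyticOnNhd isOpen_re_pos) (convex_halfSpace_re_gt 0).isPreconnected
    (z₀ := 1) (by simp) ?_
  have ht : Tendsto (fun n : ℕ ↦ ((1 + 1 / ((n : ℝ) + 1) : ℝ) : ℂ)) atTop (𝓝[≠] 1) := by
    rw [tendsto_nhdsWithin_iff]
    constructor
    · have := (tendsto_one_div_add_atTop_nhds_zero_nat (𝕜 := ℝ)).const_add 1
      rw [add_zero] at this
      exact_mod_cast (continuous_ofReal.tendsto (1 : ℝ)).comp this
    · refine Eventually.of_forall fun n ↦ ?_
      rw [mem_compl_iff, mem_singleton_iff, ← ofReal_one, ofReal_inj]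
      have : 0 < 1 / ((n : ℝ) + 1) := by positivity
      linarith
  exact ht.frequently (Frequently.of_forall fun n ↦ h _ (by positivity))

theorem norm_cpow_mul_exp {a r : ℂ} {t : ℝ} (ht : 0 < t) :
    ‖(t : ℂ) ^ (a - 1) * cexp (-(r * t))‖ = t ^ (a.re - 1) * rexp (-r.re * t) := by
  rw [norm_mul, norm_cpow_eq_rpow_re_of_pos ht, Complex.norm_exp]
  simp

theorem integrableOn_rpow_mul_exp {s b : ℝ} (hs : 0 < s) (hb : 0 < b) :
    IntegrableOn (fun t : ℝ ↦ t ^ (s - 1) * rexp (-b * t)) (Ioi 0) := by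
  simpa using integrableOn_rpow_mul_exp_neg_mul_rpow (p := 1) (s := s - 1) (by linarith) one_pos hb

theorem aestronglyMeasurable_cpow_mul_exp (a r : ℂ) :
    AEStronglyMeasurable (fun t : ℝ ↦ (t : ℂ) ^ (a - 1) * cexp (-(r * t)))
      (volume.restrict (Ioi 0)) := by
  refine ContinuousOn.aestronglyMeasurable (fun t ht ↦ ?_) measurableSet_Ioi
  refine ((continuousAt_ofReal_cpow_const _ _ (Or.inr (ne_of_gt ht))).mul
    (by fun_prop)).continuousWithinAt

theorem integrableOn_cpow_mul_exp {a r : ℂ} (ha : 0 < a.re) (hr : 0 < r.re) :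
    IntegrableOn (fun t : ℝ ↦ (t : ℂ) ^ (a - 1) * cexp (-(r * t))) (Ioi 0) := by
  refine (integrableOn_rpow_mul_exp ha hr).mono' (aestronglyMeasurable_cpow_mul_exp a r) ?_
  filter_upwards [ae_restrict_mem measurableSet_Ioi] with t ht
  exact (norm_cpow_mul_exp ht).le

/-- Euler's integral for a complex frequency in the right half-plane. -/
theorem integral_cpow_mul_exp {a r : ℂ} (ha : 0 < a.re) (hr : 0 < r.re) :
    ∫ t : ℝ in Ioi 0, (t : ℂ) ^ (a - 1) * cexp (-(r * t)) = r ^ (-a) * Gamma a := by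
  refine eqOn_re_pos_of_eq_on_pos (f := fun r ↦ ∫ t : ℝ in Ioi 0, (t : ℂ) ^ (a - 1) * cexp (-(r * t)))
    (g := fun r ↦ r ^ (-a) * Gamma a) ?_ ?_ ?_ hr
  · intro r₀ hr₀
    have hr₀ : 0 < r₀.re := hr₀
    refine (hasDerivAt_integral_of_dominated_loc_of_deriv_le (s := {w : ℂ | r₀.re / 2 < w.re})
      (bound := fun t ↦ t ^ (a.re + 1 - 1) * rexp (-(r₀.re / 2) * t))
      (F' := fun r t ↦ (t : ℂ) ^ (a - 1) * (cexp (-(r * t)) * (-(1 * t))))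
      ((isOpen_lt continuous_const continuous_re).mem_nhds (by
        change r₀.re / 2 < r₀.re; linarith))
      (Eventually.of_forall fun r ↦ aestronglyMeasurable_cpow_mul_exp a r)
      (integrableOn_cpow_mul_exp ha hr₀) ?_ ?_ (integrableOn_rpow_mul_exp (by linarith)
        (by positivity)) ?_).2.differentiableAt.differentiableWithinAt
    · simp_rw [← mul_assoc]
      exact (aestronglyMeasurable_cpow_mul_exp a r₀).mul (by fun_prop)
    · filter_upwards [ae_restrict_mem measurableSet_Ioi] with t ht r hr
      have ht : 0 < t := ht
      have hr : r₀.re / 2 < r.re := hr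
      rw [← mul_assoc, norm_mul, norm_cpow_mul_exp ht, one_mul, norm_neg, norm_real,
        Real.norm_of_nonneg ht.le, mul_right_comm, ← Real.rpow_add_one ht.ne']
      rw [sub_add_cancel, add_sub_cancel_right]
      gcongr
    · filter_upwards with t r _
      refine HasDerivAt.const_mul _ (HasDerivAt.cexp ?_)
      exact ((hasDerivAt_id r).mul_const (t : ℂ)).neg
  · intro r hr
    exact ((differentiableAt_id.cpow_const (Or.inl hr)).mul_const _).differentiableWithinAt
  · intro t ht
    rw [Complex.integral_cpow_mul_exp_neg_mul_Ioi ha ht, one_div, inv_cpow _ _ (by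
      rw [arg_ofReal_of_nonneg ht.le]; exact pi_pos.ne), cpow_neg]

theorem norm_add_ofReal_ge {κ : ℂ} (hκ : 0 < κ.re) {t : ℝ} (ht : 0 ≤ t) : ‖κ‖ ≤ ‖κ + t‖ := by
  rw [← sq_le_sq₀ (norm_nonneg _) (norm_nonneg _), ← normSq_eq_norm_sq, ← normSq_eq_norm_sq,
    normSq_apply, normSq_apply]
  simp only [add_re, ofReal_re, add_im, ofReal_im, add_zero]
  nlinarith

theorem norm_cpow_add_le {κ : ℂ} (hκ : 0 < κ.re) {t s : ℝ} (ht : 0 ≤ t) (hs : 0 ≤ s) :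
    ‖(κ + t) ^ (-s : ℂ)‖ ≤ ‖κ‖ ^ (-s) := by
  have h0 : 0 < ‖κ‖ := norm_pos_iff.mpr fun h ↦ by simp [h] at hκ
  rw [show (-s : ℂ) = ((-s : ℝ) : ℂ) by push_cast; rfl, norm_cpow_real]
  exact Real.rpow_le_rpow_of_nonpos h0 (norm_add_ofReal_ge hκ ht) (by linarith)

/-- The triangle inequality gives `4 ‖κ‖ ^ (-s)`. Applying the mean value inequality twice gives `s
(s + 1) ‖κ‖ ^ (-s - 2)`, since `‖κ + t‖ ≥ ‖κ‖` for `t ≥ 0`. Adding the first to `‖κ‖²` times the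
second yields the claim. -/
theorem norm_second_difference_le {κ : ℂ} (hκ : 0 < κ.re) {s : ℝ} (hs : 0 < s) :
    ‖κ ^ (-s : ℂ) - 2 * (κ + 1) ^ (-s : ℂ) + (κ + 2) ^ (-s : ℂ)‖ ≤
      (4 + s * (s + 1)) * (‖κ‖ ^ (-s) / (1 + ‖κ‖ ^ 2)) := by
  have h0 : 0 < ‖κ‖ := norm_pos_iff.mpr fun h ↦ by simp [h] at hκ
  set N := ‖κ ^ (-s : ℂ) - 2 * (κ + 1) ^ (-s : ℂ) + (κ + 2) ^ (-s : ℂ)‖ with hN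
  have hre : ∀ {t : ℝ}, 0 ≤ t → κ + t ∈ slitPlane := fun ht ↦ Or.inl (by
    simp only [add_re, ofReal_re]; linarith)
  have b1 : N ≤ 4 * ‖κ‖ ^ (-s) := by
    have e0 := norm_cpow_add_le hκ (t := 0) le_rfl hs.le
    have e1 := norm_cpow_add_le hκ (t := 1) zero_le_one hs.le
    have e2 := norm_cpow_add_le hκ (t := 2) zero_le_two hs.le
    push_cast at e0 e1 e2
    rw [add_zero] at e0
    calc N ≤ ‖κ ^ (-s : ℂ) - 2 * (κ + 1) ^ (-s : ℂ)‖ + ‖(κ + 2) ^ (-s : ℂ)‖ := norm_add_le _ _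
      _ ≤ ‖κ ^ (-s : ℂ)‖ + ‖2 * (κ + 1) ^ (-s : ℂ)‖ + ‖(κ + 2) ^ (-s : ℂ)‖ := by
          gcongr; exact norm_sub_le _ _
      _ ≤ _ := by rw [norm_mul, Complex.norm_ofNat]; linarith
  have b2 : N ≤ s * (s + 1) * ‖κ‖ ^ (-s - 2) := by
    have d (c : ℂ) (t : ℝ) (ht : 0 ≤ t) : HasDerivAt (fun t : ℝ ↦ (κ + t) ^ c)
        (c * (κ + t) ^ (c - 1)) t := by
      have h1 := ((hasDerivAt_id (t : ℂ)).const_add κ).cpow_const (c := c) (hre ht)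
      simpa using h1.comp_ofReal
    have d1 : ∀ t : ℝ, 0 ≤ t → HasDerivAt (fun t : ℝ ↦ (κ + t) ^ (-s : ℂ))
        (-s * (κ + t) ^ (-s - 1 : ℂ)) t := d _
    have d2 : ∀ t : ℝ, 0 ≤ t → HasDerivAt (fun t : ℝ ↦ -s * (κ + t) ^ (-s - 1 : ℂ))
        (-s * ((-s - 1) * (κ + t) ^ (-s - 2 : ℂ))) t := fun t ht ↦ by
      have := (d (-s - 1) t ht).const_mul (-s : ℂ)
      rwa [show (-s - 1 - 1 : ℂ) = -s - 2 by ring] at this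
    have n2 : ∀ t : ℝ, 0 ≤ t → ‖(-s * ((-s - 1) * (κ + t) ^ (-s - 2 : ℂ)) : ℂ)‖ ≤
        s * (s + 1) * ‖κ‖ ^ (-s - 2) := fun t ht ↦ by
      have := norm_cpow_add_le hκ ht (s := s + 2) (by linarith)
      rw [norm_mul, norm_mul, norm_neg, norm_real, Real.norm_of_nonneg hs.le,
        show (-s - 1 : ℂ) = ((-(s + 1) : ℝ) : ℂ) by push_cast; ring, norm_real, norm_neg,
        Real.norm_of_nonneg (by linarith), ← mul_assoc]
      gcongr
      convert! this using 2
      · push_cast; ring_nf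
      · ring_nf
    have l1 : ∀ t : ℝ, 0 ≤ t → ‖(-s * (κ + (t + 1 : ℝ)) ^ (-s - 1 : ℂ) - -s * (κ + t) ^ (-s - 1 : ℂ) : ℂ)‖ ≤
        s * (s + 1) * ‖κ‖ ^ (-s - 2) := fun t ht ↦ by
      have := (convex_Icc t (t + 1)).norm_image_sub_le_of_norm_hasDerivWithin_le
        (fun x hx ↦ (d2 x (ht.trans hx.1)).hasDerivWithinAt) (fun x hx ↦ n2 x (ht.trans hx.1))
        (left_mem_Icc.mpr (by linarith)) (right_mem_Icc.mpr (by linarith))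
      simpa using this
    have l2 := (convex_Icc (0 : ℝ) 1).norm_image_sub_le_of_norm_hasDerivWithin_le
      (f := fun t : ℝ ↦ (κ + (t + 1 : ℝ)) ^ (-s : ℂ) - (κ + t) ^ (-s : ℂ))
      (fun x hx ↦ (((d1 (x + 1) (by linarith [hx.1])).comp_add_const x 1).sub
        (d1 x hx.1)).hasDerivWithinAt) (fun x hx ↦ l1 x hx.1)
        (left_mem_Icc.mpr zero_le_one) (right_mem_Icc.mpr zero_le_one)
    simp only [zero_add, ofReal_add, ofReal_one, ofReal_zero, add_zero, sub_zero, norm_one,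
      mul_one] at l2
    refine le_trans (le_of_eq ?_) l2
    rw [hN]
    congr 1
    rw [show (1 + 1 : ℂ) = 2 by norm_num]
    ring
  rw [mul_div_assoc', le_div_iff₀ (by positivity)]
  have e : ‖κ‖ ^ (-s - 2) * ‖κ‖ ^ 2 = ‖κ‖ ^ (-s) := by
    rw [← Real.rpow_natCast, ← Real.rpow_add h0]; congr 1; push_cast; ring
  calc N * (1 + ‖κ‖ ^ 2) = N + N * ‖κ‖ ^ 2 := by ring
    _ ≤ 4 * ‖κ‖ ^ (-s) + s * (s + 1) * ‖κ‖ ^ (-s - 2) * ‖κ‖ ^ 2 := by gcongr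
    _ = _ := by rw [mul_assoc, e]; ring

/-- The weight `x ^ (s - 1) (1 - exp (-x))²`. -/
noncomputable def weight (s x : ℝ) : ℝ := x ^ (s - 1) * (1 - rexp (-x)) ^ 2

theorem weight_nonneg {s x : ℝ} (hx : 0 < x) : 0 ≤ weight s x := by unfold weight; positivity

theorem weight_mul_exp_eq {s x : ℝ} (hx : 0 < x) (κ : ℂ) :
    (weight s x : ℂ) * cexp (-(κ * x)) = (x : ℂ) ^ ((s : ℂ) - 1) * cexp (-(κ * x)) -
      2 * ((x : ℂ) ^ ((s : ℂ) - 1) * cexp (-((κ + 1) * x))) +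
      (x : ℂ) ^ ((s : ℂ) - 1) * cexp (-((κ + 2) * x)) := by
  have e : cexp (-(x : ℂ)) ^ 2 = cexp (-(2 * x)) := by rw [← Complex.exp_nat_mul]; congr 1; push_cast; ring
  rw [weight, show (s : ℂ) - 1 = ((s - 1 : ℝ) : ℂ) by push_cast; rfl, ← Complex.ofReal_cpow hx.le,
    show -((κ + 1) * x) = -(κ * x) + -x by ring, show -((κ + 2) * x) = -(κ * x) + -(2 * x) by ring,
    Complex.exp_add, Complex.exp_add, ← e]
  push_cast
  ring

theorem integrableOn_weight_mul_exp {s : ℝ} (hs : 0 < s) {κ : ℂ} (hκ : 0 < κ.re) :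
    IntegrableOn (fun x : ℝ ↦ (weight s x : ℂ) * cexp (-(κ * x))) (Ioi 0) := by
  have hs' : 0 < (s : ℂ).re := by simpa using hs
  refine (((integrableOn_cpow_mul_exp hs' hκ).sub ((integrableOn_cpow_mul_exp (r := κ + 1) hs'
    (by simp; linarith)).const_mul 2)).add (integrableOn_cpow_mul_exp (r := κ + 2) hs'
    (by simp; linarith))).congr ?_
  filter_upwards [ae_restrict_mem measurableSet_Ioi] with x hx
  exact (weight_mul_exp_eq hx κ).symm

/-- Expanding `(1 - exp (-x))²` turns the integral into `Γ(s)` times a second difference of `κ ^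
(-s)`. The double zero of the weight factor thus buys the decay `1 / (1 + ‖κ‖²)` that suppresses
pairs of unequal length. -/
theorem norm_integral_weight_mul_exp_le {s : ℝ} (hs : 0 < s) {κ : ℂ} (hκ : 0 < κ.re) :
    ‖∫ x : ℝ in Ioi 0, (weight s x : ℂ) * cexp (-(κ * x))‖ ≤
      Real.Gamma s * (4 + s * (s + 1)) * (‖κ‖ ^ (-s) / (1 + ‖κ‖ ^ 2)) := by
  have hs' : 0 < (s : ℂ).re := by simpa using hs
  have h1 : 0 < (κ + 1).re := by simp; linarith
  have h2 : 0 < (κ + 2).re := by simp; linarith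
  have e : ∫ x : ℝ in Ioi 0, (weight s x : ℂ) * cexp (-(κ * x)) =
      Complex.Gamma s * (κ ^ (-s : ℂ) - 2 * (κ + 1) ^ (-s : ℂ) + (κ + 2) ^ (-s : ℂ)) := by
    have i0 := integrableOn_cpow_mul_exp hs' hκ
    have i1 : IntegrableOn (fun x : ℝ ↦ 2 * ((x : ℂ) ^ ((s : ℂ) - 1) * cexp (-((κ + 1) * x))))
      (Ioi 0) := (integrableOn_cpow_mul_exp hs' h1).const_mul 2
    have i01 : IntegrableOn (fun x : ℝ ↦ (x : ℂ) ^ ((s : ℂ) - 1) * cexp (-(κ * x)) -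
      2 * ((x : ℂ) ^ ((s : ℂ) - 1) * cexp (-((κ + 1) * x)))) (Ioi 0) := i0.sub i1
    rw [setIntegral_congr_fun measurableSet_Ioi fun x hx ↦ weight_mul_exp_eq hx κ,
      integral_add i01 (integrableOn_cpow_mul_exp hs' h2), integral_sub i0 i1, integral_const_mul,
      integral_cpow_mul_exp hs' hκ, integral_cpow_mul_exp hs' h1, integral_cpow_mul_exp hs' h2]
    ring
  rw [e, norm_mul, Complex.Gamma_ofReal, norm_real, Real.norm_of_nonneg (Real.Gamma_pos_of_pos hs).le,
    mul_assoc]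
  exact mul_le_mul_of_nonneg_left (norm_second_difference_le hκ hs) (Real.Gamma_pos_of_pos hs).le

/-! ### The theta series in the right half-plane and its mean square on rays. -/

/-- The theta series without its constant term, at a point of the right half-plane. -/
noncomputable def thetaTail (a b c : ℝ) (w : ℂ) : ℂ :=
  ∑' p : {p : ℤ × ℤ // p ≠ 0}, cexp (-(π * form a b c p * w))

theorem norm_thetaTail_term (a b c : ℝ) (p : ℤ × ℤ) (w : ℂ) :
    ‖cexp (-(π * form a b c p * w))‖ = rexp (-π * form a b c p * w.re) := by
  rw [Complex.norm_exp, ← ofReal_mul, neg_re, re_ofReal_mul, neg_mul, neg_mul]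

theorem summable_norm_thetaTail {a b c : ℝ} (ha : 0 < a) (hD : 0 < 4 * a * c - b ^ 2) {w : ℂ}
    (hw : 0 < w.re) :
    Summable fun p : {p : ℤ × ℤ // p ≠ 0} ↦ ‖cexp (-(π * form a b c p * w))‖ := by
  simp_rw [norm_thetaTail_term]
  exact (hasSum_theta_sub_one ha hD hw).summable

theorem hasSum_thetaTail {a b c : ℝ} (ha : 0 < a) (hD : 0 < 4 * a * c - b ^ 2) {w : ℂ}
    (hw : 0 < w.re) : HasSum (fun p : {p : ℤ × ℤ // p ≠ 0} ↦ cexp (-(π * form a b c p * w)))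
      (thetaTail a b c w) :=
  (summable_norm_thetaTail ha hD hw).of_norm.hasSum

theorem thetaTail_ofReal {a b c : ℝ} (ha : 0 < a) (hD : 0 < 4 * a * c - b ^ 2) {t : ℝ}
    (ht : 0 < t) : thetaTail a b c t = ((theta a b c t - 1 : ℝ) : ℂ) := by
  refine (hasSum_thetaTail ha hD (w := t) (by simpa using ht)).unique ?_
  refine (Complex.hasSum_ofReal.mpr (hasSum_theta_sub_one ha hD ht)).congr_fun fun p ↦ ?_
  push_cast
  ring_nf

theorem differentiableOn_thetaTail {a b c : ℝ} (ha : 0 < a) (hD : 0 < 4 * a * c - b ^ 2) :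
    DifferentiableOn ℂ (thetaTail a b c) {w | 0 < w.re} := by
  intro w hw
  have hw : 0 < w.re := hw
  have ho : IsOpen {v : ℂ | w.re / 2 < v.re} := isOpen_lt continuous_const continuous_re
  have h := differentiableOn_tsum_of_summable_norm (U := {v : ℂ | w.re / 2 < v.re})
    (F := fun (p : {p : ℤ × ℤ // p ≠ 0}) (w : ℂ) ↦ cexp (-(π * form a b c p * w)))
    (hasSum_theta_sub_one ha hD (t := w.re / 2) (by positivity)).summable
    (fun p ↦ by fun_prop) ho fun p v hv ↦ by
      have hv : w.re / 2 < v.re := hv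
      have := form_pos ha hD p.2
      rw [norm_thetaTail_term]
      refine Real.exp_le_exp.mpr ?_
      have := mul_le_mul_of_nonneg_left hv.le (by positivity : 0 ≤ π * form a b c p)
      linarith
  exact (h.differentiableAt (ho.mem_nhds (by change w.re / 2 < w.re; linarith))).differentiableWithinAt

open ComplexConjugate in
theorem thetaTail_conj (a b c : ℝ) (w : ℂ) :
    thetaTail a b c (conj w) = conj (thetaTail a b c w) := by
  rw [thetaTail, thetaTail, conj_tsum]
  refine tsum_congr fun p ↦ ?_
  rw [← Complex.exp_conj]
  simp

theorem continuousOn_thetaTail_ray {a b c : ℝ} (ha : 0 < a) (hD : 0 < 4 * a * c - b ^ 2) {w : ℂ}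
    (hw : 0 < w.re) : ContinuousOn (fun x : ℝ ↦ thetaTail a b c (w * x)) (Ioi 0) :=
  (differentiableOn_thetaTail ha hD).continuousOn.comp (by fun_prop) fun x hx ↦ by
    have hx : 0 < x := hx
    simp only [mem_ofPred_eq, re_mul_ofReal]
    positivity

open ComplexConjugate in
theorem hasSum_mul_conj {ι : Type*} {f : ι → ℂ} {A : ℂ} (hf : HasSum f A)
    (hs : Summable fun i ↦ ‖f i‖) :
    HasSum (fun p : ι × ι ↦ f p.1 * conj (f p.2)) ((‖A‖ ^ 2 : ℝ) : ℂ) := by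
  have hs' : Summable fun i ↦ ‖conj (f i)‖ := by simpa using hs
  have hc : HasSum (fun i ↦ conj (f i)) (conj A) := Complex.hasSum_conj'.mpr hf
  have h := hf.mul hc (summable_mul_of_summable_norm (f := f) (g := fun i ↦ conj (f i)) hs hs')
  rwa [Complex.mul_conj, normSq_eq_norm_sq] at h

open ComplexConjugate in
theorem hasSum_weight_mul_norm_sq {a b c : ℝ} (ha : 0 < a) (hD : 0 < 4 * a * c - b ^ 2) {w : ℂ}
    (hw : 0 < w.re) {x : ℝ} (hx : 0 < x) (s : ℝ) :
    HasSum (fun p : {p : ℤ × ℤ // p ≠ 0} × {p : ℤ × ℤ // p ≠ 0} ↦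
      (weight s x : ℂ) * cexp (-(π * (w * form a b c p.1 + conj w * form a b c p.2) * x)))
      ((weight s x * ‖thetaTail a b c (w * x)‖ ^ 2 : ℝ) : ℂ) := by
  have h1 : 0 < (w * x).re := by rw [re_mul_ofReal]; positivity
  have h := (hasSum_mul_conj (hasSum_thetaTail ha hD h1)
    (summable_norm_thetaTail ha hD h1)).mul_left (weight s x : ℂ)
  rw [← ofReal_mul] at h
  have e : ∀ p : {p : ℤ × ℤ // p ≠ 0} × {p : ℤ × ℤ // p ≠ 0},
      (weight s x : ℂ) * cexp (-(π * (w * form a b c p.1 + conj w * form a b c p.2) * x)) =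
      weight s x * (cexp (-(π * form a b c p.1 * (w * x))) *
        conj (cexp (-(π * form a b c p.2 * (w * x))))) := fun p ↦ by
    rw [← Complex.exp_conj, ← Complex.exp_add]
    congr 2
    simp only [map_mul, map_neg, conj_ofReal]
    ring
  simp_rw [e]
  exact h

theorem exists_form_ge {a b c : ℝ} (ha : 0 < a) (hD : 0 < 4 * a * c - b ^ 2) :
    ∃ δ : ℝ, 0 < δ ∧ δ ≤ 1 ∧ ∀ p : ℤ × ℤ, p ≠ 0 → δ ≤ form a b c p := by
  obtain ⟨δ, hδ, h⟩ := exists_form_lower ha hD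
  refine ⟨min δ 1, by positivity, min_le_right _ _, fun p hp ↦ ?_⟩
  have := h p
  nlinarith [one_le_sq_add_sq hp, min_le_left δ 1]

/-- Since `Q(p) Q(q) ≤ (Q(p) + Q(q))²`, the double series is dominated by the square of the series
for `ζ_Q` at `k / 2`. It serves only to justify exchanging sum and integral. -/
theorem summable_form_add_rpow {a b c : ℝ} (ha : 0 < a) (hD : 0 < 4 * a * c - b ^ 2) {k : ℝ}
    (hk : 2 < k) : Summable fun p : {p : ℤ × ℤ // p ≠ 0} × {p : ℤ × ℤ // p ≠ 0} ↦
      (form a b c p.1 + form a b c p.2) ^ (-k) := by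
  have h := summable_zeta ha hD (σ := k / 2) (by linarith)
  have hpos := fun p : {p : ℤ × ℤ // p ≠ 0} ↦ form_pos ha hD p.2
  refine (h.mul_of_nonneg h (fun p ↦ by have := hpos p; positivity)
    (fun p ↦ by have := hpos p; positivity)).of_nonneg_of_le
    (fun p ↦ by have := hpos p.1; have := hpos p.2; positivity) fun p ↦ ?_
  have h1 := hpos p.1
  have h2 := hpos p.2
  rw [one_div_mul_one_div, ← Real.mul_rpow h1.le h2.le, one_div, ← Real.rpow_neg (by positivity)]
  calc _ = ((form a b c p.1 + form a b c p.2) ^ 2) ^ (-(k / 2)) := by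
        rw [← Real.rpow_natCast, ← Real.rpow_mul (by positivity)]; congr 1; push_cast; ring
    _ ≤ _ := Real.rpow_le_rpow_of_nonpos (by positivity) (by nlinarith) (by linarith)

open ComplexConjugate in
/-- Mean square of the theta series along a ray close to the imaginary axis. -/
theorem thetaTail_mean_square {a b c : ℝ} (ha : 0 < a) (hD : 0 < 4 * a * c - b ^ 2) {k S : ℝ}
    (hk : 4 / 3 < k) : ∃ C : ℝ, 0 ≤ C ∧ ∀ w : ℂ, 0 < w.re → 1 / 2 ≤ |w.im| → ∀ s ∈ Icc k S,
      ∫⁻ x in Ioi (1 : ℝ), ‖thetaTail a b c (w * x)‖ₑ ^ 2 * ENNReal.ofReal (x ^ (s - 1)) ≤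
        ENNReal.ofReal (C * w.re ^ (-s)) := by
  obtain ⟨δ, hδ, hδ1, hδf⟩ := exists_form_ge ha hD
  have hsum := summable_pairs ha hD hk
  have hpos := fun p : {p : ℤ × ℤ // p ≠ 0} ↦ form_pos ha hD p.2
  set P := ∑' p : {p : ℤ × ℤ // p ≠ 0} × {p : ℤ × ℤ // p ≠ 0},
    (form a b c p.1 + form a b c p.2) ^ (-k) / (1 + (form a b c p.1 - form a b c p.2) ^ 2)
  have hP : 0 ≤ P := tsum_nonneg fun p ↦ by
    have := hpos p.1; have := hpos p.2; positivity
  obtain ⟨B, hB⟩ := (isCompact_Icc (a := k) (b := S)).exists_bound_of_continuousOn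
    (f := fun s ↦ Real.Gamma s * (4 + s * (s + 1))) (fun s hs ↦ by
      have h0 : ∀ m : ℕ, s ≠ -m := fun m h ↦ by
        have : (0 : ℝ) ≤ m := Nat.cast_nonneg m
        linarith [hs.1]
      exact ((Real.differentiableAt_Gamma h0).continuousAt.mul (by fun_prop)).continuousWithinAt)
  -- The `4` pays for the smooth cut-off, `|B|` bounds the Gamma factor uniformly on `[k, S]`, and
  -- the power of `δ` replaces the exponent `s` by `k` in the pair sum.
  refine ⟨4 * (|B| * (δ ^ (-(S - k)) * P)), by positivity, fun w hw hwi s hs ↦ ?_⟩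
  have hs0 : 0 < s := by linarith [hs.1]
  have hΓ : 0 < Real.Gamma s * (4 + s * (s + 1)) :=
    mul_pos (Real.Gamma_pos_of_pos hs0) (by positivity)
  have hBs : Real.Gamma s * (4 + s * (s + 1)) ≤ |B| :=
    (le_abs_self _).trans ((hB s hs).trans (le_abs_self _))
  let κ : {p : ℤ × ℤ // p ≠ 0} × {p : ℤ × ℤ // p ≠ 0} → ℂ :=
    fun p ↦ π * (w * form a b c p.1 + conj w * form a b c p.2)
  have κre : ∀ p, (κ p).re = π * (w.re * (form a b c p.1 + form a b c p.2)) := fun p ↦ by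
    simp only [κ, re_ofReal_mul, add_re, re_mul_ofReal, conj_re]; ring
  have κim : ∀ p, (κ p).im = π * (w.im * (form a b c p.1 - form a b c p.2)) := fun p ↦ by
    simp only [κ, im_ofReal_mul, add_im, im_mul_ofReal, conj_im]; ring
  have κpos : ∀ p, 0 < (κ p).re := fun p ↦ by
    rw [κre]; have := hpos p.1; have := hpos p.2; positivity
  have κre_ge : ∀ p, w.re * (form a b c p.1 + form a b c p.2) ≤ (κ p).re := fun p ↦ by
    rw [κre]; have := hpos p.1; have := hpos p.2
    exact le_mul_of_one_le_left (by positivity) (by linarith [pi_gt_three])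
  let F : {p : ℤ × ℤ // p ≠ 0} × {p : ℤ × ℤ // p ≠ 0} → ℝ → ℂ :=
    fun p x ↦ (weight s x : ℂ) * cexp (-(κ p * x))
  have hFint : ∀ p, IntegrableOn (F p) (Ioi 0) := fun p ↦ integrableOn_weight_mul_exp hs0 (κpos p)
  -- Taking norms replaces `κ` by its real part. The resulting bound depends badly on `w`, but
  -- convergence alone permits termwise integration.
  have hFnorm : Summable fun p ↦ ∫ x in Ioi (0 : ℝ), ‖F p x‖ := by
    refine (((summable_form_add_rpow ha hD (k := s + 2) (by linarith)).mul_left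
      (w.re ^ (-(s + 2)))).mul_left (Real.Gamma s * (4 + s * (s + 1)))).of_nonneg_of_le
      (fun p ↦ integral_nonneg fun _ ↦ norm_nonneg _) fun p ↦ ?_
    have h1 := hpos p.1
    have h2 := hpos p.2
    have e : ((∫ x in Ioi (0 : ℝ), ‖F p x‖ : ℝ) : ℂ) =
        ∫ x : ℝ in Ioi 0, (weight s x : ℂ) * cexp (-(((κ p).re : ℂ) * x)) := by
      rw [← integral_complex_ofReal]
      refine setIntegral_congr_fun measurableSet_Ioi fun x hx ↦ ?_
      simp only [F, norm_mul, norm_real, Real.norm_of_nonneg (weight_nonneg hx), Complex.norm_exp]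
      rw [ofReal_mul, ofReal_exp, neg_re, re_mul_ofReal]
      push_cast
      rfl
    have hb := norm_integral_weight_mul_exp_le hs0 (κ := ((κ p).re : ℂ)) (by simpa using κpos p)
    rw [← e, norm_real, Real.norm_of_nonneg (integral_nonneg fun _ ↦ norm_nonneg _), norm_real,
      Real.norm_of_nonneg (κpos p).le] at hb
    refine hb.trans (mul_le_mul_of_nonneg_left ?_ hΓ.le)
    rw [← Real.mul_rpow hw.le (by positivity)]
    calc (κ p).re ^ (-s) / (1 + (κ p).re ^ 2) ≤ (κ p).re ^ (-s) / (κ p).re ^ 2 := by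
          have := κpos p
          gcongr
          linarith
      _ = (κ p).re ^ (-(s + 2)) := by
          rw [← Real.rpow_natCast, ← Real.rpow_sub (κpos p)]; congr 1; push_cast; ring
      _ ≤ _ := Real.rpow_le_rpow_of_nonpos (by positivity) (κre_ge p) (by linarith)
  have hHas := hasSum_integral_of_summable_integral_norm hFint hFnorm
  let g : ℝ → ℝ := fun x ↦ weight s x * ‖thetaTail a b c (w * x)‖ ^ 2
  have hg : ∀ x ∈ Ioi (0 : ℝ), HasSum (fun p ↦ F p x) (g x : ℂ) := fun x hx ↦
    hasSum_weight_mul_norm_sq ha hD hw hx s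
  have hgnn : ∀ x ∈ Ioi (0 : ℝ), 0 ≤ g x := fun x hx ↦
    mul_nonneg (weight_nonneg hx) (by positivity)
  have hgint : IntegrableOn g (Ioi 0) := by
    refine ⟨ContinuousOn.aestronglyMeasurable (ContinuousOn.mul (fun x hx ↦ ?_)
      ((continuousOn_thetaTail_ray ha hD hw).norm.pow 2)) measurableSet_Ioi, ?_⟩
    · exact ((Real.continuousAt_rpow_const _ _ (Or.inl (ne_of_gt hx))).mul
        (by fun_prop)).continuousWithinAt
    · calc ∫⁻ x in Ioi (0 : ℝ), ‖g x‖ₑ ≤ ∫⁻ x in Ioi (0 : ℝ), ∑' p, ‖F p x‖ₑ := by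
            refine setLIntegral_mono' measurableSet_Ioi fun x hx ↦ ?_
            have : ‖g x‖ₑ = ‖∑' p, F p x‖ₑ := by
              rw [(hg x hx).tsum_eq, ← ofReal_norm, ← ofReal_norm, norm_real]
            rw [this]
            exact enorm_tsum_le_tsum_enorm
        _ = ∑' p, ∫⁻ x in Ioi (0 : ℝ), ‖F p x‖ₑ :=
            lintegral_tsum fun p ↦ (hFint p).aestronglyMeasurable.enorm
        _ = ∑' p, ENNReal.ofReal (∫ x in Ioi (0 : ℝ), ‖F p x‖) :=
            tsum_congr fun p ↦ (ofReal_integral_norm_eq_lintegral_enorm (hFint p)).symm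
        _ < ⊤ := hFnorm.tsum_ofReal_lt_top
  have hgle : ∫ x in Ioi (0 : ℝ), g x ≤ |B| * (w.re ^ (-s) * (δ ^ (-(S - k)) * P)) := by
    have e : ((∫ x in Ioi (0 : ℝ), g x : ℝ) : ℂ) = ∫ x in Ioi (0 : ℝ), ∑' p, F p x := by
      rw [← integral_complex_ofReal]
      exact setIntegral_congr_fun measurableSet_Ioi fun x hx ↦ (hg x hx).tsum_eq.symm
    rw [← e] at hHas
    rw [← Real.norm_of_nonneg (setIntegral_nonneg measurableSet_Ioi hgnn), ← norm_real,
      ← hHas.tsum_eq]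
    refine tsum_of_norm_bounded (((hsum.hasSum.mul_left (δ ^ (-(S - k)))).mul_left
      (w.re ^ (-s))).mul_left |B|) fun p ↦ ?_
    have h1 := hpos p.1
    have h2 := hpos p.2
    have hQ : δ ≤ form a b c p.1 + form a b c p.2 := by linarith [hδf p.1 p.1.2]
    refine (norm_integral_weight_mul_exp_le hs0 (κpos p)).trans ?_
    have n1 : (κ p).re ≤ ‖κ p‖ := (le_abs_self _).trans (abs_re_le_norm _)
    -- The imaginary part of `κ` detects the difference of the form values; this is where the ray
    -- must stay away from the real axis.
    have n2 : (form a b c p.1 - form a b c p.2) ^ 2 ≤ ‖κ p‖ ^ 2 := by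
      have := abs_im_le_norm (κ p)
      rw [κim, abs_mul, abs_mul, abs_of_pos pi_pos] at this
      rw [← sq_abs]
      refine pow_le_pow_left₀ (abs_nonneg _) (le_trans ?_ this) 2
      have : 1 ≤ π * |w.im| := by nlinarith [pi_gt_three]
      rw [← mul_assoc]
      exact le_mul_of_one_le_left (abs_nonneg _) this
    have n3 : ‖κ p‖ ^ (-s) ≤ w.re ^ (-s) * (δ ^ (-(S - k)) * (form a b c p.1 + form a b c p.2) ^ (-k)) := by
      calc ‖κ p‖ ^ (-s) ≤ (w.re * (form a b c p.1 + form a b c p.2)) ^ (-s) :=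
            Real.rpow_le_rpow_of_nonpos (by positivity) ((κre_ge p).trans n1) (by linarith)
        _ = w.re ^ (-s) * ((form a b c p.1 + form a b c p.2) ^ (-(s - k)) *
              (form a b c p.1 + form a b c p.2) ^ (-k)) := by
            rw [Real.mul_rpow hw.le (by positivity), ← Real.rpow_add (by positivity)]
            congr 2; ring
        _ ≤ _ := by
            gcongr
            calc _ ≤ δ ^ (-(s - k)) :=
                  Real.rpow_le_rpow_of_nonpos hδ hQ (by linarith [hs.1])
              _ ≤ _ := Real.rpow_le_rpow_of_exponent_ge hδ hδ1 (by linarith [hs.2])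
    calc _ ≤ |B| * (w.re ^ (-s) * (δ ^ (-(S - k)) * (form a b c p.1 + form a b c p.2) ^ (-k)) /
          (1 + (form a b c p.1 - form a b c p.2) ^ 2)) := by gcongr
      _ = _ := by ring
  -- For `x > 1` the factor `(1 - exp (-x))²` is at least `1 / 4`, so the smooth weight dominates
  -- the sharp cut-off at `1`.
  have hw1 : ∀ x ∈ Ioi (1 : ℝ), x ^ (s - 1) ≤ 4 * weight s x := fun x hx ↦ by
    have hx : 1 < x := hx
    have h2 : rexp (-x) ≤ 1 / 2 := by
      rw [Real.exp_neg, one_div]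
      exact inv_anti₀ (by norm_num) (by linarith [Real.add_one_le_exp x])
    have : 1 ≤ 4 * (1 - rexp (-x)) ^ 2 := by nlinarith
    rw [weight, mul_left_comm]
    exact le_mul_of_one_le_right (by positivity) this
  calc _ ≤ ∫⁻ x in Ioi (1 : ℝ), ENNReal.ofReal (4 * g x) := by
        refine setLIntegral_mono' measurableSet_Ioi fun x hx ↦ ?_
        rw [← ofReal_norm, ← ENNReal.ofReal_pow (norm_nonneg _), ← ENNReal.ofReal_mul (by positivity)]
        refine ENNReal.ofReal_le_ofReal ?_
        simp only [g]
        rw [mul_comm, ← mul_assoc]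
        gcongr
        exact hw1 x hx
    _ ≤ ∫⁻ x in Ioi (0 : ℝ), ENNReal.ofReal (4 * g x) :=
        lintegral_mono_set (Ioi_subset_Ioi zero_le_one)
    _ = ENNReal.ofReal (∫ x in Ioi (0 : ℝ), 4 * g x) := by
        refine (ofReal_integral_eq_lintegral_ofReal (hgint.const_mul 4) ?_).symm
        filter_upwards [ae_restrict_mem measurableSet_Ioi] with x hx
        exact mul_nonneg (by norm_num) (hgnn x hx)
    _ ≤ _ := by
        refine ENNReal.ofReal_le_ofReal ?_
        rw [integral_const_mul]
        calc _ ≤ 4 * (|B| * (w.re ^ (-s) * (δ ^ (-(S - k)) * P))) := by gcongr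
          _ = _ := by ring

/-! ### Theta inversion on rays and the rotated completed zeta-function. -/

theorem thetaTail_inv {a b c : ℝ} (ha : 0 < a) (hD : 4 * a * c - b ^ 2 = 4) {w : ℂ}
    (hw : 0 < w.re) : thetaTail a b c w⁻¹ + 1 = w * (thetaTail a b c w + 1) := by
  have hD' : 0 < 4 * a * c - b ^ 2 := by rw [hD]; norm_num
  have hd := differentiableOn_thetaTail ha hD'
  have hne : ∀ v : ℂ, 0 < v.re → v ≠ 0 := fun v hv h ↦ by simp [h] at hv
  have hinv : ∀ v : ℂ, 0 < v.re → 0 < (v⁻¹).re := fun v hv ↦ by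
    rw [inv_re]; exact div_pos hv (normSq_pos.mpr (hne v hv))
  refine eqOn_re_pos_of_eq_on_pos (f := fun w ↦ thetaTail a b c w⁻¹ + 1)
    (g := fun w ↦ w * (thetaTail a b c w + 1)) ?_ ?_ (fun t ht ↦ ?_) hw
  · exact (hd.comp (fun v hv ↦ (differentiableAt_inv (hne v hv)).differentiableWithinAt)
      hinv).add_const 1
  · exact differentiableOn_id.mul (hd.add_const 1)
  · rw [← ofReal_inv, thetaTail_ofReal ha hD' ht, thetaTail_ofReal ha hD' (inv_pos.mpr ht),
      ← one_div, theta_inv ha hD ht]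
    push_cast
    ring

theorem norm_thetaTail_le {a b c : ℝ} (ha : 0 < a) (hD : 0 < 4 * a * c - b ^ 2) {w : ℂ}
    (hw : 0 < w.re) : ‖thetaTail a b c w‖ ≤ theta a b c w.re - 1 := by
  refine tsum_of_norm_bounded (hasSum_theta_sub_one ha hD hw) fun p ↦ ?_
  rw [norm_thetaTail_term]

theorem thetaTail_ray_isBigO {a b c : ℝ} (ha : 0 < a) (hD : 0 < 4 * a * c - b ^ 2) {w : ℂ}
    (hw : 0 < w.re) (r : ℝ) : (fun t : ℝ ↦ thetaTail a b c (w * t)) =O[atTop] (· ^ r) := by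
  have h1 : Tendsto (fun t : ℝ ↦ w.re * t) atTop atTop := tendsto_id.const_mul_atTop hw
  have h2 := (theta_sub_one_isBigO ha hD r).comp_tendsto h1
  refine (IsBigO.of_bound 1 ?_).trans (h2.trans (IsBigO.of_bound (w.re ^ r) ?_))
  · filter_upwards [eventually_gt_atTop 0] with t ht
    have hp : 0 < (w * t).re := by rw [re_mul_ofReal]; positivity
    have := norm_thetaTail_le ha hD hp
    rw [re_mul_ofReal] at this
    rw [one_mul]
    exact this.trans (le_abs_self _)
  · filter_upwards [eventually_gt_atTop 0] with t ht
    simp only [Function.comp_apply]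
    rw [Real.mul_rpow hw.le ht.le, norm_mul, Real.norm_of_nonneg (by positivity : 0 ≤ w.re ^ r)]

open ComplexConjugate in
/-- The Mellin pair of the theta series along the ray through a point `z` of the unit circle. -/
noncomputable def rayPair {a b c : ℝ} (ha : 0 < a) (hD : 4 * a * c - b ^ 2 = 4) {z : ℂ}
    (hz : 0 < z.re) (hz1 : ‖z‖ = 1) : WeakFEPair ℂ where
  f t := thetaTail a b c (z * t) + 1
  g t := thetaTail a b c (conj z * t) + 1
  k := 1
  ε := conj z
  f₀ := 1
  g₀ := 1
  hf_int := ((continuousOn_thetaTail_ray ha (by rw [hD]; norm_num) hz).add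
    continuousOn_const).locallyIntegrableOn measurableSet_Ioi
  hg_int := ((continuousOn_thetaTail_ray ha (by rw [hD]; norm_num) (by rwa [conj_re])).add
    continuousOn_const).locallyIntegrableOn measurableSet_Ioi
  hk := one_pos
  hε := by
    rw [Ne, map_eq_zero]
    rintro rfl
    simp at hz
  h_feq t ht := by
    have ht : 0 < t := ht
    have hzc : 0 < (conj z * t).re := by rw [re_mul_ofReal, conj_re]; positivity
    have e : (z * ((1 / t : ℝ) : ℂ)) = (conj z * t)⁻¹ := by
      rw [mul_inv, Complex.inv_def (conj z), normSq_conj, normSq_eq_norm_sq, hz1]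
      push_cast
      simp
    rw [e, thetaTail_inv ha hD hzc, smul_eq_mul, Real.rpow_one]
  hf_top r := by
    simpa using thetaTail_ray_isBigO ha (by rw [hD]; norm_num) hz r
  hg_top r := by
    simpa using thetaTail_ray_isBigO ha (by rw [hD]; norm_num) (w := conj z) (by rwa [conj_re]) r

theorem ofReal_mul_cpow {x : ℝ} (hx : 0 < x) {z : ℂ} (hz : z ≠ 0) (s : ℂ) :
    ((x : ℂ) * z) ^ s = (x : ℂ) ^ s * z ^ s := by
  have hx' : (x : ℂ) ≠ 0 := ofReal_ne_zero.mpr hx.ne'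
  rw [cpow_def_of_ne_zero (mul_ne_zero hx' hz), cpow_def_of_ne_zero hx', cpow_def_of_ne_zero hz,
    Complex.log_ofReal_mul hx hz, ← Complex.exp_add, ofReal_log hx.le]
  ring_nf

theorem hasSum_mellin_thetaTail {a b c : ℝ} (ha : 0 < a) (hD : 0 < 4 * a * c - b ^ 2) {z : ℂ}
    (hz : 0 < z.re) {s : ℂ} (hs : 1 < s.re) :
    HasSum (fun p : {p : ℤ × ℤ // p ≠ 0} ↦
      z ^ (-s) * (π : ℂ) ^ (-s) * Complex.Gamma s * (form a b c p : ℂ) ^ (-s))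
      (mellin (fun t : ℝ ↦ thetaTail a b c (z * t)) s) := by
  have hz0 : z ≠ 0 := fun h ↦ by simp [h] at hz
  have hs0 : 0 < s.re := by linarith
  have hr : ∀ p : {p : ℤ × ℤ // p ≠ 0}, 0 < ((π * form a b c p : ℝ) * z : ℂ).re := fun p ↦ by
    have := form_pos ha hD p.2
    rw [re_ofReal_mul]
    positivity
  let F : {p : ℤ × ℤ // p ≠ 0} → ℝ → ℂ :=
    fun p t ↦ (t : ℂ) ^ (s - 1) * cexp (-(((π * form a b c p : ℝ) * z : ℂ) * t))
  have h := hasSum_integral_of_summable_integral_norm (μ := volume.restrict (Ioi 0)) (F := F)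
    (fun p ↦ integrableOn_cpow_mul_exp hs0 (hr p)) ?_
  · have e1 : ∀ p, ∫ t in Ioi (0 : ℝ), F p t =
        z ^ (-s) * (π : ℂ) ^ (-s) * Complex.Gamma s * (form a b c p : ℂ) ^ (-s) := fun p ↦ by
      have := form_pos ha hD p.2
      simp only [F]
      rw [integral_cpow_mul_exp hs0 (hr p), ofReal_mul_cpow (by positivity) hz0, ofReal_mul,
        mul_cpow_ofReal_nonneg pi_pos.le this.le]
      ring
    have e2 : ∫ t in Ioi (0 : ℝ), ∑' p, F p t = mellin (fun t : ℝ ↦ thetaTail a b c (z * t)) s := by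
      refine setIntegral_congr_fun measurableSet_Ioi fun t ht ↦ ?_
      simp only [F, smul_eq_mul, thetaTail]
      rw [tsum_mul_left]
      congr 1
      refine tsum_congr fun p ↦ ?_
      push_cast
      ring_nf
    rw [← e2]
    simpa only [e1] using h
  · have hsum := ((summable_zeta ha hD hs).mul_left ((π * z.re) ^ (-s.re))).mul_left
      (Real.Gamma s.re)
    refine hsum.congr fun p ↦ ?_
    have hp := form_pos ha hD p.2
    have hr' := hr p
    rw [re_ofReal_mul] at hr'
    have e : ∫ t in Ioi (0 : ℝ), ‖F p t‖ =
        ∫ t in Ioi (0 : ℝ), t ^ (s.re - 1) * rexp (-((π * form a b c p * z.re) * t)) := by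
      refine setIntegral_congr_fun measurableSet_Ioi fun t ht ↦ ?_
      simp only [F]
      rw [norm_cpow_mul_exp ht, re_ofReal_mul, neg_mul]
    rw [e, Real.integral_rpow_mul_exp_neg_mul_Ioi hs0 hr', one_div (π * form a b c p * z.re),
      Real.inv_rpow hr'.le,
      show π * form a b c p * z.re = (π * z.re) * form a b c p by ring,
      Real.mul_rpow (by positivity) hp.le, Real.rpow_neg (by positivity)]
    field_simp

theorem rayPair_Λ_of_one_lt_re {a b c : ℝ} (ha : 0 < a) (hD : 4 * a * c - b ^ 2 = 4) {z : ℂ}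
    (hz : 0 < z.re) (hz1 : ‖z‖ = 1) {Z : ℂ → ℂ} (hZ : IsContinuation a b c Z) {s : ℂ}
    (hs : 1 < s.re) :
    (rayPair ha hD hz hz1).Λ s = z ^ (-s) * (π : ℂ) ^ (-s) * Complex.Gamma s * Z s := by
  have hD' : 0 < 4 * a * c - b ^ 2 := by rw [hD]; norm_num
  rw [← ((rayPair ha hD hz hz1).hasMellin (s := s) hs).2]
  have h1 := hasSum_mellin_thetaTail ha hD' hz hs
  have h2 := (hZ.2 s hs).mul_left (z ^ (-s) * (π : ℂ) ^ (-s) * Complex.Gamma s)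
  rw [← h1.unique h2]
  congr 1
  ext t
  simp [rayPair]

-- The entire part differs from the completed function by the polar terms `1 / s` and `conj z / (1 -
-- s)`. Dividing by `Γ` removes the pole at `0`, as `s Γ(s) = Γ(s + 1)`; writing the formula this
-- way leaves `1` as the only excluded point.
open ComplexConjugate in
theorem isContinuation_rayPair {a b c : ℝ} (ha : 0 < a) (hD : 4 * a * c - b ^ 2 = 4) {z : ℂ}
    (hz : 0 < z.re) (hz1 : ‖z‖ = 1) :
    IsContinuation a b c fun s ↦ z ^ s * (π : ℂ) ^ s * ((rayPair ha hD hz hz1).Λ₀ s *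
      (Complex.Gamma s)⁻¹ - (Complex.Gamma (s + 1))⁻¹ - conj z / (1 - s) * (Complex.Gamma s)⁻¹) := by
  have hpi : (π : ℂ) ≠ 0 := ofReal_ne_zero.mpr pi_ne_zero
  have hz0 : z ≠ 0 := fun h ↦ by simp [h] at hz
  constructor
  · intro s hs
    have h1 : (1 : ℂ) - s ≠ 0 := sub_ne_zero.mpr (Ne.symm hs)
    have h2 := differentiable_one_div_Gamma s
    have h3 : DifferentiableAt ℂ (fun s : ℂ ↦ (Complex.Gamma (s + 1))⁻¹) s :=
      (differentiable_one_div_Gamma (s + 1)).comp s (f := fun s : ℂ ↦ s + 1) (by fun_prop)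
    have h4 := (rayPair ha hD hz hz1).differentiable_Λ₀ s
    have h5 : DifferentiableAt ℂ (fun s : ℂ ↦ conj z / (1 - s)) s := by
      fun_prop (disch := exact h1)
    have h6 : DifferentiableAt ℂ (fun s : ℂ ↦ (π : ℂ) ^ s) s :=
      differentiableAt_id.const_cpow (Or.inl hpi)
    have h7 : DifferentiableAt ℂ (fun s : ℂ ↦ z ^ s) s :=
      differentiableAt_id.const_cpow (Or.inl hz0)
    exact ((h7.mul h6).mul (((h4.mul h2).sub h3).sub (h5.mul h2))).differentiableWithinAt
  · intro s hs
    have hs0 : s ≠ 0 := by rintro rfl; simp at hs; linarith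
    have hG : Complex.Gamma s ≠ 0 := Gamma_ne_zero_of_re_pos (by linarith)
    obtain ⟨Z, hZ⟩ := exists_continuation ha (b := b) (c := c) (by rw [hD]; norm_num)
    have hpw : (π : ℂ) ^ s ≠ 0 := by simp [Complex.cpow_eq_zero_iff, hpi]
    have hzw : z ^ s ≠ 0 := by simp [Complex.cpow_eq_zero_iff, hz0]
    convert! hZ.2 s hs using 1
    beta_reduce
    rw [(rayPair ha hD hz hz1).Λ₀_eq, rayPair_Λ_of_one_lt_re ha hD hz hz1 hZ hs,
      Complex.Gamma_add_one s hs0, cpow_neg, cpow_neg]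
    simp only [rayPair, smul_eq_mul, mul_one, ofReal_one]
    field_simp
    ring

/-- The completed zeta-function, rotated by `z`, is a nonvanishing multiple of `ζ_Q`. -/
theorem rayPair_Λ_eq {a b c : ℝ} (ha : 0 < a) (hD : 4 * a * c - b ^ 2 = 4) {z : ℂ}
    (hz : 0 < z.re) (hz1 : ‖z‖ = 1) {Z : ℂ → ℂ} (hZ : IsContinuation a b c Z) {s : ℂ}
    (hs : 0 < s.re) (hs1 : s ≠ 1) :
    (rayPair ha hD hz hz1).Λ s = z ^ (-s) * (π : ℂ) ^ (-s) * Complex.Gamma s * Z s := by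
  have hpi : (π : ℂ) ≠ 0 := ofReal_ne_zero.mpr pi_ne_zero
  have hz0 : z ≠ 0 := fun h ↦ by simp [h] at hz
  have hs0 : s ≠ 0 := by rintro rfl; simp at hs
  have hG : Complex.Gamma s ≠ 0 := Gamma_ne_zero_of_re_pos hs
  have hpw : (π : ℂ) ^ s ≠ 0 := by simp [Complex.cpow_eq_zero_iff, hpi]
  have hzw : z ^ s ≠ 0 := by simp [Complex.cpow_eq_zero_iff, hz0]
  have h1s : (1 : ℂ) - s ≠ 0 := sub_ne_zero.mpr (Ne.symm hs1)
  rw [hZ.eqOn (isContinuation_rayPair ha hD hz hz1) hs1]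
  beta_reduce
  rw [(rayPair ha hD hz hz1).Λ₀_eq,
    Complex.Gamma_add_one s hs0, cpow_neg, cpow_neg]
  simp only [rayPair, smul_eq_mul, mul_one, ofReal_one]
  field_simp
  ring

theorem lintegral_Ioo_eq_lintegral_inv (F : ℝ → ENNReal) :
    ∫⁻ x in Ioo (0 : ℝ) 1, F x = ∫⁻ u in Ioi (1 : ℝ), ENNReal.ofReal ((u ^ 2)⁻¹) * F (1 / u) := by
  have himg : Ioo (0 : ℝ) 1 = (fun u : ℝ ↦ 1 / u) '' Ioi 1 := by
    ext x
    simp only [mem_Ioo, mem_image, mem_Ioi]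
    constructor
    · rintro ⟨h0, h1⟩
      exact ⟨1 / x, (one_lt_div h0).mpr h1, by simp⟩
    · rintro ⟨u, hu, rfl⟩
      exact ⟨by positivity, (div_lt_one (by positivity)).mpr hu⟩
  rw [himg, lintegral_image_eq_lintegral_abs_deriv_mul (f' := fun u ↦ -(u ^ 2)⁻¹) measurableSet_Ioi
    (fun u hu ↦ by
      have hu : 1 < u := hu
      simpa using (hasDerivAt_inv (by positivity : u ≠ 0)).hasDerivWithinAt)
    (fun x _ y _ h ↦ by simpa using h)]
  refine lintegral_congr fun u ↦ ?_
  rw [abs_neg, abs_of_nonneg (by positivity)]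

/-- The functional equation carries the part on `(0, 1)` to `(1, ∞)` on the conjugate ray, where the
tail has the same norm. The Jacobian cancels the squared factor `x`, leaving the weight `x ^ (-(2σ -
1))`, which is at most `x ^ (2σ - 1)` for `σ ≥ 1 / 2`. -/
theorem lintegral_f_modif_sq_le {a b c : ℝ} (ha : 0 < a) (hD : 4 * a * c - b ^ 2 = 4) {z : ℂ}
    (hz : 0 < z.re) (hz1 : ‖z‖ = 1) {σ : ℝ} (hσ : 1 / 2 ≤ σ) :
    ∫⁻ x in Ioi (0 : ℝ), ‖(rayPair ha hD hz hz1).f_modif x‖ₑ ^ 2 * ENNReal.ofReal (x ^ (2 * σ - 1)) ≤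
      2 * ∫⁻ x in Ioi (1 : ℝ), ‖thetaTail a b c (z * x)‖ₑ ^ 2 * ENNReal.ofReal (x ^ (2 * σ - 1)) := by
  set P := rayPair ha hD hz hz1 with hP
  have hf : ∀ x ∈ Ioi (1 : ℝ), P.f_modif x = thetaTail a b c (z * x) := fun x hx ↦ by
    have h2 : x ∉ Ioo (0 : ℝ) 1 := fun h ↦ absurd h.2 (not_lt.mpr (le_of_lt hx))
    simp [WeakFEPair.f_modif, indicator_of_mem hx, indicator_of_notMem h2, hP, rayPair]
  have hg : ∀ x ∈ Ioi (1 : ℝ), ‖P.f_modif (1 / x)‖ = x * ‖thetaTail a b c (z * x)‖ := fun x hx ↦ by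
    have hx' : 1 < x := hx
    have h2 : x ∉ Ioo (0 : ℝ) 1 := fun h ↦ absurd h.2 (not_lt.mpr hx'.le)
    rw [P.hf_modif_FE x (by linarith)]
    have e : P.g_modif x = starRingEnd ℂ (thetaTail a b c (z * x)) := by
      rw [← thetaTail_conj]
      simp [WeakFEPair.g_modif, indicator_of_mem hx, indicator_of_notMem h2, hP, rayPair]
    rw [e, norm_smul, RCLike.norm_conj]
    simp [hP, rayPair, hz1, abs_of_pos (zero_lt_one.trans hx')]
  have hsplit : Ioi (0 : ℝ) = Ioo 0 1 ∪ ({1} ∪ Ioi 1) := by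
    ext x
    simp only [mem_Ioi, mem_union, mem_Ioo, mem_singleton_iff]
    constructor
    · intro h
      rcases lt_trichotomy x 1 with h1 | h1 | h1
      · exact Or.inl ⟨h, h1⟩
      · exact Or.inr (Or.inl h1)
      · exact Or.inr (Or.inr h1)
    · rintro (h | h | h) <;> linarith
  calc _ ≤ (∫⁻ x in Ioo (0 : ℝ) 1, ‖P.f_modif x‖ₑ ^ 2 * ENNReal.ofReal (x ^ (2 * σ - 1))) +
        ((∫⁻ x in ({1} : Set ℝ), ‖P.f_modif x‖ₑ ^ 2 * ENNReal.ofReal (x ^ (2 * σ - 1))) +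
        ∫⁻ x in Ioi (1 : ℝ), ‖P.f_modif x‖ₑ ^ 2 * ENNReal.ofReal (x ^ (2 * σ - 1))) := by
        rw [hsplit]
        refine (lintegral_union_le _ _ _).trans ?_
        gcongr
        exact lintegral_union_le _ _ _
    _ ≤ _ := by
        rw [show (∫⁻ x in ({1} : Set ℝ), ‖P.f_modif x‖ₑ ^ 2 * ENNReal.ofReal (x ^ (2 * σ - 1))) = 0 by
          simp, zero_add, two_mul (lintegral _ _), lintegral_Ioo_eq_lintegral_inv]
        refine add_le_add ?_ ?_
        · refine setLIntegral_mono' measurableSet_Ioi fun x hx ↦ ?_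
          have hx' : 1 < x := hx
          have hx0 : 0 < x := by linarith
          rw [← ofReal_norm, hg x hx, ← ofReal_norm, ← ENNReal.ofReal_pow (by positivity),
            ← ENNReal.ofReal_pow (by positivity), ← ENNReal.ofReal_mul (by positivity),
            ← ENNReal.ofReal_mul (by positivity), ← ENNReal.ofReal_mul (by positivity)]
          refine ENNReal.ofReal_le_ofReal ?_
          rw [mul_pow, one_div, Real.inv_rpow hx0.le, ← Real.rpow_neg hx0.le,
            ← mul_assoc, ← mul_assoc, inv_mul_cancel₀ (by positivity), one_mul]
          gcongr
          · exact hx'.le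
          · linarith
        · refine (setLIntegral_congr_fun measurableSet_Ioi fun x hx ↦ ?_).le
          rw [hf x hx]

/-- Mean square of the entire part of the rotated zeta-function on vertical lines. -/
theorem rayPair_Λ₀_mean_square {a b c : ℝ} (ha : 0 < a) (hD : 4 * a * c - b ^ 2 = 4) {σ₀ σ₁ : ℝ}
    (hσ₀ : 2 / 3 < σ₀) : ∃ C : ℝ, 0 ≤ C ∧ ∀ (z : ℂ) (hz : 0 < z.re) (hz1 : ‖z‖ = 1),
      1 / 2 ≤ |z.im| → ∀ σ ∈ Icc σ₀ σ₁, ∀ L : ℝ, 0 < L →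
        ∫⁻ t in Icc (-L) L, ‖(rayPair ha hD hz hz1).Λ₀ (σ + t * I)‖ₑ ^ 2 ≤
          ENNReal.ofReal (C * z.re ^ (-(2 * σ))) := by
  have hD' : 0 < 4 * a * c - b ^ 2 := by rw [hD]; norm_num
  obtain ⟨C, hC, h⟩ := thetaTail_mean_square ha hD' (k := 2 * σ₀) (S := 2 * σ₁) (by linarith)
  refine ⟨4 * π * rexp π * (2 * C), by positivity, fun z hz hz1 hzi σ hσ L hL ↦ ?_⟩
  have hconv : MellinConvergent (rayPair ha hD hz hz1).f_modif σ :=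
    ((rayPair ha hD hz hz1).isStrongFEPair_toStrongFEPair.hasMellin σ).1
  refine (lintegral_mellin_sq_le hconv hL).trans ?_
  rw [mul_assoc (4 * π * rexp π), mul_assoc 2, ENNReal.ofReal_mul (p := 4 * π * rexp π) (by positivity),
    ENNReal.ofReal_mul (p := 2) (by positivity), ENNReal.ofReal_ofNat]
  gcongr
  refine (lintegral_f_modif_sq_le ha hD hz hz1 (by linarith [hσ.1])).trans ?_
  gcongr
  exact h z hz hzi (2 * σ) ⟨by linarith [hσ.1], by linarith [hσ.2]⟩

/-! ### Jensen's formula and counting zeros by a mean square. -/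

-- In Jensen's formula every zero of the disc contributes nonnegatively, so all zeros outside `Z`
-- may be discarded.
open MeromorphicOn in
theorem sum_order_mul_log_le {K : ℂ → ℂ} {c : ℂ} {R : ℝ} (hR : 0 < R)
    (hK : AnalyticOnNhd ℂ K (Metric.closedBall c R)) (h0 : K c ≠ 0) {κ : ℝ}
    (Z : Finset ℂ) (hZ : ∀ ρ ∈ Z, ρ ≠ c ∧ ‖c - ρ‖ ≤ R ∧ κ ≤ Real.log (R * ‖c - ρ‖⁻¹)) :
    κ * ∑ ρ ∈ Z, (analyticOrderNatAt K ρ : ℝ) ≤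
      circleAverage (fun z ↦ Real.log ‖K z‖) c R - Real.log ‖K c‖ := by
  have hRabs : |R| = R := abs_of_pos hR
  have hJ := AnalyticOnNhd.circleAverage_log_norm hR.ne' (hRabs.symm ▸ hK) h0
  rw [hRabs] at hJ
  rw [hJ, add_sub_cancel_right]
  set D := MeromorphicOn.divisor K (Metric.closedBall c R) with hD
  have hDnn : ∀ u, 0 ≤ D u := fun u ↦ hK.divisor_nonneg u
  have hfin := D.finiteSupport (isCompact_closedBall c R)
  have hterm : ∀ u, 0 ≤ (D u : ℝ) * Real.log (R * ‖c - u‖⁻¹) := fun u ↦ by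
    by_cases hu : u ∈ Metric.closedBall c R
    · refine mul_nonneg (by exact_mod_cast hDnn u) ?_
      rcases eq_or_ne u c with rfl | hne
      · simp
      · have hp : 0 < ‖c - u‖ := norm_pos_iff.mpr (sub_ne_zero.mpr hne.symm)
        refine Real.log_nonneg ?_
        rw [← div_eq_mul_inv, one_le_div hp, norm_sub_rev]
        exact mem_closedBall_iff_norm.mp hu
    · rw [D.apply_eq_zero_of_notMem hu]
      simp
  have hsub : (Function.support fun u ↦ (D u : ℝ) * Real.log (R * ‖c - u‖⁻¹)) ⊆
      (hfin.toFinset ∪ Z : Finset ℂ) := fun u hu ↦ by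
    rw [Finset.coe_union, Set.Finite.coe_toFinset]
    left
    intro h
    apply hu
    simp [h]
  rw [finsum_eq_sum_of_support_subset _ hsub, Finset.mul_sum]
  calc _ ≤ ∑ ρ ∈ Z, (D ρ : ℝ) * Real.log (R * ‖c - ρ‖⁻¹) := by
        refine Finset.sum_le_sum fun ρ hρ ↦ ?_
        obtain ⟨h1, h2, h3⟩ := hZ ρ hρ
        have hmem : ρ ∈ Metric.closedBall c R := by
          rw [mem_closedBall_iff_norm, norm_sub_rev]; exact h2
        have hcb : IsPreconnected (Metric.closedBall c R) :=
          (convex_closedBall c R).isPreconnected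
        have htop : analyticOrderAt K ρ ≠ ⊤ :=
          hK.analyticOrderAt_ne_top_of_isPreconnected hcb (Metric.mem_closedBall_self hR.le) hmem
            (by rw [(hK c (Metric.mem_closedBall_self hR.le)).analyticOrderAt_eq_zero.mpr h0]; simp)
        have hDρ : D ρ = (analyticOrderNatAt K ρ : ℤ) := by
          rw [hD, hK.divisor_apply hmem, ← Nat.cast_analyticOrderNatAt htop]
          simp
        rw [hDρ, mul_comm]
        push_cast
        gcongr
    _ ≤ _ := Finset.sum_le_sum_of_subset_of_nonneg Finset.subset_union_right
        fun u _ _ ↦ hterm u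

/-- From `log x ≤ x - 1 ≤ x² / 2`. This lossy step is harmless because `K` will be normalised to
have bounded mean square per unit height. -/
theorem circleAverage_log_norm_le {K : ℂ → ℂ} {c : ℂ} {R : ℝ} (hR : 0 < R)
    (hK : AnalyticOnNhd ℂ K (Metric.closedBall c R)) :
    circleAverage (fun z ↦ Real.log ‖K z‖) c R ≤ circleAverage (fun z ↦ ‖K z‖ ^ 2 / 2) c R := by
  have hs : Metric.sphere c |R| ⊆ Metric.closedBall c R := by
    rw [abs_of_pos hR]; exact Metric.sphere_subset_closedBall
  refine circleAverage_mono ?_ ?_ fun z hz ↦ ?_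
  · exact MeromorphicOn.circleIntegrable_log_norm (f := K) fun z hz ↦ (hK z (hs hz)).meromorphicAt
  · refine ContinuousOn.circleIntegrable' ?_
    exact ((hK.continuousOn.mono hs).norm.pow 2).div_const 2
  · rcases eq_or_ne (K z) 0 with h | h
    · simp [h]
    · have := Real.log_le_sub_one_of_pos (norm_pos_iff.mpr h)
      nlinarith [sq_nonneg (‖K z‖ - 1)]

/-- Jensen's formula averaged over a vertical segment of centres. -/
theorem sum_order_le_of_mean_square {K : ℂ → ℂ} {A σ₀ η t₁ t₂ M : ℝ} (hη : 0 < η)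
    (hA : σ₀ + 2 * η < A) (ht : t₁ + η ≤ t₂)
    (hK : AnalyticOnNhd ℂ K {s | σ₀ ≤ s.re ∧ t₁ - (A - σ₀) ≤ s.im ∧ s.im ≤ t₂ + (A - σ₀)})
    (h0 : ∀ t ∈ Icc t₁ t₂, K (A + t * I) ≠ 0)
    (hM : ∀ σ ∈ Icc σ₀ (2 * A - σ₀),
      ∫ t in (t₁ - (A - σ₀))..(t₂ + (A - σ₀)), ‖K (σ + t * I)‖ ^ 2 ≤ M)
    (Z : Finset ℂ) (hZ : ∀ ρ ∈ Z, σ₀ + 2 * η ≤ ρ.re ∧ ρ.re < A ∧ t₁ ≤ ρ.im ∧ ρ.im ≤ t₂) :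
    Real.log ((A - σ₀) / (A - σ₀ - η)) * η * ∑ ρ ∈ Z, (analyticOrderNatAt K ρ : ℝ) ≤
      M / 2 - ∫ t in t₁..t₂, Real.log ‖K (A + t * I)‖ := by
  set R := A - σ₀ with hRdef
  have hR : 0 < R := by rw [hRdef]; linarith
  have hRη : 0 < R - η := by rw [hRdef]; linarith
  set κ := Real.log (R / (R - η)) with hκdef
  have hκ : 0 ≤ κ := Real.log_nonneg (by rw [one_le_div hRη]; linarith)
  have ht12 : t₁ ≤ t₂ := by linarith
  have hball : ∀ t ∈ Icc t₁ t₂, Metric.closedBall (A + t * I : ℂ) R ⊆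
      {s | σ₀ ≤ s.re ∧ t₁ - R ≤ s.im ∧ s.im ≤ t₂ + R} := fun t ht s hs ↦ by
    rw [mem_closedBall_iff_norm] at hs
    have h1 := (abs_re_le_norm _).trans hs
    have h2 := (abs_im_le_norm _).trans hs
    simp only [sub_re, add_re, ofReal_re, mul_re, I_re, mul_zero, ofReal_im, I_im, mul_one,
      sub_self, add_zero, sub_im, add_im, mul_im, zero_add, abs_le] at h1 h2
    exact ⟨by linarith [h1.1], by linarith [h2.1, ht.1], by linarith [h2.2, ht.2]⟩
  -- the pointwise inequality
  let w : ℝ → ℝ := fun t ↦ ∑ ρ ∈ Z, (Icc (ρ.im - η) (ρ.im + η)).indicator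
    (fun _ ↦ (analyticOrderNatAt K ρ : ℝ)) t
  let G : ℝ → ℝ → ℝ := fun t θ ↦ ‖K (circleMap (A + t * I) R θ)‖ ^ 2 / 2
  have hpt : ∀ t ∈ Icc t₁ t₂, κ * w t ≤
      (2 * π)⁻¹ * (∫ θ in (0 : ℝ)..2 * π, G t θ) - Real.log ‖K (A + t * I)‖ := fun t ht ↦ by
    have hKt := hK.mono (hball t ht)
    have h1 := sum_order_mul_log_le (κ := κ) hR hKt (h0 t ht) (Z.filter fun ρ ↦ t ∈ Icc (ρ.im - η) (ρ.im + η))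
      fun ρ hρ ↦ by
        obtain ⟨hρZ, hρt⟩ := Finset.mem_filter.mp hρ
        obtain ⟨z1, z2, z3, z4⟩ := hZ ρ hρZ
        have hre : ((A + t * I : ℂ) - ρ).re = A - ρ.re := by simp
        have him : ((A + t * I : ℂ) - ρ).im = t - ρ.im := by simp
        have hne : ρ ≠ A + t * I := fun h ↦ by
          have := congrArg Complex.re h
          simp at this
          linarith
        -- One `η` of the margin `2η` absorbs the vertical offset of the centre; the other keeps the
        -- zero off the circle, which makes its Jensen weight at least `κ`.
        have hnorm : ‖(A + t * I : ℂ) - ρ‖ ≤ R - η := by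
          refine (norm_le_abs_re_add_abs_im _).trans ?_
          rw [hre, him, abs_of_pos (by linarith)]
          have : |t - ρ.im| ≤ η := abs_le.mpr ⟨by linarith [hρt.1], by linarith [hρt.2]⟩
          rw [hRdef]
          linarith
        have hpos : 0 < ‖(A + t * I : ℂ) - ρ‖ := norm_pos_iff.mpr (sub_ne_zero.mpr hne.symm)
        refine ⟨hne, by linarith, Real.log_le_log (by positivity) ?_⟩
        rw [← div_eq_mul_inv]
        exact div_le_div_of_nonneg_left hR.le hpos hnorm
    have h2 := circleAverage_log_norm_le hR hKt
    have h3 : circleAverage (fun z ↦ ‖K z‖ ^ 2 / 2) (A + t * I) R =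
        (2 * π)⁻¹ * (∫ θ in (0 : ℝ)..2 * π, G t θ) := rfl
    have h4 : w t = ∑ ρ ∈ Z.filter fun ρ ↦ t ∈ Icc (ρ.im - η) (ρ.im + η),
        (analyticOrderNatAt K ρ : ℝ) := by
      simp only [w, Finset.sum_filter, indicator]
    rw [h4]
    linarith
  -- integrability
  have hcm : Continuous fun p : ℝ × ℝ ↦ circleMap (A + p.1 * I) R p.2 := by
    unfold circleMap; fun_prop
  have hGc : ContinuousOn (Function.uncurry G) (Icc t₁ t₂ ×ˢ Icc 0 (2 * π)) := by
    refine ((hK.continuousOn.comp hcm.continuousOn fun p hp ↦ ?_).norm.pow 2).div_const 2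
    exact hball p.1 hp.1 (circleMap_mem_closedBall _ hR.le _)
  have hGint : Integrable (Function.uncurry G)
      ((volume.restrict (Ioc t₁ t₂)).prod (volume.restrict (Ioc 0 (2 * π)))) := by
    rw [Measure.prod_restrict]
    exact (hGc.integrableOn_compact (isCompact_Icc.prod isCompact_Icc)).mono_set
      (prod_mono Ioc_subset_Icc_self Ioc_subset_Icc_self)
  have hGI : IntervalIntegrable (fun t ↦ (2 * π)⁻¹ * ∫ θ in (0 : ℝ)..2 * π, G t θ) volume t₁ t₂ := by
    rw [intervalIntegrable_iff_integrableOn_Ioc_of_le ht12]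
    simp_rw [intervalIntegral.integral_of_le two_pi_pos.le]
    exact hGint.integral_prod_left.const_mul _
  have hseg : ∀ σ : ℝ, σ₀ ≤ σ → ∀ S ⊆ Icc (t₁ - R) (t₂ + R), ContinuousOn (fun t : ℝ ↦ K (σ + t * I)) S :=
    fun σ hσ S hS ↦ hK.continuousOn.comp (by fun_prop) fun t ht ↦ by
      have := hS ht
      simp only [mem_ofPred_eq, add_re, ofReal_re, mul_re, I_re, mul_zero, ofReal_im, I_im,
        mul_one, sub_self, add_zero, add_im, mul_im, zero_add]
      exact ⟨hσ, this⟩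
  have hlogI : IntervalIntegrable (fun t : ℝ ↦ Real.log ‖K (A + t * I)‖) volume t₁ t₂ := by
    refine ContinuousOn.intervalIntegrable ?_
    rw [uIcc_of_le ht12]
    exact (hseg A (by linarith) _ (Icc_subset_Icc (by linarith) (by linarith))).norm.log
      fun t ht ↦ norm_ne_zero_iff.mpr (h0 t ht)
  have hwI : ∀ ρ : ℂ, IntegrableOn ((Icc (ρ.im - η) (ρ.im + η)).indicator
      (fun _ ↦ (analyticOrderNatAt K ρ : ℝ))) (Ioc t₁ t₂) := fun ρ ↦
    (integrableOn_const (by simp)).indicator measurableSet_Icc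
  -- integrate over the segment
  have hmono := intervalIntegral.integral_mono_on ht12 (f := fun t ↦ κ * w t)
    (by
      rw [intervalIntegrable_iff_integrableOn_Ioc_of_le ht12]
      exact (integrable_finsetSum Z fun ρ _ ↦ hwI ρ).const_mul κ)
    (hGI.sub hlogI) hpt
  rw [intervalIntegral.integral_sub hGI hlogI] at hmono
  -- A zero near an end of the segment may lose half of its window of length `2η`, but a length `η`
  -- always survives.
  have hleft : κ * η * ∑ ρ ∈ Z, (analyticOrderNatAt K ρ : ℝ) ≤ ∫ t in t₁..t₂, κ * w t := by
    rw [intervalIntegral.integral_const_mul, intervalIntegral.integral_of_le ht12,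
      integral_finsetSum Z fun ρ _ ↦ hwI ρ, mul_assoc, Finset.mul_sum]
    gcongr with ρ hρ
    obtain ⟨z1, z2, z3, z4⟩ := hZ ρ hρ
    rw [setIntegral_indicator measurableSet_Icc, setIntegral_const, smul_eq_mul]
    gcongr
    rw [Measure.real, ← ENNReal.ofReal_le_iff_le_toReal (by
      exact ((measure_mono inter_subset_left).trans_lt measure_Ioc_lt_top).ne)]
    rcases le_total (ρ.im + η) t₂ with h | h
    · refine le_trans ?_ (measure_mono (show Ioc ρ.im (ρ.im + η) ⊆ _ from fun t ht ↦
        ⟨⟨by linarith [ht.1], by linarith [ht.2]⟩, by linarith [ht.1], ht.2⟩))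
      rw [Real.volume_Ioc, add_sub_cancel_left]
    · refine le_trans ?_ (measure_mono (show Ioc (t₂ - η) t₂ ⊆ _ from fun t ht ↦
        ⟨⟨by linarith [ht.1], ht.2⟩, by linarith [ht.1], by linarith [ht.2]⟩))
      rw [Real.volume_Ioc, sub_sub_cancel]
  have hright : ∫ t in t₁..t₂, (2 * π)⁻¹ * ∫ θ in (0 : ℝ)..2 * π, G t θ ≤ M / 2 := by
    rw [intervalIntegral.integral_const_mul]
    have hswap : ∫ t in t₁..t₂, ∫ θ in (0 : ℝ)..2 * π, G t θ =
        ∫ θ in (0 : ℝ)..2 * π, ∫ t in t₁..t₂, G t θ := by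
      simp_rw [intervalIntegral.integral_of_le two_pi_pos.le, intervalIntegral.integral_of_le ht12]
      exact integral_integral_swap hGint
    -- For a fixed angle the moving point of the circle runs along the vertical line of abscissa `A
    -- + R cos θ`, where the mean square hypothesis applies.
    have hθ : ∀ θ ∈ Icc (0 : ℝ) (2 * π), ∫ t in t₁..t₂, G t θ ≤ M / 2 := fun θ _ ↦ by
      have hc : R * Real.cos θ ≤ R ∧ -R ≤ R * Real.cos θ :=
        ⟨by nlinarith [Real.cos_le_one θ], by nlinarith [Real.neg_one_le_cos θ]⟩
      have hsn : R * Real.sin θ ≤ R ∧ -R ≤ R * Real.sin θ :=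
        ⟨by nlinarith [Real.sin_le_one θ], by nlinarith [Real.neg_one_le_sin θ]⟩
      have e : ∀ t : ℝ, G t θ = ‖K ((A + R * Real.cos θ : ℝ) + (t + R * Real.sin θ : ℝ) * I)‖ ^ 2 / 2 :=
        fun t ↦ by
          simp only [G, circleMap]
          congr 4
          rw [Complex.exp_mul_I]
          push_cast
          ring
      simp_rw [e]
      rw [intervalIntegral.integral_div]
      gcongr
      rw [intervalIntegral.integral_comp_add_right
        (fun t : ℝ ↦ ‖K ((A + R * Real.cos θ : ℝ) + t * I)‖ ^ 2)]
      refine le_trans ?_ (hM (A + R * Real.cos θ) ⟨by linarith [hc.2], by linarith [hc.1]⟩)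
      have hci : ContinuousOn (fun t : ℝ ↦ ‖K ((A + R * Real.cos θ : ℝ) + t * I)‖ ^ 2)
          (Icc (t₁ - R) (t₂ + R)) :=
        (hseg (A + R * Real.cos θ) (by linarith [hc.2]) _ Subset.rfl).norm.pow 2
      refine intervalIntegral.integral_mono_interval (by linarith [hsn.2]) (by linarith)
        (by linarith [hsn.1]) (ae_of_all _ fun t ↦ by positivity) ?_
      refine ContinuousOn.intervalIntegrable ?_
      rwa [uIcc_of_le (by linarith)]
    rw [hswap]
    have hI : IntervalIntegrable (fun θ ↦ ∫ t in t₁..t₂, G t θ) volume 0 (2 * π) := by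
      rw [intervalIntegrable_iff_integrableOn_Ioc_of_le two_pi_pos.le]
      simp_rw [intervalIntegral.integral_of_le ht12]
      exact hGint.integral_prod_right
    have := intervalIntegral.integral_mono_on two_pi_pos.le hI intervalIntegrable_const hθ
    rw [intervalIntegral.integral_const, sub_zero, smul_eq_mul] at this
    rw [inv_mul_le_iff₀ two_pi_pos]
    exact this
  linarith

/-! ### Lower bounds for the Gamma function and for `ζ_Q` far to the right. -/

/-- The reflection formula gives `|Γ(1 + it)|² = π t / sinh (π t)` exactly, so Stirling's formula is
not needed; this is why the line of centres has an integral abscissa. -/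
theorem norm_sq_Gamma_one_add_ge {t : ℝ} (ht : t ≠ 0) :
    π * |t| * rexp (-(π * |t|)) ≤ ‖Complex.Gamma (1 + t * I)‖ ^ 2 := by
  have hI : (t * I : ℂ) ≠ 0 := mul_ne_zero (ofReal_ne_zero.mpr ht) I_ne_zero
  have h1 : Complex.Gamma (1 - t * I) = starRingEnd ℂ (Complex.Gamma (1 + t * I)) := by
    rw [← Complex.Gamma_conj]
    congr 1
    simp [sub_eq_add_neg]
  have h2 : ‖Complex.Gamma (1 + t * I)‖ ^ 2 = |t| * (π / |Real.sinh (π * t)|) := by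
    have h3 : ‖Complex.Gamma (1 - t * I)‖ = ‖Complex.Gamma (1 + t * I)‖ := by
      rw [h1, RCLike.norm_conj]
    have h4 := congrArg norm (Complex.Gamma_mul_Gamma_one_sub (t * I))
    rw [← mul_assoc (π : ℂ), Complex.sin_mul_I, ← ofReal_mul, ← ofReal_sinh, norm_mul, norm_div,
      norm_mul _ I, Complex.norm_I, mul_one, norm_real, norm_real, Real.norm_eq_abs,
      Real.norm_eq_abs, abs_of_pos pi_pos] at h4
    rw [← h4, sq]
    nth_rw 2 [← h3]
    rw [add_comm (1 : ℂ), Complex.Gamma_add_one _ hI, norm_mul, norm_mul, Complex.norm_I, mul_one,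
      norm_real, Real.norm_eq_abs, mul_assoc]
  have h5 : |Real.sinh (π * t)| ≤ rexp (π * |t|) := by
    have e : π * |t| = |π * t| := by rw [abs_mul, abs_of_pos pi_pos]
    rw [e, Real.sinh_eq, abs_le]
    have h6 := Real.exp_le_exp.mpr (le_abs_self (π * t))
    have h7 := Real.exp_le_exp.mpr (neg_le_abs (π * t))
    constructor <;> linarith [Real.exp_pos (π * t), Real.exp_pos (-(π * t)),
      Real.exp_pos |π * t|]
  have h8 : 0 < |Real.sinh (π * t)| := abs_pos.mpr (by
    rw [Ne, Real.sinh_eq_zero]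
    exact mul_ne_zero pi_ne_zero ht)
  rw [h2, Real.exp_neg, ← div_eq_mul_inv, mul_comm π |t|, mul_div_assoc, mul_comm |t| π]
  gcongr

theorem norm_sq_Gamma_ge {t : ℝ} (ht : t ≠ 0) (n : ℕ) :
    π * |t| ^ (2 * n + 1) * rexp (-(π * |t|)) ≤ ‖Complex.Gamma (n + 1 + t * I)‖ ^ 2 := by
  induction n with
  | zero => simpa using norm_sq_Gamma_one_add_ge ht
  | succ n ih =>
    have hne : (n + 1 + t * I : ℂ) ≠ 0 := fun h ↦ ht (by simpa using congrArg Complex.im h)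
    have hle : |t| ≤ ‖(n + 1 + t * I : ℂ)‖ := by
      simpa using Complex.abs_im_le_norm (n + 1 + t * I : ℂ)
    push_cast
    rw [show (n + 1 + 1 + t * I : ℂ) = (n + 1 + t * I) + 1 by ring, Complex.Gamma_add_one _ hne,
      norm_mul, mul_pow]
    calc _ = |t| ^ 2 * (π * |t| ^ (2 * n + 1) * rexp (-(π * |t|))) := by ring
      _ ≤ _ := by gcongr

theorem exists_form_min {a b c : ℝ} (ha : 0 < a) (hD : 0 < 4 * a * c - b ^ 2) :
    ∃ p₀ : {p : ℤ × ℤ // p ≠ 0}, ∀ p : {p : ℤ × ℤ // p ≠ 0}, form a b c p₀ ≤ form a b c p := by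
  have : Nonempty {p : ℤ × ℤ // p ≠ 0} := ⟨⟨(1, 0), by simp⟩⟩
  have h := (summable_zeta ha hD (one_lt_two)).tendsto_cofinite_zero
  have h2 : Tendsto (fun p : {p : ℤ × ℤ // p ≠ 0} ↦ (form a b c p ^ (2 : ℝ))) cofinite atTop := by
    have h3 : Tendsto (fun p : {p : ℤ × ℤ // p ≠ 0} ↦ 1 / form a b c p ^ (2 : ℝ)) cofinite
        (𝓝[>] 0) := tendsto_nhdsWithin_iff.mpr ⟨h, Eventually.of_forall fun p ↦ by
          have := form_pos ha hD p.2
          exact mem_Ioi.mpr (by positivity)⟩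
    simpa [Function.comp_def] using tendsto_inv_nhdsGT_zero.comp h3
  obtain ⟨p₀, hp⟩ := h2.exists_forall_le
  exact ⟨p₀, fun p ↦ (Real.rpow_le_rpow_iff (form_pos ha hD p₀.2).le (form_pos ha hD p.2).le
    two_pos).mp (hp p)⟩

/-- Far to the right, `ζ_Q` is dominated by the terms of the shortest vectors. -/
theorem exists_norm_zeta_ge {a b c : ℝ} (ha : 0 < a) (hD : 0 < 4 * a * c - b ^ 2) :
    ∃ (n : ℕ) (m : ℝ), 1 ≤ n ∧ 0 < m ∧ ∀ Z, IsContinuation a b c Z → ∀ s : ℂ, (n + 1 : ℝ) ≤ s.re →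
      m ^ (-s.re) / 2 ≤ ‖Z s‖ := by
  classical
  obtain ⟨p₀, hp₀⟩ := exists_form_min ha hD
  set m := form a b c p₀ with hm
  have hm0 : 0 < m := form_pos ha hD p₀.2
  have hq : ∀ p : {p : ℤ × ℤ // p ≠ 0}, 0 < form a b c p := fun p ↦ form_pos ha hD p.2
  -- The terms of non-minimal vectors, relative to the minimum. Their sum tends to `0` as `k` grows,
  -- so some `k` makes it smaller than `1 / 2`.
  let g : ℕ → {p : ℤ × ℤ // p ≠ 0} → ℝ :=
    fun k p ↦ if form a b c p = m then 0 else (m / form a b c p) ^ k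
  have hr0 : ∀ p : {p : ℤ × ℤ // p ≠ 0}, 0 ≤ m / form a b c p := fun p ↦ (div_pos hm0 (hq p)).le
  have hr1 : ∀ p : {p : ℤ × ℤ // p ≠ 0}, m / form a b c p ≤ 1 :=
    fun p ↦ (div_le_one (hq p)).mpr (hp₀ p)
  have hg0 : ∀ k p, 0 ≤ g k p := fun k p ↦ by
    simp only [g]; split_ifs
    · exact le_rfl
    · exact pow_nonneg (hr0 p) k
  have hbs : Summable fun p : {p : ℤ × ℤ // p ≠ 0} ↦ (m / form a b c p) ^ 2 := by
    refine ((summable_zeta ha hD one_lt_two).mul_left (m ^ 2)).congr fun p ↦ ?_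
    rw [Real.rpow_two, div_pow, mul_one_div]
  have hgb : ∀ k, 2 ≤ k → ∀ p, g k p ≤ (m / form a b c p) ^ 2 := fun k hk p ↦ by
    simp only [g]; split_ifs
    · exact pow_nonneg (hr0 p) 2
    · exact pow_le_pow_of_le_one (hr0 p) (hr1 p) hk
  have hlim : Tendsto (fun k ↦ ∑' p, g k p) atTop (𝓝 (∑' _ : {p : ℤ × ℤ // p ≠ 0}, (0 : ℝ))) := by
    refine tendsto_tsum_of_dominated_convergence hbs (fun p ↦ ?_) ?_
    · by_cases h : form a b c p = m
      · simp [g, h]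
      · simp only [g, h, if_false]
        refine tendsto_pow_atTop_nhds_zero_of_lt_one (hr0 p) ?_
        exact (div_lt_one (hq p)).mpr (lt_of_le_of_ne (hp₀ p) (Ne.symm h))
    · filter_upwards [eventually_ge_atTop 2] with k hk p
      rw [Real.norm_of_nonneg (hg0 k p)]
      exact hgb k hk p
  rw [tsum_zero] at hlim
  obtain ⟨k, hk, hk2⟩ := ((hlim.eventually_lt_const (show (0 : ℝ) < 1 / 2 by norm_num)).and
    (eventually_ge_atTop 2)).exists
  obtain ⟨n, rfl⟩ : ∃ n, k = n + 1 := ⟨k - 1, by omega⟩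
  refine ⟨n, m, by omega, hm0, fun Z hZ s hs ↦ ?_⟩
  have hn : (1 : ℝ) ≤ n := by exact_mod_cast (by omega : 1 ≤ n)
  have hsum := (hZ.2 s (by linarith)).mul_left ((m : ℂ) ^ s)
  have hre := Complex.hasSum_re hsum
  have hgs : Summable (g (n + 1)) := hbs.of_nonneg_of_le (hg0 _) (hgb _ hk2)
  -- After multiplication by `m ^ s` every minimal vector contributes exactly `1`. One of them is
  -- kept, and the others can only increase the real part.
  have hlow := (hasSum_ite_eq p₀ (1 : ℝ)).sub hgs.hasSum
  have hle := hasSum_le (fun p ↦ ?_) hlow hre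
  · have h1 : 1 / 2 ≤ ‖(m : ℂ) ^ s * Z s‖ := by
      linarith [Complex.re_le_norm ((m : ℂ) ^ s * Z s)]
    rw [norm_mul, norm_cpow_eq_rpow_re_of_pos hm0] at h1
    rw [Real.rpow_neg hm0.le]
    have : 0 < m ^ s.re := by positivity
    field_simp
    linarith
  · by_cases h : form a b c p = m
    · have e : (m : ℂ) ^ s * (form a b c p : ℂ) ^ (-s) = 1 := by
        rw [h, cpow_neg, mul_inv_cancel₀]
        simp [Complex.cpow_eq_zero_iff, hm0.ne']
      rw [e]
      simp only [g, h, if_true, one_re]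
      split_ifs <;> norm_num
    · have hne : p ≠ p₀ := fun h' ↦ h (by rw [h'])
      have e : ‖(m : ℂ) ^ s * (form a b c p : ℂ) ^ (-s)‖ = (m / form a b c p) ^ s.re := by
        rw [norm_mul, norm_cpow_eq_rpow_re_of_pos hm0, norm_cpow_eq_rpow_re_of_pos (hq p),
          Real.div_rpow hm0.le (hq p).le, neg_re, Real.rpow_neg (hq p).le, div_eq_mul_inv]
      have h2 : (m / form a b c p) ^ s.re ≤ (m / form a b c p) ^ (n + 1) := by
        rw [← Real.rpow_natCast]
        refine Real.rpow_le_rpow_of_exponent_ge (div_pos hm0 (hq p)) (hr1 p) ?_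
        push_cast
        exact hs
      simp only [g, h, if_false, hne]
      have h3 := neg_le_of_abs_le (Complex.abs_re_le_norm ((m : ℂ) ^ s * (form a b c p : ℂ) ^ (-s)))
      linarith

/-! ### The twisted zeta-function: logarithmic lower bound and mean square. -/

/-- The nonvanishing factor by which `ζ_Q` is multiplied before zeros are counted: the Gamma
factor, rotated by the angle `φ` and normalised at height `T`. -/
noncomputable def twist (T φ : ℝ) (s : ℂ) : ℂ :=
  (T : ℂ) ^ (1 / 2 - s) * (cexp (φ * I) ^ (-s) * (π : ℂ) ^ (-s) * Complex.Gamma s)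

theorem twist_ne_zero {T : ℝ} (hT : 0 < T) (φ : ℝ) {s : ℂ} (hs : 0 < s.re) : twist T φ s ≠ 0 := by
  have hG : Complex.Gamma s ≠ 0 := Gamma_ne_zero_of_re_pos hs
  simp [twist, Complex.cpow_eq_zero_iff, hG, hT.ne', pi_ne_zero, Complex.exp_ne_zero]

theorem analyticAt_twist {T : ℝ} (hT : 0 < T) (φ : ℝ) {s : ℂ} (hs : 0 < s.re) :
    AnalyticAt ℂ (twist T φ) s := by
  have hd : DifferentiableOn ℂ (twist T φ) {s | 0 < s.re} := fun w hw ↦ by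
    have hw : 0 < w.re := hw
    have h1 : DifferentiableAt ℂ (fun s : ℂ ↦ (T : ℂ) ^ (1 / 2 - s)) w :=
      DifferentiableAt.const_cpow (by fun_prop) (Or.inl (ofReal_ne_zero.mpr hT.ne'))
    have h2 : DifferentiableAt ℂ (fun s : ℂ ↦ cexp (φ * I) ^ (-s)) w :=
      DifferentiableAt.const_cpow (by fun_prop) (Or.inl (Complex.exp_ne_zero _))
    have h3 : DifferentiableAt ℂ (fun s : ℂ ↦ (π : ℂ) ^ (-s)) w :=
      DifferentiableAt.const_cpow (by fun_prop) (Or.inl (ofReal_ne_zero.mpr pi_ne_zero))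
    have h4 : DifferentiableAt ℂ Complex.Gamma w := Complex.differentiableAt_Gamma _ fun m h ↦ by
      rw [h] at hw
      simp only [neg_re, natCast_re] at hw
      linarith [(Nat.cast_nonneg m : (0 : ℝ) ≤ m)]
    exact (h1.mul ((h2.mul h3).mul h4)).differentiableWithinAt
  exact hd.analyticAt ((isOpen_lt continuous_const continuous_re).mem_nhds hs)

theorem norm_exp_mul_I_cpow_neg {φ : ℝ} (h1 : -π < φ) (h2 : φ ≤ π) (s : ℂ) :
    ‖cexp (φ * I) ^ (-s)‖ = rexp (φ * s.im) := by
  rw [cpow_def_of_ne_zero (Complex.exp_ne_zero _), Complex.log_exp (by simpa) (by simpa),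
    Complex.norm_exp]
  simp

/-- The rotation contributes `(π / 2 - 1 / T) |t|`, which cancels the decay `-π |t| / 2` of `log
|Γ|` up to a loss of `|t| / T ≤ 1`. `Real.log t` means `log |t|` for negative `t`, so both
half-planes are covered. -/
theorem log_norm_twist_ge (n : ℕ) {T ε : ℝ} (hT : 1 ≤ T) (hε : ε = 1 ∨ ε = -1) {t : ℝ}
    (ht : 0 < ε * t) (htT : ε * t ≤ T) :
    (n + 1 / 2 : ℝ) * (Real.log t - Real.log T) + (Real.log π / 2 - (n + 1) * Real.log π - 1) ≤
      Real.log ‖twist T (ε * (π / 2 - 1 / T)) ((n + 1 : ℝ) + t * I)‖ := by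
  have hT0 : 0 < T := by linarith
  have habs : ε * t = |t| := by
    rcases hε with rfl | rfl
    · rw [one_mul] at ht ⊢; rw [abs_of_pos ht]
    · rw [neg_one_mul] at ht ⊢; rw [abs_of_neg (by linarith)]
  rw [habs] at ht htT
  have ht0 : t ≠ 0 := abs_pos.mp ht
  have hφ : |ε * (π / 2 - 1 / T)| < π := by
    have h1 : |ε| = 1 := by rcases hε with rfl | rfl <;> simp
    have h2 : 0 < 1 / T := by positivity
    have h3 : 1 / T ≤ 1 := (div_le_one hT0).mpr hT
    rw [abs_mul, h1, one_mul, abs_lt]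
    constructor <;> linarith [pi_gt_three]
  have hGne : Complex.Gamma ((n + 1 : ℝ) + t * I) ≠ 0 :=
    Gamma_ne_zero_of_re_pos (by simp; positivity)
  have hG : Real.log π + (2 * n + 1) * Real.log t - π * |t| ≤
      2 * Real.log ‖Complex.Gamma ((n + 1 : ℝ) + t * I)‖ := by
    have h1 := norm_sq_Gamma_ge ht0 n
    have h2 := Real.log_le_log (by positivity) h1
    rw [Real.log_mul (by positivity) (by positivity), Real.log_mul (by positivity) (by positivity),
      Real.log_exp, Real.log_pow, Real.log_pow, Real.log_abs] at h2
    push_cast at h2 ⊢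
    linarith
  have hre : (((n + 1 : ℝ) : ℂ) + t * I).re = n + 1 := by simp
  have him : (((n + 1 : ℝ) : ℂ) + t * I).im = t := by simp
  rw [twist, norm_mul, norm_mul, norm_mul, norm_cpow_eq_rpow_re_of_pos hT0,
    norm_cpow_eq_rpow_re_of_pos pi_pos, norm_exp_mul_I_cpow_neg (abs_lt.mp hφ).1 (abs_lt.mp hφ).2.le,
    neg_re, sub_re, hre, him, show (1 / 2 : ℂ).re = 1 / 2 by norm_num,
    Real.log_mul (by positivity) (by positivity), Real.log_mul (by positivity) (by positivity),
    Real.log_mul (by positivity) (by positivity), Real.log_rpow hT0, Real.log_rpow pi_pos,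
    Real.log_exp]
  have e : ε * (π / 2 - 1 / T) * t = (π / 2 - 1 / T) * |t| := by rw [← habs]; ring
  have h3 : 1 / T * |t| ≤ 1 := by rw [one_div, inv_mul_le_one₀ hT0]; exact htT
  rw [e]
  linear_combination h3 + hG / 2

theorem integral_norm_sq_le_of_lintegral {f : ℝ → ℂ} (hf : Continuous f) {L B : ℝ} (hB : 0 ≤ B)
    (h : ∫⁻ t in Icc (-L) L, ‖f t‖ₑ ^ 2 ≤ ENNReal.ofReal B) {t₁ t₂ : ℝ} (h12 : t₁ ≤ t₂)
    (h1 : -L ≤ t₁) (h2 : t₂ ≤ L) : ∫ t in t₁..t₂, ‖f t‖ ^ 2 ≤ B := by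
  rw [intervalIntegral.integral_of_le h12,
    integral_eq_lintegral_of_nonneg_ae (Eventually.of_forall fun _ ↦ sq_nonneg _)
      (by fun_prop)]
  refine ENNReal.toReal_le_of_le_ofReal hB (le_trans ?_ h)
  calc _ = ∫⁻ t in Ioc t₁ t₂, ‖f t‖ₑ ^ 2 := by
        refine lintegral_congr fun t ↦ ?_
        rw [ENNReal.ofReal_pow (norm_nonneg _), ofReal_norm]
    _ ≤ ∫⁻ t in Icc (-L) L, ‖f t‖ₑ ^ 2 := lintegral_mono_set fun t ht ↦
        ⟨h1.trans ht.1.le, ht.2.trans h2⟩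

/-- Mean square of the twisted zeta-function on vertical segments. -/
theorem twist_mul_mean_square {a b c : ℝ} (ha : 0 < a) (hD : 4 * a * c - b ^ 2 = 4) {σ₀ σ₁ : ℝ}
    (hσ₀ : 2 / 3 < σ₀) {Z : ℂ → ℂ} (hZ : IsContinuation a b c Z) : ∃ C : ℝ, 0 ≤ C ∧
      ∀ T ε : ℝ, 1 ≤ T → ε = 1 ∨ ε = -1 → ∀ σ ∈ Icc σ₀ σ₁, ∀ t₁ t₂ : ℝ, t₁ ≤ t₂ →
        -(2 * T) ≤ t₁ → t₂ ≤ 2 * T → (∀ t ∈ Icc t₁ t₂, 1 ≤ |t|) →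
        ∫ t in t₁..t₂, ‖twist T (ε * (π / 2 - 1 / T)) (σ + t * I) * Z (σ + t * I)‖ ^ 2 ≤ C * T := by
  obtain ⟨C, hC, h⟩ := rayPair_Λ₀_mean_square (σ₁ := σ₁) ha hD hσ₀
  refine ⟨2 * (C * 2 ^ (2 * σ₁)) + 32, by positivity,
    fun T ε hT hε σ hσ t₁ t₂ h12 h1 h2 habs ↦ ?_⟩
  have hT0 : 0 < T := by linarith
  set δ := 1 / T with hδ
  have hδ0 : 0 < δ := by positivity
  have hδ1 : δ ≤ 1 := (div_le_one hT0).mpr hT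
  set z := cexp ((ε * (π / 2 - δ) : ℝ) * I) with hz
  have hz1 : ‖z‖ = 1 := norm_exp_ofReal_mul_I _
  have hre : z.re = Real.sin δ := by
    rw [hz, exp_ofReal_mul_I_re]
    rcases hε with rfl | rfl
    · rw [one_mul, Real.cos_pi_div_two_sub]
    · rw [neg_one_mul, Real.cos_neg, Real.cos_pi_div_two_sub]
  have him : |z.im| = Real.cos δ := by
    have hc : 0 ≤ Real.cos δ := Real.cos_nonneg_of_mem_Icc ⟨by linarith [pi_gt_three],
      by linarith [pi_gt_three]⟩
    rw [hz, exp_ofReal_mul_I_im]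
    rcases hε with rfl | rfl
    · rw [one_mul, Real.sin_pi_div_two_sub, abs_of_nonneg hc]
    · rw [neg_one_mul, Real.sin_neg, Real.sin_pi_div_two_sub, abs_neg, abs_of_nonneg hc]
  -- The real part is `sin (1 / T)`, which is at least `(2 / π) / T` by Jordan's inequality.
  have hrelow : 1 / (2 * T) ≤ z.re := by
    rw [hre]
    refine le_trans ?_ (Real.mul_le_sin hδ0.le (by linarith [pi_gt_three]))
    rw [hδ, div_mul_div_comm, mul_one, div_le_div_iff₀ (by positivity) (by positivity)]
    nlinarith [pi_le_four]
  have hz0 : 0 < z.re := lt_of_lt_of_le (by positivity) hrelow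
  have himlow : 1 / 2 ≤ |z.im| := by
    rw [him]
    nlinarith [Real.one_sub_sq_div_two_le_cos (x := δ)]
  set P := rayPair ha hD hz0 hz1 with hP
  have hms := h z hz0 hz1 himlow σ hσ (2 * T) (by positivity)
  have hcont : Continuous fun t : ℝ ↦ P.Λ₀ (σ + t * I) :=
    P.differentiable_Λ₀.continuous.comp (by fun_prop)
  have hint := integral_norm_sq_le_of_lintegral hcont (by positivity) hms h12 h1 h2
  -- The polar terms have norm at most `1` each because `|t| ≥ 1`, and `(x + 2)² ≤ 2 x² + 8`.
  have hK : ∀ t ∈ Icc t₁ t₂, ‖twist T (ε * (π / 2 - δ)) (σ + t * I) * Z (σ + t * I)‖ ^ 2 ≤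
      T ^ (1 - 2 * σ) * (2 * ‖P.Λ₀ (σ + t * I)‖ ^ 2 + 8) := fun t ht ↦ by
    set s : ℂ := σ + t * I with hs
    have hsre : s.re = σ := by simp [hs]
    have hsim : s.im = t := by simp [hs]
    have ht1 := habs t ht
    have hs1 : s ≠ 1 := fun h ↦ by
      have : t = 0 := by rw [← hsim, h, one_im]
      norm_num [this] at ht1
    have e : twist T (ε * (π / 2 - δ)) s * Z s = (T : ℂ) ^ (1 / 2 - s) * P.Λ s := by
      rw [hP, rayPair_Λ_eq ha hD hz0 hz1 hZ (by rw [hsre]; linarith [hσ.1]) hs1, twist]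
      ring
    have eΛ : P.Λ s = P.Λ₀ s - 1 / s - starRingEnd ℂ z / (1 - s) := by
      simp [WeakFEPair.Λ, hP, rayPair]
    have n1 : ‖1 / s‖ ≤ 1 := by
      have : 1 ≤ ‖s‖ := ht1.trans (hsim ▸ abs_im_le_norm s)
      rw [norm_div, norm_one]
      exact div_le_one_of_le₀ this (norm_nonneg _)
    have n2 : ‖starRingEnd ℂ z / (1 - s)‖ ≤ 1 := by
      have : 1 ≤ ‖1 - s‖ := ht1.trans (by
        have := abs_im_le_norm (1 - s)
        rwa [sub_im, one_im, hsim, zero_sub, abs_neg] at this)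
      rw [norm_div, RCLike.norm_conj, hz1]
      exact div_le_one_of_le₀ this (norm_nonneg _)
    have n3 : ‖P.Λ s‖ ≤ ‖P.Λ₀ s‖ + 2 := by
      rw [eΛ]
      refine (norm_sub_le _ _).trans ?_
      linarith [norm_sub_le (P.Λ₀ s) (1 / s)]
    have n4 : ‖(T : ℂ) ^ (1 / 2 - s)‖ ^ 2 = T ^ (1 - 2 * σ) := by
      rw [norm_cpow_eq_rpow_re_of_pos hT0, ← Real.rpow_natCast, ← Real.rpow_mul hT0.le]
      congr 1
      simp [hsre]
      ring
    rw [e, norm_mul, mul_pow, n4]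
    refine mul_le_mul_of_nonneg_left ?_ (by positivity)
    nlinarith [norm_nonneg (P.Λ s), norm_nonneg (P.Λ₀ s), sq_nonneg (‖P.Λ₀ s‖ - 2)]
  have hcont2 : Continuous fun t : ℝ ↦ T ^ (1 - 2 * σ) * (2 * ‖P.Λ₀ (σ + t * I)‖ ^ 2 + 8) := by
    fun_prop
  have hstep : ∫ t in t₁..t₂, ‖twist T (ε * (π / 2 - δ)) (σ + t * I) * Z (σ + t * I)‖ ^ 2 ≤
      ∫ t in t₁..t₂, T ^ (1 - 2 * σ) * (2 * ‖P.Λ₀ (σ + t * I)‖ ^ 2 + 8) := by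
    rw [intervalIntegral.integral_of_le h12, intervalIntegral.integral_of_le h12]
    refine integral_mono_of_nonneg (Eventually.of_forall fun _ ↦ sq_nonneg _)
      (hcont2.integrableOn_Ioc) ?_
    filter_upwards [ae_restrict_mem measurableSet_Ioc] with t ht
    exact hK t ⟨ht.1.le, ht.2⟩
  refine hstep.trans ?_
  rw [intervalIntegral.integral_const_mul, intervalIntegral.integral_add
    (Continuous.intervalIntegrable (by fun_prop) _ _) (by simp),
    intervalIntegral.integral_const_mul, intervalIntegral.integral_const, smul_eq_mul]
  have hσ2 : 2 / 3 < σ := lt_of_lt_of_le hσ₀ hσ.1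
  have b1 : z.re ^ (-(2 * σ)) ≤ 2 ^ (2 * σ₁) * T ^ (2 * σ) := by
    calc z.re ^ (-(2 * σ)) ≤ (1 / (2 * T)) ^ (-(2 * σ)) :=
          Real.rpow_le_rpow_of_nonpos (by positivity) hrelow (by linarith)
      _ = 2 ^ (2 * σ) * T ^ (2 * σ) := by
          rw [Real.rpow_neg (by positivity), one_div, Real.inv_rpow (by positivity), inv_inv,
            Real.mul_rpow (by norm_num) hT0.le]
      _ ≤ _ := by
          gcongr
          · norm_num
          · exact hσ.2
  -- The normalisation `T ^ (1 / 2 - s)` in `twist` is chosen so that the bound is of order `T` on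
  -- every line.
  have b2 : T ^ (1 - 2 * σ) * T ^ (2 * σ) = T := by
    rw [← Real.rpow_add hT0, sub_add_cancel, Real.rpow_one]
  have b3 : T ^ (1 - 2 * σ) ≤ 1 := Real.rpow_le_one_of_one_le_of_nonpos hT (by linarith)
  have b4 : 0 < T ^ (1 - 2 * σ) := by positivity
  calc _ ≤ T ^ (1 - 2 * σ) * (2 * (C * (2 ^ (2 * σ₁) * T ^ (2 * σ))) + (4 * T) * 8) := by
        gcongr
        · exact hint.trans (by gcongr)
        · linarith
    _ = 2 * (C * 2 ^ (2 * σ₁)) * (T ^ (1 - 2 * σ) * T ^ (2 * σ)) + T ^ (1 - 2 * σ) * (32 * T) := by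
        ring
    _ ≤ 2 * (C * 2 ^ (2 * σ₁)) * T + 1 * (32 * T) := by
        rw [b2]
        gcongr
    _ = _ := by ring

/-! ### The linear bound for the number of zeros. -/

theorem analyticOrderAt_mul_of_ne_zero {u f : ℂ → ℂ} {s : ℂ} (hu : AnalyticAt ℂ u s)
    (hs : u s ≠ 0) : analyticOrderAt (fun w ↦ u w * f w) s = analyticOrderAt f s := by
  have hinv : AnalyticAt ℂ (fun w ↦ (u w)⁻¹) s := hu.inv hs
  have hev : (fun w ↦ (u w)⁻¹ * (u w * f w)) =ᶠ[𝓝 s] f := by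
    filter_upwards [hu.continuousAt.eventually_ne hs] with w hw
    rw [inv_mul_cancel_left₀ hw]
  by_cases hf : AnalyticAt ℂ f s
  · have h := analyticOrderAt_mul hu hf
    rw [hu.analyticOrderAt_eq_zero.mpr hs, zero_add] at h
    exact h
  · rw [analyticOrderAt_of_not_analyticAt hf, analyticOrderAt_of_not_analyticAt]
    exact fun h ↦ hf ((hinv.mul h).congr hev)

theorem sum_order_le_half {a b c : ℝ} (ha : 0 < a) (hD : 4 * a * c - b ^ 2 = 4) {Z : ℂ → ℂ}
    (hZ : IsContinuation a b c Z) {n : ℕ} {m : ℝ} (hn : 1 ≤ n) (hm : 0 < m)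
    (hlow : ∀ s : ℂ, (n + 1 : ℝ) ≤ s.re → m ^ (-s.re) / 2 ≤ ‖Z s‖) :
    ∃ C : ℝ, 0 ≤ C ∧ ∀ T ε : ℝ, (n + 3 : ℝ) ≤ T → ε = 1 ∨ ε = -1 → ∀ S : Finset ℂ,
      (∀ ρ ∈ S, 3 / 4 ≤ ρ.re ∧ ρ.re < n + 1 ∧ (n + 2 : ℝ) ≤ ε * ρ.im ∧ ε * ρ.im ≤ T) →
      ∑ ρ ∈ S, (analyticOrderNatAt Z ρ : ℝ) ≤ C * T := by
  have hn' : (1 : ℝ) ≤ n := by exact_mod_cast hn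
  -- The abscissa `17 / 24` lies between `2 / 3` and `3 / 4`, and `17 / 24 + 2 · (1 / 48) = 3 / 4`
  -- fixes the margin `η = 1 / 48`. The right end is its mirror image in the line of centres.
  obtain ⟨C, hC, hms⟩ := twist_mul_mean_square (σ₀ := 17 / 24) (σ₁ := 2 * (n + 1) - 17 / 24)
    ha hD (by norm_num) hZ
  set d : ℝ := Real.log π / 2 - (n + 1) * Real.log π - 1 + Real.log (m ^ (-(n + 1 : ℝ)) / 2) with hd
  set κ : ℝ := Real.log (((n + 1 : ℝ) - 17 / 24) / ((n + 1 : ℝ) - 17 / 24 - 1 / 48)) * (1 / 48) with hκ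
  have hκ0 : 0 < κ := by
    refine mul_pos (Real.log_pos ?_) (by norm_num)
    rw [one_lt_div (by linarith)]
    linarith
  refine ⟨(C / 2 + (n + 1 / 2) + |d|) / κ, by positivity, fun T ε hT hε S hS ↦ ?_⟩
  have hT1 : 1 ≤ T := by linarith
  have hT0 : 0 < T := by linarith
  obtain ⟨t₁, t₂, h12⟩ : ∃ t₁ t₂ : ℝ, (ε = 1 ∧ t₁ = n + 2 ∧ t₂ = T) ∨
      (ε = -1 ∧ t₁ = -T ∧ t₂ = -(n + 2)) := by
    rcases hε with h | h
    · exact ⟨_, _, Or.inl ⟨h, rfl, rfl⟩⟩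
    · exact ⟨_, _, Or.inr ⟨h, rfl, rfl⟩⟩
  have hmem : ∀ t, t ∈ Icc t₁ t₂ ↔ (n + 2 : ℝ) ≤ ε * t ∧ ε * t ≤ T := fun t ↦ by
    rcases h12 with ⟨rfl, rfl, rfl⟩ | ⟨rfl, rfl, rfl⟩
    · simp
    · rw [mem_Icc]
      constructor <;> rintro ⟨h1, h2⟩ <;> constructor <;> linarith
  have hlen : t₁ + 1 / 48 ≤ t₂ := by
    rcases h12 with ⟨rfl, rfl, rfl⟩ | ⟨rfl, rfl, rfl⟩ <;> linarith
  have hlen' : t₂ - t₁ ≤ T := by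
    rcases h12 with ⟨rfl, rfl, rfl⟩ | ⟨rfl, rfl, rfl⟩ <;> linarith
  set R : ℝ := (n + 1 : ℝ) - 17 / 24 with hR
  have hlo : -(2 * T) ≤ t₁ - R := by
    rcases h12 with ⟨rfl, rfl, rfl⟩ | ⟨rfl, rfl, rfl⟩ <;> linarith
  have hhi : t₂ + R ≤ 2 * T := by
    rcases h12 with ⟨rfl, rfl, rfl⟩ | ⟨rfl, rfl, rfl⟩ <;> linarith
  -- Starting at height `n + 2`, which exceeds the radius by more than `1`, keeps all discs away
  -- from the pole.
  have habs : ∀ t ∈ Icc (t₁ - R) (t₂ + R), 1 ≤ |t| := fun t ht ↦ by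
    rw [le_abs]
    rcases h12 with ⟨rfl, rfl, rfl⟩ | ⟨rfl, rfl, rfl⟩
    · left; linarith [ht.1]
    · right; linarith [ht.2]
  set φ := ε * (π / 2 - 1 / T) with hφ
  let K : ℂ → ℂ := fun s ↦ twist T φ s * Z s
  have hZa : ∀ s : ℂ, s ≠ 1 → AnalyticAt ℂ Z s := fun s hs ↦
    hZ.1.analyticAt (isOpen_compl_singleton.mem_nhds hs)
  have hKa : ∀ s : ℂ, 0 < s.re → s ≠ 1 → AnalyticAt ℂ K s := fun s hs hs1 ↦
    (analyticAt_twist hT0 φ hs).mul (hZa s hs1)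
  have hZ0 : ∀ s : ℂ, (n + 1 : ℝ) ≤ s.re → Z s ≠ 0 := fun s hs h ↦ by
    have := hlow s hs
    rw [h, norm_zero] at this
    have : 0 < m ^ (-s.re) := by positivity
    linarith
  have hlineRe : ∀ t : ℝ, (((n + 1 : ℝ) : ℂ) + t * I).re = n + 1 := fun t ↦ by simp
  have hlineIm : ∀ t : ℝ, (((n + 1 : ℝ) : ℂ) + t * I).im = t := fun t ↦ by simp
  have hK0 : ∀ t : ℝ, K ((n + 1 : ℝ) + t * I) ≠ 0 := fun t ↦
    mul_ne_zero (twist_ne_zero hT0 φ (by rw [hlineRe]; positivity)) (hZ0 _ (hlineRe t).ge)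
  have key := sum_order_le_of_mean_square (K := K) (A := (n + 1 : ℝ)) (σ₀ := 17 / 24)
    (η := 1 / 48) (t₁ := t₁) (t₂ := t₂) (M := C * T) (by norm_num) (by linarith) hlen
    (fun s hs ↦ hKa s (by linarith [hs.1]) fun h ↦ by
      have := habs s.im hs.2
      norm_num [h] at this)
    (fun t _ ↦ hK0 t)
    (fun σ hσ ↦ hms T ε hT1 hε σ hσ _ _ (by linarith) hlo hhi habs) S
    (fun ρ hρ ↦ by
      obtain ⟨h1, h2, h3, h4⟩ := hS ρ hρ
      exact ⟨by linarith, h2, (hmem ρ.im).mpr ⟨h3, h4⟩⟩)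
  have hord : ∀ ρ ∈ S, analyticOrderNatAt K ρ = analyticOrderNatAt Z ρ := fun ρ hρ ↦ by
    have h1 : 0 < ρ.re := by linarith [(hS ρ hρ).1]
    rw [analyticOrderNatAt, analyticOrderNatAt, analyticOrderAt_mul_of_ne_zero
      (analyticAt_twist hT0 φ h1) (twist_ne_zero hT0 φ h1)]
  rw [Finset.sum_congr rfl fun ρ hρ ↦ by rw [hord ρ hρ]] at key
  have hKlow : ∀ t ∈ Icc t₁ t₂, (n + 1 / 2 : ℝ) * (Real.log t - Real.log T) + d ≤
      Real.log ‖K ((n + 1 : ℝ) + t * I)‖ := fun t ht ↦ by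
    obtain ⟨h1, h2⟩ := (hmem t).mp ht
    have h3 := log_norm_twist_ge n hT1 hε (t := t) (by linarith) h2
    have h4 := Real.log_le_log (by positivity) (hlow _ (hlineRe t).ge)
    rw [hlineRe] at h4
    have h5 : ‖twist T φ ((n + 1 : ℝ) + t * I)‖ ≠ 0 :=
      norm_ne_zero_iff.mpr (left_ne_zero_of_mul (hK0 t))
    have h6 : ‖Z ((n + 1 : ℝ) + t * I)‖ ≠ 0 :=
      norm_ne_zero_iff.mpr (right_ne_zero_of_mul (hK0 t))
    rw [norm_mul, Real.log_mul h5 h6]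
    linarith
  have hle12 : t₁ ≤ t₂ := by linarith
  have hcont : ContinuousOn (fun t : ℝ ↦ Real.log ‖K ((n + 1 : ℝ) + t * I)‖) (uIcc t₁ t₂) := by
    intro t ht
    rw [uIcc_of_le hle12] at ht
    have h1 : (((n + 1 : ℝ) : ℂ) + t * I) ≠ 1 := fun h ↦ by
      have := hlineIm t
      rw [h, one_im] at this
      have := habs t ⟨by linarith [ht.1], by linarith [ht.2]⟩
      norm_num [← ‹0 = t›] at this
    have h2 : ContinuousAt (fun t : ℝ ↦ K ((n + 1 : ℝ) + t * I)) t :=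
      ContinuousAt.comp (f := fun t : ℝ ↦ (((n + 1 : ℝ) : ℂ) + t * I))
        (hKa _ (by rw [hlineRe]; positivity) h1).continuousAt (by fun_prop)
    exact (h2.norm.log (norm_ne_zero_iff.mpr (hK0 t))).continuousWithinAt
  have hint := intervalIntegral.integral_mono_on hle12 (μ := volume)
    (f := fun t ↦ (n + 1 / 2 : ℝ) * (Real.log t - Real.log T) + d)
    ((((intervalIntegral.intervalIntegrable_log').sub
      intervalIntegrable_const).const_mul _).add intervalIntegrable_const)
    hcont.intervalIntegrable hKlow
  rw [intervalIntegral.integral_add ((((intervalIntegral.intervalIntegrable_log').sub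
      intervalIntegrable_const).const_mul _)) intervalIntegrable_const,
    intervalIntegral.integral_const_mul, intervalIntegral.integral_sub
      intervalIntegral.intervalIntegrable_log' intervalIntegrable_const,
    intervalIntegral.integral_const, intervalIntegral.integral_const, integral_log, smul_eq_mul,
    smul_eq_mul] at hint
  have hlogT : Real.log (n + 2) ≤ Real.log T := Real.log_le_log (by positivity) (by linarith)
  -- The terms in `T log T` cancel: the integral of `log (|t| / T)` loses at most `T`. This is what
  -- makes the zero count linear.
  have hlogint : -T ≤ t₂ * Real.log t₂ - t₁ * Real.log t₁ - t₂ + t₁ - (t₂ - t₁) * Real.log T := by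
    rcases h12 with ⟨-, rfl, rfl⟩ | ⟨-, rfl, rfl⟩
    · nlinarith
    · rw [Real.log_neg_eq_log, Real.log_neg_eq_log]
      nlinarith
  have hdint : -(|d| * T) ≤ (t₂ - t₁) * d := by
    nlinarith [neg_abs_le d, abs_nonneg d]
  have hfin : κ * ∑ ρ ∈ S, (analyticOrderNatAt Z ρ : ℝ) ≤ (C / 2 + (n + 1 / 2) + |d|) * T := by
    have := mul_le_mul_of_nonneg_left hlogint (by positivity : (0 : ℝ) ≤ n + 1 / 2)
    rw [hκ, hR]
    linarith
  rw [div_mul_eq_mul_div, le_div_iff₀ hκ0]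
  linarith

/-- The zeros to the right of `3 / 4` number at most a constant times `T`. -/
theorem exists_sum_order_le {a b c : ℝ} (ha : 0 < a) (hD : 4 * a * c - b ^ 2 = 4) {Z : ℂ → ℂ}
    (hZ : IsContinuation a b c Z) : ∃ (A C t₀ : ℝ), 0 ≤ C ∧ (∀ s : ℂ, A ≤ s.re → Z s ≠ 0) ∧
      ∀ T : ℝ, t₀ + 1 ≤ T → ∀ S : Finset ℂ,
        (∀ ρ ∈ S, 3 / 4 ≤ ρ.re ∧ ρ.re < A ∧ t₀ ≤ |ρ.im| ∧ |ρ.im| ≤ T) →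
        ∑ ρ ∈ S, (analyticOrderNatAt Z ρ : ℝ) ≤ C * T := by
  have hD' : 0 < 4 * a * c - b ^ 2 := by rw [hD]; norm_num
  obtain ⟨n, m, hn, hm, hlow⟩ := exists_norm_zeta_ge ha hD'
  obtain ⟨C, hC, h⟩ := sum_order_le_half ha hD hZ hn hm (hlow Z hZ)
  refine ⟨n + 1, 2 * C, n + 2, by positivity, fun s hs h0 ↦ ?_, fun T hT S hS ↦ ?_⟩
  · have := hlow Z hZ s hs
    rw [h0, norm_zero] at this
    have : 0 < m ^ (-s.re) := by positivity
    linarith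
  · have h1 := h T 1 (by linarith) (Or.inl rfl) (S.filter fun ρ ↦ 0 ≤ ρ.im) fun ρ hρ ↦ by
      obtain ⟨hρ, him⟩ := Finset.mem_filter.mp hρ
      rw [one_mul, ← abs_of_nonneg him]
      exact hS ρ hρ
    have h2 := h T (-1) (by linarith) (Or.inr rfl) (S.filter fun ρ ↦ ¬ 0 ≤ ρ.im) fun ρ hρ ↦ by
      obtain ⟨hρ, him⟩ := Finset.mem_filter.mp hρ
      rw [neg_one_mul, ← abs_of_neg (not_le.mp him)]
      exact hS ρ hρ
    rw [← Finset.sum_filter_add_sum_filter_not S fun ρ ↦ 0 ≤ ρ.im]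
    linarith

/-! ### Finiteness and symmetry of the zeros. -/

/-- Removing the pole of `ζ_Q` leaves an entire function which does not vanish at `1`. -/
theorem exists_entire_eq {a b c : ℝ} (ha : 0 < a) (hD : 4 * a * c - b ^ 2 = 4) {Z : ℂ → ℂ}
    (hZ : IsContinuation a b c Z) : ∃ H : ℂ → ℂ, Differentiable ℂ H ∧ H 1 ≠ 0 ∧
      ∀ s, s ≠ 1 → H s = (1 - s) * Z s := by
  have hpi : (π : ℂ) ≠ 0 := ofReal_ne_zero.mpr pi_ne_zero
  have hz : 0 < (1 : ℂ).re := by simp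
  refine ⟨fun s ↦ (π : ℂ) ^ s * ((1 - s) * ((rayPair ha hD hz norm_one).Λ₀ s *
      (Complex.Gamma s)⁻¹ - (Complex.Gamma (s + 1))⁻¹) - (Complex.Gamma s)⁻¹), fun s ↦ ?_, ?_,
      fun s hs ↦ ?_⟩
  · have h2 := differentiable_one_div_Gamma s
    have h3 : DifferentiableAt ℂ (fun s : ℂ ↦ (Complex.Gamma (s + 1))⁻¹) s :=
      (differentiable_one_div_Gamma (s + 1)).comp s (f := fun s : ℂ ↦ s + 1) (by fun_prop)
    have h4 := (rayPair ha hD hz norm_one).differentiable_Λ₀ s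
    have h6 : DifferentiableAt ℂ (fun s : ℂ ↦ (π : ℂ) ^ s) s :=
      differentiableAt_id.const_cpow (Or.inl hpi)
    have h5 : DifferentiableAt ℂ (fun s : ℂ ↦ 1 - s) s := by fun_prop
    exact h6.mul ((h5.mul ((h4.mul h2).sub h3)).sub h2)
  · simp [hpi]
  · have h1s : (1 : ℂ) - s ≠ 0 := sub_ne_zero.mpr (Ne.symm hs)
    rw [hZ.eqOn (isContinuation_rayPair ha hD hz norm_one) hs]
    simp only [map_one, one_cpow, one_mul]
    field_simp

/-- Vanishing near `s` would force the entire function `H` to vanish identically, against `H 1 ≠ 0`.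
The argument also covers `s = 1`, by means of punctured neighbourhoods. -/
theorem analyticOrderAt_ne_top {a b c : ℝ} (ha : 0 < a) (hD : 4 * a * c - b ^ 2 = 4) {Z : ℂ → ℂ}
    (hZ : IsContinuation a b c Z) (s : ℂ) : analyticOrderAt Z s ≠ ⊤ := by
  obtain ⟨H, hH, h1, hHZ⟩ := exists_entire_eq ha hD hZ
  intro h
  have hev := analyticOrderAt_eq_top.mp h
  have h2 : ∃ᶠ w in 𝓝[≠] s, H w = 0 := by
    refine Eventually.frequently ?_
    have hne : ∀ᶠ w in 𝓝[≠] s, w ≠ 1 := by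
      by_cases hs : s = 1
      · subst hs
        exact eventually_mem_nhdsWithin
      · exact (eventually_ne_nhds hs).filter_mono nhdsWithin_le_nhds
    filter_upwards [hev.filter_mono nhdsWithin_le_nhds, hne] with w hw hw1
    rw [hHZ w hw1, hw, mul_zero]
  have h3 := (hH.differentiableOn.analyticOnNhd isOpen_univ).eqOn_zero_of_preconnected_of_frequently_eq_zero
    isPreconnected_univ (mem_univ s) h2
  exact h1 (h3 (mem_univ 1))

theorem finite_zeros {a b c : ℝ} (ha : 0 < a) (hD : 4 * a * c - b ^ 2 = 4) {Z : ℂ → ℂ}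
    (hZ : IsContinuation a b c Z) (σ T : ℝ) :
    {s : ℂ | σ ≤ s.re ∧ |s.im| ≤ T ∧ analyticOrderAt Z s ≠ 0}.Finite := by
  obtain ⟨H, hH, h1, hHZ⟩ := exists_entire_eq ha hD hZ
  obtain ⟨A, C, t₀, -, hA, -⟩ := exists_sum_order_le ha hD hZ
  set B : Set ℂ := Icc σ A ×ℂ Icc (-T) T with hB
  have hBc : IsCompact B := isCompact_Icc.reProdIm isCompact_Icc
  have hHa : AnalyticOnNhd ℂ H univ := hH.differentiableOn.analyticOnNhd isOpen_univ
  have hfin := (MeromorphicOn.divisor H B).finiteSupport hBc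
  refine (hfin.union (finite_singleton 1)).subset fun s ⟨hs1, hs2, hs3⟩ ↦ ?_
  by_cases hs : s = 1
  · exact Or.inr hs
  left
  have hZs := (analyticOrderAt_ne_zero.mp hs3).2
  have hsA : s.re ≤ A := by
    by_contra h
    exact hA s (not_le.mp h).le hZs
  have hsB : s ∈ B := ⟨⟨hs1, hsA⟩, abs_le.mp hs2⟩
  have hH0 : analyticOrderAt H s ≠ 0 :=
    analyticOrderAt_ne_zero.mpr ⟨hHa s (mem_univ s), by rw [hHZ s hs, hZs, mul_zero]⟩
  have hHt : analyticOrderAt H s ≠ ⊤ :=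
    hHa.analyticOrderAt_ne_top_of_isPreconnected isPreconnected_univ (mem_univ 1) (mem_univ s)
      (by rw [(hHa 1 (mem_univ 1)).analyticOrderAt_eq_zero.mpr h1]; simp)
  rw [Function.mem_support, MeromorphicOn.AnalyticOnNhd.divisor_apply
    (fun w _ ↦ hHa w (mem_univ w)) hsB]
  intro h
  rw [← Nat.cast_analyticOrderNatAt hHt] at h hH0
  simp at h hH0
  exact hH0 h

/-- For `z = 1` the Mellin pair is its own dual, so the completed function is invariant under `s ↦ 1
- s`. In the open critical strip it differs from `Z` by the nonvanishing factor `twist 1 0`. -/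
theorem analyticOrderAt_one_sub {a b c : ℝ} (ha : 0 < a) (hD : 4 * a * c - b ^ 2 = 4) {Z : ℂ → ℂ}
    (hZ : IsContinuation a b c Z) {s : ℂ} (hs0 : 0 < s.re) (hs1 : s.re < 1) :
    analyticOrderAt Z (1 - s) = analyticOrderAt Z s := by
  have hz : 0 < (1 : ℂ).re := by simp
  set P := rayPair ha hD hz norm_one with hP
  have hsymm : P.symm = P := by
    simp [WeakFEPair.symm, hP, rayPair]
  have hfe : P.Λ ∘ (fun s ↦ 1 - s) = P.Λ := by
    ext s
    have := P.functional_equation s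
    rw [hsymm] at this
    simpa [hP, rayPair] using this
  have hord : ∀ w : ℂ, 0 < w.re → w.re < 1 → analyticOrderAt P.Λ w = analyticOrderAt Z w :=
    fun w hw0 hw1 ↦ by
      rw [← analyticOrderAt_mul_of_ne_zero (f := Z) (analyticAt_twist one_pos 0 hw0)
        (twist_ne_zero one_pos 0 hw0)]
      refine analyticOrderAt_congr ?_
      filter_upwards [(isOpen_lt continuous_const continuous_re).mem_nhds hw0,
        (isOpen_lt continuous_re continuous_const).mem_nhds hw1] with v hv0 hv1
      rw [hP, rayPair_Λ_eq ha hD hz norm_one hZ hv0 (by rintro rfl; simp at hv1)]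
      simp [twist]
  rw [← hord s hs0 hs1, ← hord (1 - s) (by simpa using hs1) (by simpa using hs0), ← hfe,
    analyticOrderAt_comp_of_deriv_ne_zero (by fun_prop) (by simp), hfe, sub_sub_cancel]

/-! ### Transfer to arbitrary discriminant and to the counting functions. -/

theorem exists_scaled_order {a b c : ℝ} (ha : 0 < a) (hD : 0 < 4 * a * c - b ^ 2) :
    ∃ (a' b' c' : ℝ) (Z : ℂ → ℂ), 0 < a' ∧ 4 * a' * c' - b' ^ 2 = 4 ∧ IsContinuation a' b' c' Z ∧
      ∀ s, analyticOrderAt (epsteinZeta a b c) s = analyticOrderAt Z s := by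
  obtain ⟨r, hr, hr2⟩ : ∃ r : ℝ, 0 < r ∧ r ^ 2 * (4 * a * c - b ^ 2) = 4 :=
    ⟨2 / √(4 * a * c - b ^ 2), by positivity, by
      rw [div_pow, Real.sq_sqrt hD.le]; field_simp; norm_num⟩
  obtain ⟨hd, hs⟩ := isContinuation_epsteinZeta ha hD
  have hrC : (r : ℂ) ≠ 0 := ofReal_ne_zero.mpr hr.ne'
  have hdr : Differentiable ℂ fun s : ℂ ↦ (r : ℂ) ^ (-s) :=
    fun s ↦ differentiableAt_id.neg.const_cpow (Or.inl hrC)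
  refine ⟨r * a, r * b, r * c, fun s ↦ (r : ℂ) ^ (-s) * epsteinZeta a b c s, by positivity,
    by linear_combination hr2, ⟨hdr.differentiableOn.mul hd, fun s h ↦ ?_⟩, fun s ↦ ?_⟩
  · convert! (hs s h).mul_left ((r : ℂ) ^ (-s)) using 1
    ext p
    have : form (r * a) (r * b) (r * c) p = r * form a b c p := by simp only [form]; ring
    rw [this, ofReal_mul, mul_cpow_ofReal_nonneg hr.le (form_pos ha hD p.2).le]
  · refine (analyticOrderAt_mul_of_ne_zero ?_ (by simp [Complex.cpow_eq_zero_iff, hrC])).symm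
    exact hdr.analyticAt s

theorem lineCount_one_sub {a b c : ℝ} (ha : 0 < a) (hD : 0 < 4 * a * c - b ^ 2) {σ : ℝ}
    (hσ0 : 0 < σ) (hσ1 : σ < 1) (T : ℝ) : lineCount a b c (1 - σ) T = lineCount a b c σ T := by
  obtain ⟨a', b', c', Z, ha', hD', hZ, hord⟩ := exists_scaled_order ha hD
  let e : {s : ℂ // s.re = σ ∧ |s.im| ≤ T} ≃ {s : ℂ // s.re = 1 - σ ∧ |s.im| ≤ T} :=
    (Equiv.subLeft (1 : ℂ)).subtypeEquiv fun s ↦ by simp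
  rw [lineCount, lineCount, ← e.tsum_eq]
  refine tsum_congr fun s ↦ ?_
  rw [hord, hord, ← analyticOrderAt_one_sub ha' hD' hZ (s := s) (by rw [s.2.1]; exact hσ0)
    (by rw [s.2.1]; exact hσ1)]
  rfl

theorem lineCount_le_zeroCount (a b c σ T : ℝ) : lineCount a b c σ T ≤ zeroCount a b c σ T :=
  ENNReal.le_tsum (f := fun σ' : {σ' : ℝ // σ ≤ σ'} ↦ lineCount a b c σ' T) ⟨σ, le_rfl⟩

/-- The double sum over abscissae and points of a line runs over each complex number at most once,
so the uncountable sum collapses to a finite one. -/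
theorem zeroCount_le_sum {a b c σ T : ℝ} (S : Finset ℂ)
    (hS : ∀ s : ℂ, σ ≤ s.re → |s.im| ≤ T → analyticOrderAt (epsteinZeta a b c) s ≠ 0 → s ∈ S) :
    zeroCount a b c σ T ≤ ∑ s ∈ S, ((analyticOrderAt (epsteinZeta a b c) s : ℕ∞) : ENNReal) := by
  classical
  let F : ℂ → ENNReal := fun s ↦ ((analyticOrderAt (epsteinZeta a b c) s : ℕ∞) : ENNReal)
  let g : (Σ σ' : {σ' : ℝ // σ ≤ σ'}, {s : ℂ // s.re = σ' ∧ |s.im| ≤ T}) → ℂ := fun x ↦ x.2.1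
  have hg : Function.Injective g := by
    rintro ⟨⟨σ₁, h₁⟩, ⟨s, h₂, h₃⟩⟩ ⟨⟨σ₂, h₄⟩, ⟨s', h₅, h₆⟩⟩ h
    obtain rfl : s = s' := h
    obtain rfl : σ₁ = σ₂ := h₂.symm.trans h₅
    rfl
  have h1 : zeroCount a b c σ T = ∑' x, F (g x) :=
    (ENNReal.tsum_sigma' (fun x : Σ σ' : {σ' : ℝ // σ ≤ σ'}, {s : ℂ // s.re = σ' ∧ |s.im| ≤ T} ↦
      F (g x))).symm
  have h2 : ∀ x, F (g x) = (fun s ↦ if s ∈ S then F s else 0) (g x) := fun x ↦ by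
    beta_reduce
    split_ifs with h
    · rfl
    · by_contra h0
      refine h (hS _ (x.2.2.1 ▸ x.1.2) x.2.2.2 fun h' ↦ h0 ?_)
      simp [F, h']
  rw [h1, tsum_congr h2]
  refine (ENNReal.tsum_comp_le_tsum_of_injective hg (fun s ↦ if s ∈ S then F s else 0)).trans (le_of_eq ?_)
  rw [tsum_eq_sum (s := S) fun s hs ↦ if_neg hs]
  exact Finset.sum_congr rfl fun s hs ↦ if_pos hs

/-- The zeros with real part at least `3 / 4` are linearly bounded in number. -/
theorem zeroCount_le {a b c : ℝ} (ha : 0 < a) (hD : 0 < 4 * a * c - b ^ 2) :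
    (∀ T, zeroCount a b c (3 / 4) T ≠ ⊤) ∧ ∃ B C t₀ : ℝ, 0 ≤ B ∧ 0 ≤ C ∧
      ∀ T, t₀ ≤ T → (zeroCount a b c (3 / 4) T).toReal ≤ B + C * T := by
  classical
  obtain ⟨a', b', c', Z, ha', hD', hZ, hord⟩ := exists_scaled_order ha hD
  obtain ⟨A, C, t₀, hC, hA, hcount⟩ := exists_sum_order_le ha' hD' hZ
  let S : ℝ → Finset ℂ := fun T ↦ (finite_zeros ha' hD' hZ (3 / 4) T).toFinset
  have hS : ∀ T s, s ∈ S T ↔ 3 / 4 ≤ s.re ∧ |s.im| ≤ T ∧ analyticOrderAt Z s ≠ 0 := fun T s ↦ by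
    simp [S]
  have hle : ∀ T, zeroCount a b c (3 / 4) T ≤
      ((∑ s ∈ S T, analyticOrderNatAt Z s : ℕ) : ENNReal) := fun T ↦ by
    refine (zeroCount_le_sum (S T) fun s h1 h2 h3 ↦ (hS T s).mpr ⟨h1, h2, hord s ▸ h3⟩).trans
      (le_of_eq ?_)
    rw [Nat.cast_sum]
    refine Finset.sum_congr rfl fun s _ ↦ ?_
    rw [hord, ← Nat.cast_analyticOrderNatAt (analyticOrderAt_ne_top ha' hD' hZ s)]
    simp
  refine ⟨fun T ↦ ((hle T).trans_lt (ENNReal.natCast_lt_top _)).ne,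
    -- The zeros of height below `t₀` are finite in number and go into the constant term; the linear
    -- bound handles the rest.
    ∑ s ∈ S t₀, (analyticOrderNatAt Z s : ℝ), C, t₀ + 1, by positivity, hC, fun T hT ↦ ?_⟩
  refine (ENNReal.toReal_mono (ENNReal.natCast_ne_top _) (hle T)).trans ?_
  rw [ENNReal.toReal_natCast, Nat.cast_sum,
    ← Finset.sum_filter_not_add_sum_filter (S T) fun s ↦ t₀ ≤ |s.im|]
  refine add_le_add (Finset.sum_le_sum_of_subset_of_nonneg (fun s hs ↦ ?_) fun _ _ _ ↦ by positivity)
    (hcount T hT _ fun s hs ↦ ?_)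
  · obtain ⟨h1, h2⟩ := Finset.mem_filter.mp hs
    obtain ⟨h3, -, h5⟩ := (hS T s).mp h1
    exact (hS t₀ s).mpr ⟨h3, (not_le.mp h2).le, h5⟩
  · obtain ⟨h1, h2⟩ := Finset.mem_filter.mp hs
    obtain ⟨h3, h4, h5⟩ := (hS T s).mp h1
    refine ⟨h3, ?_, h2, h4⟩
    by_contra h
    exact hA s (not_lt.mp h) (analyticOrderAt_ne_zero.mp h5).2

theorem zeroCount_isLittleO {a b c : ℝ} (ha : 0 < a) (hD : 0 < 4 * a * c - b ^ 2) :
    (fun T : ℝ ↦ (zeroCount a b c (3 / 4) T).toReal) =o[atTop] fun T : ℝ ↦ T * Real.log T := by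
  obtain ⟨-, B, C, t₀, hB, hC, h⟩ := zeroCount_le ha hD
  have h1 : (fun T : ℝ ↦ (zeroCount a b c (3 / 4) T).toReal) =O[atTop] fun T : ℝ ↦ T * 1 := by
    refine IsBigO.of_bound (B + C) ?_
    filter_upwards [eventually_ge_atTop t₀, eventually_ge_atTop 1] with T hT hT1
    rw [mul_one, Real.norm_of_nonneg ENNReal.toReal_nonneg, Real.norm_of_nonneg (by linarith)]
    nlinarith [h T hT]
  refine h1.trans_isLittleO ((isBigO_refl _ _).mul_isLittleO ?_)
  exact (isLittleO_const_left.mpr (Or.inr (tendsto_norm_atTop_atTop.comp tendsto_log_atTop)))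

end EpsteinZeta

theorem mainTheorem2 (a b c : ℝ) (ha : 0 < a) (hD : 0 < 4 * a * c - b ^ 2) :
    (∀ T : ℝ, 0 < T →
      EpsteinZeta.lineCount a b c (1 / 4) T = EpsteinZeta.lineCount a b c (3 / 4) T ∧
      EpsteinZeta.lineCount a b c (3 / 4) T ≤ EpsteinZeta.zeroCount a b c (3 / 4) T ∧
      EpsteinZeta.zeroCount a b c (3 / 4) T ≠ ⊤) ∧
    (fun T : ℝ ↦ (EpsteinZeta.zeroCount a b c (3 / 4) T).toReal)
      =o[Filter.atTop] fun T : ℝ ↦ T * Real.log T := by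
  refine ⟨fun T _ ↦ ⟨?_, EpsteinZeta.lineCount_le_zeroCount a b c (3 / 4) T,
    (EpsteinZeta.zeroCount_le ha hD).1 T⟩, EpsteinZeta.zeroCount_isLittleO ha hD⟩
  have h := EpsteinZeta.lineCount_one_sub ha hD (σ := 3 / 4) (by norm_num) (by norm_num) T
  rwa [show (1 : ℝ) - 3 / 4 = 1 / 4 by norm_num] at h
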